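/- Let $n\ge 1$, $s\in(0,1)$, $p\in(1,\infty)$. Let $\mathbb{H}^n=\mathbb{R}^{2n+1}$ be the Heisenberg group, with points $\xi=(x,y,t)$, $x,y\in\mathbb{R}^n$, $t\in\mathbb R$, group law $\xi\circ\xi'=(x+x',\,y+y',\,t+t'+2\langle y,x'\rangle-2\langle x,y'\rangle)$, dilations $\Phi_\lambda(\xi)=(\lambda x,\lambda y,\lambda^2t)$, homogeneous dimension $Q=2n+2$, Lebesgue measure, standard homogeneous norm $|\xi|_{\mathbb{H}^n}=\big((|x|^2+|y|^2)^2+t^2\big)^{1/4}$ and balls $B_r(\xi)=\{\eta:|\xi^{-1}\circ\eta|_{\mathbb{H}^n}<r\}$. Let $d_{\rm o}:\mathbb{H}^n\to[0,\infty)$ be a homogeneous norm, i.e. a continuous function with $d_{\rm o}(\Phi_\lambda(\xi))=\lambda d_{\rm o}(\xi)$ for all $\lambda>0$, and $d_{\rm o}(\xi)=0$ if and only if $\xi=0$. Let $\Omega\subset\mathbb{H}^n$ be open, and let $f:\mathbb{H}^n\times\mathbb{R}\to\mathbb{R}$ be such that $f(\cdot,x)$ is measurable and belongs to $L^\infty_{\rm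 loc}(\mathbb{H}^n)$ for every $x\in\mathbb R$, $f(\xi,\cdot)$ is continuous for a.e. $\xi$, and for every compact $K\subset\Omega$ there is a constant $C$ with $|f(\xi,x)|\le C$ for every $x\in\mathbb{R}$ and a.e. $\xi\in K$. For $D\subset\mathbb{H}^n$ open, $W^{s,p}(D)$ is the space of all $u\in L^p(D)$ with $\dfrac{|u(\xi)-u(\eta)|}{|\eta^{-1}\circ\xi|_{\mathbb{H}^n}^{Q/p+s}}\in L^p(D\times D)$, and $u\in W^{s,p}_{\rm loc}(\Omega)$ means $u\in W^{s,p}(D)$ for every open $D\Subset\Omega$. Moreover, $L^{p-1}_{sp}(\mathbb{H}^n)$ is the set of all $v\in L^{p-1}_{\rm loc}(\mathbb{H}^n)$ with $\int_{\mathbb{H}^n}|v(\xi)|^{p-1}(1+|\xi|_{\mathbb{H}^n})^{-Q-sp}\,d\xi<\infty$. A measurable function $u:\mathbb{H}^n\to\mathbb{R}$ is a weak supersolution in $\Omega$ if $u\in W^{s,p}_{\rm loc}(\Omega)$, $u_-=\max(-u,0)\in L^{p-1}_{sp}(\mathbb{H}^n)$ and, for every nonnegative $\psi\in C_0^\infty(\Omega)$,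 $$\int_{\mathbb{H}^n}\int_{\mathbb{H}^n}\frac{|u(\xi)-u(\eta)|^{p-2}(u(\xi)-u(\eta))(\psi(\xi)-\psi(\eta))}{d_{\rm o}(\eta^{-1}\circ\xi)^{Q+sp}}\,d\xi\,d\eta\ \ge\ \int_{\mathbb{H}^n}f(\xi,u(\xi))\psi(\xi)\,d\xi,$$ where the double integral, which always exists in $[-\infty,\infty)$, is in particular required to be finite. Theorem. Let $u$ be a weak supersolution in $\Omega$. Then $$u(\xi)=\operatorname*{ess\,lim\,inf}_{\eta\to\xi}u(\eta):=\lim_{r\to0^+}\operatorname*{ess\,inf}_{B_r(\xi)}u\qquad\text{for a.e. }\xi\in\Omega.$$ In particular, $u$ has a lower semicontinuous representative in $\Omega$: there is a lower semicontinuous function $v:\Omega\to(-\infty,+\infty]$ with $u=v$ a.e. in $\Omega$. -/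

import Mathlib

open MeasureTheory Set Filter Topology
open scoped ENNReal ContDiff

noncomputable section

/-- The underlying space `ℝ²ⁿ⁺¹` of the Heisenberg group; points are `ξ = (x, y, t)`.
The topology, the smooth structure and the (Lebesgue) measure are those of `ℝ²ⁿ⁺¹`. -/
abbrev Heis (n : ℕ) : Type :=
  EuclideanSpace ℝ (Fin n) × EuclideanSpace ℝ (Fin n) × ℝ

namespace Heis

variable {n : ℕ}

/-- The group law `ξ ∘ ξ' = (x + x', y + y', t + t' + 2⟨y, x'⟩ - 2⟨x, y'⟩)`. -/
def op (ξ ξ' : Heis n) : Heis n :=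
  (ξ.1 + ξ'.1, ξ.2.1 + ξ'.2.1,
    ξ.2.2 + ξ'.2.2 + 2 * inner ℝ ξ.2.1 ξ'.1 - 2 * inner ℝ ξ.1 ξ'.2.1)

/-- The inverse `ξ⁻¹ = (-x, -y, -t)` for the group law `Heis.op`. -/
def inverse (ξ : Heis n) : Heis n := (-ξ.1, -ξ.2.1, -ξ.2.2)

/-- `Heis.inverse` is an inverse for the group law, with the origin as neutral element. -/
theorem op_inverse (ξ : Heis n) : op ξ (inverse ξ) = 0 := by
  simp [op, inverse, real_inner_comm, Prod.ext_iff]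

/-- The anisotropic dilations `Φ_r(x, y, t) = (r x, r y, r² t)`. -/
def dilation (r : ℝ) (ξ : Heis n) : Heis n := (r • ξ.1, r • ξ.2.1, r ^ 2 * ξ.2.2)

/-- The homogeneous dimension `Q = 2n + 2`. -/
def homDim (n : ℕ) : ℝ := 2 * n + 2

/-- A homogeneous norm on the Heisenberg group. No symmetry and no triangle inequality is
required. -/
structure IsHomogeneousNorm (d : Heis n → ℝ) : Prop where
  continuous : Continuous d
  nonneg : ∀ ξ, 0 ≤ d ξ
  dilation : ∀ r : ℝ, 0 < r → ∀ ξ, d (dilation r ξ) = r * d ξ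
  eq_zero_iff : ∀ ξ, d ξ = 0 ↔ ξ = 0

/-- The standard homogeneous norm `|ξ| = (|z|⁴ + t²)^(1/4)`, where `z = (x, y)`. -/
def hnorm (ξ : Heis n) : ℝ :=
  ((‖ξ.1‖ ^ 2 + ‖ξ.2.1‖ ^ 2) ^ 2 + ξ.2.2 ^ 2) ^ (1 / 4 : ℝ)

/-- The ball `B_r(ξ₀) = {ξ : |ξ₀⁻¹ ∘ ξ| < r}` of the standard homogeneous norm. -/
def hball (ξ₀ : Heis n) (r : ℝ) : Set (Heis n) :=
  {ξ | hnorm (op (inverse ξ₀) ξ) < r}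

/-- `u ∈ W^{s,p}(D)`: `u ∈ L^p(D)` and
`|u(ξ) - u(η)| / |η⁻¹ ∘ ξ|^(Q/p + s) ∈ L^p(D × D)`. -/
def MemFracSobolev (s p : ℝ) (D : Set (Heis n)) (u : Heis n → ℝ) : Prop :=
  MemLp u (ENNReal.ofReal p) (volume.restrict D) ∧
  MemLp (fun z : Heis n × Heis n =>
      |u z.1 - u z.2| / hnorm (op (inverse z.2) z.1) ^ (homDim n / p + s))
    (ENNReal.ofReal p) ((volume.restrict D).prod (volume.restrict D))

/-- `u ∈ W^{s,p}_loc(Ω)`: `u ∈ W^{s,p}(D)` for every open `D ⋐ Ω`. -/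
def MemFracSobolevLoc (s p : ℝ) (Ω : Set (Heis n)) (u : Heis n → ℝ) : Prop :=
  ∀ D : Set (Heis n), IsOpen D → IsCompact (closure D) → closure D ⊆ Ω →
    MemFracSobolev s p D u

/-- `v ∈ L^{p-1}_{sp}(ℍⁿ)`: `v ∈ L^{p-1}_loc(ℍⁿ)` and
`∫ |v(ξ)|^(p-1) / (1 + |ξ|)^(Q + sp) dξ < ∞`. -/
def MemTailSpace (s p : ℝ) (v : Heis n → ℝ) : Prop :=
  (∀ K : Set (Heis n), IsCompact K →
    MemLp v (ENNReal.ofReal (p - 1)) (volume.restrict K)) ∧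
  Integrable (fun ξ : Heis n => |v ξ| ^ (p - 1) / (1 + hnorm ξ) ^ (homDim n + s * p)) volume

/-- The conditions on the datum `f = f(ξ, x)`: it is a Carathéodory function, each `f(·, x)` is
locally essentially bounded, and the bound is uniform in `x` on compact subsets of `Ω`. -/
structure IsDatum (Ω : Set (Heis n)) (f : Heis n → ℝ → ℝ) : Prop where
  measurable : ∀ x : ℝ, AEStronglyMeasurable (fun ξ => f ξ x) (volume : Measure (Heis n))
  continuous : ∀ᵐ ξ ∂(volume : Measure (Heis n)), Continuous (f ξ)
  locBounded : ∀ x : ℝ, ∀ K : Set (Heis n), IsCompact K →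
    ∃ C : ℝ, ∀ᵐ ξ ∂(volume.restrict K), |f ξ x| ≤ C
  uniform : ∀ K : Set (Heis n), IsCompact K → K ⊆ Ω →
    ∃ C : ℝ, ∀ x : ℝ, ∀ᵐ ξ ∂(volume.restrict K), |f ξ x| ≤ C

/-- The integrand
`|u(ξ) - u(η)|^(p-2) (u(ξ) - u(η)) (ψ(ξ) - ψ(η)) / d(η⁻¹ ∘ ξ)^(Q + sp)`
of the weak formulation, at `z = (ξ, η)`. -/
def energyIntegrand (s p : ℝ) (d : Heis n → ℝ) (u ψ : Heis n → ℝ) (z : Heis n × Heis n) : ℝ :=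
  |u z.1 - u z.2| ^ (p - 2) * (u z.1 - u z.2) * (ψ z.1 - ψ z.2)
    / d (op (inverse z.2) z.1) ^ (homDim n + s * p)

/-- `u` is a weak supersolution in `Ω` to `𝓛 u = f`. For `u` in the stated function classes and
`ψ ≥ 0`, the positive part of the integrand is always integrable, so that the double integral is
defined in `[-∞, ∞)`; the inequality includes that it is finite, which is the first conjunct. -/
structure IsWeakSupersolution (s p : ℝ) (d : Heis n → ℝ) (f : Heis n → ℝ → ℝ)
    (Ω : Set (Heis n)) (u : Heis n → ℝ) : Prop where
  measurable : AEStronglyMeasurable u (volume : Measure (Heis n))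
  memLoc : MemFracSobolevLoc s p Ω u
  negPart : MemTailSpace s p (fun ξ => max (-u ξ) 0)
  weak : ∀ ψ : Heis n → ℝ, ContDiff ℝ ∞ ψ → HasCompactSupport ψ → tsupport ψ ⊆ Ω →
    (∀ ξ, 0 ≤ ψ ξ) →
      Integrable (energyIntegrand s p d u ψ)
        ((volume : Measure (Heis n)).prod (volume : Measure (Heis n))) ∧
      ∫ ξ, f ξ (u ξ) * ψ ξ ≤
        ∫ z, energyIntegrand s p d u ψ z
          ∂((volume : Measure (Heis n)).prod (volume : Measure (Heis n)))

/-- `ess liminf_{η → ξ} u(η) = lim_{r → 0⁺} ess inf_{B_r(ξ)} u`, as an extended real number.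
The essential infimum increases as `r` decreases, so the limit is a supremum. -/
def essLiminf (u : Heis n → ℝ) (ξ : Heis n) : EReal :=
  ⨆ (r : ℝ) (_ : 0 < r),
    essInf (fun η => (u η : EReal)) (volume.restrict (hball ξ r))

end Heis

end

/-! That ess lim inf u ≤ u a.e. is true of every function; the equation is needed only for the
reverse inequality. The core is a De Giorgi lemma (`exists_deGiorgi`): if the mean of (k - u)_+^p
over B_r(ξ₀) is small compared with ε^p, and the tail and the datum are at most of order ε^(p-1)
r^(-sp), then u ≥ k - ε a.e. on B_{r/2}(ξ₀). Suppose it is available at all small radii about each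
point (`exists_threshold`). At a.e. ξ with u(ξ) ≥ k, the function (k - u)_+^p, which vanishes at ξ,
has arbitrarily small means over some arbitrarily small balls about ξ
(`ae_exists_lintegral_hball_le`). Hence ess lim inf u ≥ k - ε there, and rational k suffice.

For the De Giorgi lemma, test with (k - u)_+ φ^p and read the weak inequality as "negative part of
the energy ≤ positive part + datum". The positive part satisfies a Caccioppoli estimate
(`lintegral_energy_testFun_le`). For the negative part no fractional Sobolev inequality is used: a
point ξ with u(ξ) < k interacts with every η in B_ρ(ξ) with u(η) ≥ k, and these η fill at least
|B_ρ| - |{u < k}|. So the negative part is at least c ρ^(-Q-sp) (|B_ρ| - |{u < k}|) ∫ (k - u)_+^p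
(`lintegral_neg_energy_testFun_ge`). Taking |B_ρ| twice the Chebyshev bound of |{u < k}| turns this
into a gain of power sp/Q, that is, a superlinear recursion over shrinking balls and decreasing
levels, whose solutions tend to 0 when they start small.

Two obstacles remain. The test function is not smooth, and u_+ is not controlled at infinity, so the
energies of smooth approximations cannot be passed to the limit by domination. Mollification by left
translations commutes with the left invariant kernel and converges in the fractional norm. The
positive part of the integrand sees far values of u only through u_-, so its errors are estimated
directly; the negative part is handled by Fatou (`lintegral_neg_energy_le`). Secondly, the tail must
be O(r^(-sp)) as r → 0. This follows from a local lower bound on u, which is the De Giorgi lemma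
itself on one ball with level 0 and a huge ε (`exists_lower_bound`). -/

noncomputable section

namespace Heis

variable {n : ℕ}

/-! ### The group structure -/

theorem op_assoc (a b c : Heis n) : op (op a b) c = op a (op b c) := by
  simp only [op, Prod.mk.injEq, inner_add_left, inner_add_right]
  refine ⟨add_assoc _ _ _, add_assoc _ _ _, by ring⟩

theorem inverse_op_self (a : Heis n) : op (inverse a) a = 0 := by
  simp [op, inverse, real_inner_comm, Prod.ext_iff]

theorem op_zero (a : Heis n) : op a 0 = a := by
  simp [op]

theorem zero_op (a : Heis n) : op 0 a = a := by
  simp [op]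

theorem inverse_inverse (a : Heis n) : inverse (inverse a) = a := by
  simp [inverse]

theorem inverse_zero : inverse (0 : Heis n) = 0 := by
  simp [inverse]

theorem inverse_op (a b : Heis n) : inverse (op a b) = op (inverse b) (inverse a) := by
  simp only [op, inverse, Prod.mk.injEq, inner_neg_left, inner_neg_right, real_inner_comm]
  refine ⟨by abel, by abel, by ring⟩

theorem inverse_op_cancel (a b : Heis n) : op (inverse a) (op a b) = b := by
  rw [← op_assoc, inverse_op_self, zero_op]

theorem op_inverse_cancel (a b : Heis n) : op a (op (inverse a) b) = b := by
  rw [← op_assoc, op_inverse, zero_op]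

theorem op_inverse_cancel_right (a b : Heis n) : op (op a b) (inverse b) = a := by
  rw [op_assoc, op_inverse, op_zero]

theorem inverse_op_cancel_right (a b : Heis n) : op (op a (inverse b)) b = a := by
  rw [op_assoc, inverse_op_self, op_zero]

/-- Left invariance of the kernel variable. This is why test functions are mollified by left
translations. -/
theorem inverse_op_op_left (c a b : Heis n) :
    op (inverse (op c a)) (op c b) = op (inverse a) b := by
  rw [inverse_op, op_assoc, inverse_op_cancel]

theorem contDiff_op : ContDiff ℝ ∞ (fun z : Heis n × Heis n => op z.1 z.2) := by
  unfold op
  have h1 : ContDiff ℝ ∞ fun z : Heis n × Heis n => inner ℝ z.1.2.1 z.2.1 :=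
    ContDiff.inner ℝ (by fun_prop) (by fun_prop)
  have h2 : ContDiff ℝ ∞ fun z : Heis n × Heis n => inner ℝ z.1.1 z.2.2.1 :=
    ContDiff.inner ℝ (by fun_prop) (by fun_prop)
  fun_prop

theorem contDiff_inverse : ContDiff ℝ ∞ (inverse : Heis n → Heis n) := by
  unfold inverse
  fun_prop

theorem continuous_op : Continuous (fun z : Heis n × Heis n => op z.1 z.2) :=
  contDiff_op.continuous

theorem continuous_inverse : Continuous (inverse : Heis n → Heis n) :=
  contDiff_inverse.continuous

@[fun_prop]
theorem _root_.Continuous.heisOp {X : Type*} [TopologicalSpace X] {f g : X → Heis n}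
    (hf : Continuous f) (hg : Continuous g) : Continuous fun x => op (f x) (g x) :=
  continuous_op.comp (hf.prodMk hg)

@[fun_prop]
theorem _root_.Continuous.heisInverse {X : Type*} [TopologicalSpace X] {f : X → Heis n}
    (hf : Continuous f) : Continuous fun x => inverse (f x) :=
  continuous_inverse.comp hf

@[fun_prop]
theorem _root_.Measurable.heisOp {X : Type*} [MeasurableSpace X] {f g : X → Heis n}
    (hf : Measurable f) (hg : Measurable g) : Measurable fun x => op (f x) (g x) :=
  continuous_op.measurable.comp (hf.prodMk hg)

@[fun_prop]
theorem _root_.Measurable.heisInverse {X : Type*} [MeasurableSpace X] {f : X → Heis n}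
    (hf : Measurable f) : Measurable fun x => inverse (f x) :=
  continuous_inverse.measurable.comp hf

/-! ### The standard homogeneous norm -/

theorem hnorm_nonneg (a : Heis n) : 0 ≤ hnorm a := by
  unfold hnorm; positivity

theorem hnorm_pow_four (a : Heis n) :
    hnorm a ^ 4 = (‖a.1‖ ^ 2 + ‖a.2.1‖ ^ 2) ^ 2 + a.2.2 ^ 2 := by
  unfold hnorm
  rw [← Real.rpow_natCast, ← Real.rpow_mul (by positivity)]
  norm_num

theorem hnorm_zero : hnorm (0 : Heis n) = 0 := by
  have := hnorm_pow_four (0 : Heis n)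
  simpa using this

theorem hnorm_eq_zero {a : Heis n} : hnorm a = 0 ↔ a = 0 := by
  refine ⟨fun h => ?_, fun h => h ▸ hnorm_zero⟩
  have h4 := hnorm_pow_four a
  rw [h] at h4
  have h1 : ‖a.1‖ ^ 2 + ‖a.2.1‖ ^ 2 = 0 := by nlinarith [sq_nonneg a.2.2, sq_nonneg ‖a.1‖]
  have h2 : a.2.2 = 0 := by nlinarith
  have h3 : ‖a.1‖ = 0 := by nlinarith [sq_nonneg ‖a.1‖, sq_nonneg ‖a.2.1‖]
  have h5 : ‖a.2.1‖ = 0 := by nlinarith [sq_nonneg ‖a.1‖, sq_nonneg ‖a.2.1‖]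
  rw [norm_eq_zero] at h3 h5
  exact Prod.ext h3 (Prod.ext h5 h2)

theorem hnorm_pos {a : Heis n} (h : a ≠ 0) : 0 < hnorm a :=
  lt_of_le_of_ne (hnorm_nonneg a) fun h' => h (hnorm_eq_zero.1 h'.symm)

theorem hnorm_inverse (a : Heis n) : hnorm (inverse a) = hnorm a := by
  simp [hnorm, inverse]

theorem continuous_hnorm : Continuous (hnorm : Heis n → ℝ) := by
  unfold hnorm
  refine Continuous.rpow_const (by fun_prop) fun _ => Or.inr (by norm_num)

@[fun_prop]
theorem _root_.Continuous.hnorm {X : Type*} [TopologicalSpace X] {f : X → Heis n}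
    (hf : Continuous f) : Continuous fun x => hnorm (f x) :=
  continuous_hnorm.comp hf

@[fun_prop]
theorem _root_.Measurable.hnorm {X : Type*} [MeasurableSpace X] {f : X → Heis n}
    (hf : Measurable f) : Measurable fun x => hnorm (f x) :=
  continuous_hnorm.measurable.comp hf

theorem hnorm_dilation {r : ℝ} (hr : 0 ≤ r) (a : Heis n) : hnorm (dilation r a) = r * hnorm a := by
  have h : hnorm (dilation r a) ^ 4 = (r * hnorm a) ^ 4 := by
    rw [mul_pow, hnorm_pow_four, hnorm_pow_four]
    simp only [dilation, norm_smul, Real.norm_eq_abs, abs_of_nonneg hr]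
    ring
  exact (pow_left_inj₀ (hnorm_nonneg _) (mul_nonneg hr (hnorm_nonneg _)) (by norm_num)).1 h

/-- The Cauchy–Schwarz inequality for the complex inner product of `ℂⁿ`. -/
theorem inner_sq_add_inner_sq_le {E : Type*} [NormedAddCommGroup E] [InnerProductSpace ℝ E]
    (x y x' y' : E) :
    (inner ℝ x x' + inner ℝ y y') ^ 2 + (inner ℝ y x' - inner ℝ x y') ^ 2 ≤
      (‖x‖ ^ 2 + ‖y‖ ^ 2) * (‖x'‖ ^ 2 + ‖y'‖ ^ 2) := by
  set A := inner ℝ x x' + inner ℝ y y' with hA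
  set B := inner ℝ y x' - inner ℝ x y' with hB
  -- A x' - B y' and A y' + B x' are the real and imaginary parts of (A + iB)(x' + iy'), so A² + B²
  -- becomes a real inner product and the real Cauchy–Schwarz inequality applies.
  have h1 : A ^ 2 + B ^ 2 = inner ℝ x (A • x' - B • y') + inner ℝ y (A • y' + B • x') := by
    simp only [inner_add_right, inner_sub_right, inner_smul_right]
    rw [hA, hB]; ring
  have h2 : ‖A • x' - B • y'‖ ^ 2 + ‖A • y' + B • x'‖ ^ 2
      = (A ^ 2 + B ^ 2) * (‖x'‖ ^ 2 + ‖y'‖ ^ 2) := by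
    rw [@norm_sub_sq_real, @norm_add_sq_real]
    simp only [inner_smul_left, inner_smul_right, norm_smul, Real.norm_eq_abs, mul_pow, sq_abs,
      RCLike.conj_to_real, real_inner_comm x' y']
    ring
  have h3 := real_inner_le_norm x (A • x' - B • y')
  have h4 := real_inner_le_norm y (A • y' + B • x')
  set S := A ^ 2 + B ^ 2 with hS
  have hS0 : 0 ≤ S := by positivity
  set P := ‖A • x' - B • y'‖
  set R := ‖A • y' + B • x'‖
  have h5 : S ^ 2 ≤ (‖x‖ ^ 2 + ‖y‖ ^ 2) * (S * (‖x'‖ ^ 2 + ‖y'‖ ^ 2)) := by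
    rw [← h2]
    have : S ≤ ‖x‖ * P + ‖y‖ * R := by linarith
    calc S ^ 2 ≤ (‖x‖ * P + ‖y‖ * R) ^ 2 := by gcongr
      _ ≤ _ := by nlinarith [sq_nonneg (‖x‖ * R - ‖y‖ * P)]
  rcases hS0.eq_or_lt with h0 | h0
  · rw [← h0]; positivity
  · exact le_of_mul_le_mul_left (by linarith [h5, sq S]) h0

/-- The triangle inequality of the Euclidean plane, in squared form. -/
theorem sq_add_sq_le_add_sq {a₁ b₁ a₂ b₂ N₁ N₂ : ℝ} (h₁ : 0 ≤ N₁) (h₂ : 0 ≤ N₂)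
    (h₃ : a₁ ^ 2 + b₁ ^ 2 ≤ N₁ ^ 2) (h₄ : a₂ ^ 2 + b₂ ^ 2 ≤ N₂ ^ 2) :
    (a₁ + a₂) ^ 2 + (b₁ + b₂) ^ 2 ≤ (N₁ + N₂) ^ 2 := by
  have h : a₁ * a₂ + b₁ * b₂ ≤ N₁ * N₂ := by
    refine (abs_le_of_sq_le_sq' ?_ (by positivity)).2
    calc (a₁ * a₂ + b₁ * b₂) ^ 2 ≤ (a₁ ^ 2 + b₁ ^ 2) * (a₂ ^ 2 + b₂ ^ 2) := by
          nlinarith [sq_nonneg (a₁ * b₂ - b₁ * a₂)]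
      _ ≤ N₁ ^ 2 * N₂ ^ 2 := by gcongr
      _ = (N₁ * N₂) ^ 2 := by ring
  nlinarith

/-- The triangle inequality for the standard homogeneous norm. -/
theorem hnorm_op_le (a b : Heis n) : hnorm (op a b) ≤ hnorm a + hnorm b := by
  obtain ⟨x, y, t⟩ := a
  obtain ⟨x', y', t'⟩ := b
  have ha := hnorm_pow_four (x, y, t)
  have hb := hnorm_pow_four (x', y', t')
  have hab := hnorm_pow_four (op (x, y, t) (x', y', t'))
  have ha0 := hnorm_nonneg (x, y, t)
  have hb0 := hnorm_nonneg (x', y', t')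
  have hab0 := hnorm_nonneg (op (x, y, t) (x', y', t'))
  generalize hnorm (x, y, t) = α at *
  generalize hnorm (x', y', t') = β at *
  generalize hnorm (op (x, y, t) (x', y', t')) = γ at *
  simp only [op] at hab ha hb
  rw [@norm_add_sq_real, @norm_add_sq_real] at hab
  have hcs := inner_sq_add_inner_sq_le x y x' y'
  set A := inner ℝ x x' + inner ℝ y y' with hA
  set B := inner ℝ y x' - inner ℝ x y' with hB
  set m := ‖x‖ ^ 2 + ‖y‖ ^ 2 with hm
  set m' := ‖x'‖ ^ 2 + ‖y'‖ ^ 2 with hm'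
  have hm0 : 0 ≤ m := by positivity
  have hm0' : 0 ≤ m' := by positivity
  -- Read m + it as a complex number of modulus α². The product of the two points corresponds to (m
  -- + it) + (m' + it') + 2(A + iB) with |A + iB| ≤ αβ, so its modulus γ² is at most α² + β² + 2αβ.
  have hab' : γ ^ 4 = (m + m' + 2 * A) ^ 2 + (t + t' + 2 * B) ^ 2 := by
    rw [hab, hA, hB, hm, hm']; ring
  have hmα : m ≤ α ^ 2 := by
    refine (abs_le_of_sq_le_sq' ?_ (by positivity)).2; nlinarith [sq_nonneg t]
  have hmβ : m' ≤ β ^ 2 := by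
    refine (abs_le_of_sq_le_sq' ?_ (by positivity)).2; nlinarith [sq_nonneg t']
  have hAB : A ^ 2 + B ^ 2 ≤ (α * β) ^ 2 := by
    rw [mul_pow]
    exact hcs.trans (by gcongr)
  have k1 : (m + m') ^ 2 + (t + t') ^ 2 ≤ (α ^ 2 + β ^ 2) ^ 2 :=
    sq_add_sq_le_add_sq (by positivity) (by positivity)
      (by rw [← ha]; exact le_of_eq (by ring)) (by rw [← hb]; exact le_of_eq (by ring))
  have k2 : (m + m' + 2 * A) ^ 2 + (t + t' + 2 * B) ^ 2 ≤ (α ^ 2 + β ^ 2 + 2 * (α * β)) ^ 2 :=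
    sq_add_sq_le_add_sq (by positivity) (by positivity) k1 (by linarith)
  have k3 : γ ^ 4 ≤ (α + β) ^ 4 := by
    rw [hab']; refine k2.trans (le_of_eq (by ring))
  exact (pow_le_pow_iff_left₀ hab0 (by positivity) (by norm_num)).1 k3

/-- The distance `|η⁻¹ ∘ ξ|` is symmetric. -/
theorem hnorm_inverse_op_comm (a b : Heis n) :
    hnorm (op (inverse a) b) = hnorm (op (inverse b) a) := by
  rw [← hnorm_inverse, inverse_op, inverse_inverse]

theorem hnorm_inverse_op_triangle (a b c : Heis n) :
    hnorm (op (inverse a) c) ≤ hnorm (op (inverse a) b) + hnorm (op (inverse b) c) := by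
  have := hnorm_op_le (op (inverse a) b) (op (inverse b) c)
  rwa [op_assoc, op_inverse_cancel] at this

theorem hnorm_inverse_op_pos {a b : Heis n} (h : a ≠ b) : 0 < hnorm (op (inverse a) b) := by
  refine hnorm_pos fun h' => h ?_
  have := op_inverse_cancel a b
  rw [h', op_zero] at this
  exact this

theorem mem_hball {a b : Heis n} {r : ℝ} : b ∈ hball a r ↔ hnorm (op (inverse a) b) < r := Iff.rfl

theorem mem_hball_self {a : Heis n} {r : ℝ} (hr : 0 < r) : a ∈ hball a r := by
  rw [mem_hball, inverse_op_self, hnorm_zero]; exact hr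

theorem hball_subset_hball {a b : Heis n} {r R : ℝ} (h : hnorm (op (inverse a) b) + r ≤ R) :
    hball b r ⊆ hball a R := by
  intro c hc
  rw [mem_hball] at hc ⊢
  linarith [hnorm_inverse_op_triangle a b c]

theorem hball_mono {a : Heis n} {r R : ℝ} (h : r ≤ R) : hball a r ⊆ hball a R :=
  fun _ hc => mem_hball.2 ((mem_hball.1 hc).trans_le h)

theorem isOpen_hball (a : Heis n) (r : ℝ) : IsOpen (hball a r) :=
  isOpen_lt (by fun_prop) continuous_const

theorem measurableSet_hball (a : Heis n) (r : ℝ) : MeasurableSet (hball a r) :=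
  (isOpen_hball a r).measurableSet

theorem norm_le_of_hnorm_le {a : Heis n} {r : ℝ} (h : hnorm a ≤ r) : ‖a‖ ≤ max r (r ^ 2) := by
  have h4 := hnorm_pow_four a
  have h0 := hnorm_nonneg a
  have hr0 : 0 ≤ r := h0.trans h
  have h5 : hnorm a ^ 2 ≤ r ^ 2 := by gcongr
  have h6 : ‖a.1‖ ^ 2 + ‖a.2.1‖ ^ 2 ≤ hnorm a ^ 2 := by
    refine (abs_le_of_sq_le_sq' ?_ (by positivity)).2; nlinarith [sq_nonneg a.2.2]
  have h7 : |a.2.2| ≤ hnorm a ^ 2 := by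
    apply abs_le_of_sq_le_sq _ (by positivity); nlinarith [sq_nonneg (‖a.1‖ ^ 2 + ‖a.2.1‖ ^ 2)]
  rw [Prod.norm_def, Prod.norm_def]
  refine max_le ?_ (max_le ?_ ?_)
  · exact le_max_of_le_left (abs_le_of_sq_le_sq' (by nlinarith [sq_nonneg ‖a.2.1‖]) hr0).2
  · exact le_max_of_le_left (abs_le_of_sq_le_sq' (by nlinarith [sq_nonneg ‖a.1‖]) hr0).2
  · exact le_max_of_le_right (by rw [Real.norm_eq_abs]; linarith)

theorem isCompact_hnorm_le (r : ℝ) : IsCompact {a : Heis n | hnorm a ≤ r} := by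
  refine Metric.isCompact_of_isClosed_isBounded (isClosed_le continuous_hnorm continuous_const) ?_
  refine (Metric.isBounded_closedBall (x := (0 : Heis n)) (r := max r (r ^ 2))).subset ?_
  intro a ha
  simpa using norm_le_of_hnorm_le ha

/-- The closed ball of the standard homogeneous norm. -/
def closedHball (ξ₀ : Heis n) (r : ℝ) : Set (Heis n) :=
  {ξ | hnorm (op (inverse ξ₀) ξ) ≤ r}

theorem mem_closedHball {a b : Heis n} {r : ℝ} :
    b ∈ closedHball a r ↔ hnorm (op (inverse a) b) ≤ r := Iff.rfl

theorem isCompact_closedHball (a : Heis n) (r : ℝ) : IsCompact (closedHball a r) := by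
  have : closedHball a r = (fun b => op a b) '' {b : Heis n | hnorm b ≤ r} := by
    ext b
    simp only [mem_closedHball, mem_image, mem_ofPred_eq]
    refine ⟨fun h => ⟨_, h, op_inverse_cancel a b⟩, ?_⟩
    rintro ⟨c, hc, rfl⟩
    rwa [inverse_op_cancel]
  rw [this]
  exact (isCompact_hnorm_le r).image (by fun_prop)

theorem hball_subset_closedHball (a : Heis n) (r : ℝ) : hball a r ⊆ closedHball a r :=
  fun _ hb => mem_closedHball.2 (mem_hball.1 hb).le

theorem closedHball_subset_hball {a : Heis n} {r R : ℝ} (h : r < R) :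
    closedHball a r ⊆ hball a R :=
  fun _ hb => mem_hball.2 ((mem_closedHball.1 hb).trans_lt h)

theorem closure_hball_subset (a : Heis n) (r : ℝ) : closure (hball a r) ⊆ closedHball a r :=
  closure_minimal (hball_subset_closedHball a r) (isCompact_closedHball a r).isClosed

theorem isCompact_closure_hball (a : Heis n) (r : ℝ) : IsCompact (closure (hball a r)) :=
  (isCompact_closedHball a r).of_isClosed_subset isClosed_closure (closure_hball_subset a r)

theorem exists_closedHball_subset {U : Set (Heis n)} (hU : IsOpen U) {a : Heis n} (ha : a ∈ U) :
    ∃ r, 0 < r ∧ closedHball a r ⊆ U := by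
  have hc : Continuous fun b : Heis n => op a b := by fun_prop
  have h0 : (fun b : Heis n => op a b) ⁻¹' U ∈ 𝓝 (0 : Heis n) :=
    hc.continuousAt.preimage_mem_nhds (by rw [op_zero]; exact hU.mem_nhds ha)
  obtain ⟨ε, hε, hb⟩ := Metric.mem_nhds_iff.1 h0
  -- For a radius r ≤ 1 one has r² ≤ r, so the quadratic scaling of t does no harm in the bound
  -- max(r, r²).
  refine ⟨min 1 (ε / 2), by positivity, fun b hb' => ?_⟩
  have h1 := norm_le_of_hnorm_le (mem_closedHball.1 hb')
  have h2 : ‖op (inverse a) b‖ < ε := by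
    refine h1.trans_lt (max_lt ?_ ?_)
    · exact (min_le_right _ _).trans_lt (by linarith)
    · have : (min 1 (ε / 2)) ^ 2 ≤ min 1 (ε / 2) := by
        have h3 : min 1 (ε / 2) ≤ 1 := min_le_left _ _
        have h4 : 0 < min 1 (ε / 2) := by positivity
        nlinarith
      exact (this.trans (min_le_right _ _)).trans_lt (by linarith)
  have := hb (mem_ball_zero_iff.2 h2)
  simpa [op_inverse_cancel] using this

/-! ### Lebesgue measure -/

/-- The map is triangular in (x, y, t): each coordinate is translated by an amount that depends only
on the preceding ones. Fubini then reduces the claim to the invariance of Lebesgue measure under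
ordinary translations. -/
theorem measurePreserving_op_left (a : Heis n) :
    MeasurePreserving (fun b => op a b) (volume : Measure (Heis n)) volume := by
  have h1 := measurePreserving_add_left (volume : Measure (EuclideanSpace ℝ (Fin n))) a.1
  have h2 := measurePreserving_add_left (volume : Measure (EuclideanSpace ℝ (Fin n))) a.2.1
  have h3 : ∀ x : EuclideanSpace ℝ (Fin n), MeasurePreserving
      (fun q : EuclideanSpace ℝ (Fin n) × ℝ => (a.2.1 + q.1,
        a.2.2 + q.2 + 2 * inner ℝ a.2.1 x - 2 * inner ℝ a.1 q.1)) volume volume := by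
    intro x
    refine h2.skew_product (g := fun y t => a.2.2 + t + 2 * inner ℝ a.2.1 x - 2 * inner ℝ a.1 y)
      (by fun_prop) (ae_of_all _ fun y => ?_)
    have := (measurePreserving_add_left (volume : Measure ℝ)
      (a.2.2 + 2 * inner ℝ a.2.1 x - 2 * inner ℝ a.1 y)).map_eq
    rw [← this]
    congr 1
    ext t
    ring
  exact h1.skew_product (g := fun x (q : EuclideanSpace ℝ (Fin n) × ℝ) => (a.2.1 + q.1,
        a.2.2 + q.2 + 2 * inner ℝ a.2.1 x - 2 * inner ℝ a.1 q.1))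
    (by unfold Function.uncurry; fun_prop) (ae_of_all _ fun x => (h3 x).map_eq)

theorem measurePreserving_op_right (a : Heis n) :
    MeasurePreserving (fun b => op b a) (volume : Measure (Heis n)) volume := by
  have h1 := measurePreserving_add_right (volume : Measure (EuclideanSpace ℝ (Fin n))) a.1
  have h2 := measurePreserving_add_right (volume : Measure (EuclideanSpace ℝ (Fin n))) a.2.1
  have h3 : ∀ x : EuclideanSpace ℝ (Fin n), MeasurePreserving
      (fun q : EuclideanSpace ℝ (Fin n) × ℝ => (q.1 + a.2.1,
        q.2 + a.2.2 + 2 * inner ℝ q.1 a.1 - 2 * inner ℝ x a.2.1)) volume volume := by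
    intro x
    refine h2.skew_product (g := fun y t => t + a.2.2 + 2 * inner ℝ y a.1 - 2 * inner ℝ x a.2.1)
      (by fun_prop) (ae_of_all _ fun y => ?_)
    have := (measurePreserving_add_left (volume : Measure ℝ)
      (a.2.2 + 2 * inner ℝ y a.1 - 2 * inner ℝ x a.2.1)).map_eq
    rw [← this]
    congr 1
    ext t
    ring
  exact h1.skew_product (g := fun x (q : EuclideanSpace ℝ (Fin n) × ℝ) => (q.1 + a.2.1,
        q.2 + a.2.2 + 2 * inner ℝ q.1 a.1 - 2 * inner ℝ x a.2.1))
    (by unfold Function.uncurry; fun_prop) (ae_of_all _ fun x => (h3 x).map_eq)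

theorem lintegral_op_left (a : Heis n) {F : Heis n → ℝ≥0∞} (hF : Measurable F) :
    ∫⁻ b, F (op a b) = ∫⁻ b, F b :=
  (measurePreserving_op_left a).lintegral_comp hF

theorem homDim_pos : 0 < homDim n := by unfold homDim; positivity

theorem map_dilation_volume {r : ℝ} (hr : 0 < r) :
    Measure.map (dilation r) (volume : Measure (Heis n))
      = ENNReal.ofReal (r ^ (-homDim n)) • volume := by
  have hr0 := hr.ne'
  have e1 := Measure.map_addHaar_smul (volume : Measure (EuclideanSpace ℝ (Fin n))) hr0
  have e2 := Measure.map_addHaar_smul (volume : Measure ℝ) (pow_ne_zero 2 hr0)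
  have e3 : (volume : Measure (Heis n)) = volume.prod (volume.prod volume) := rfl
  have e4 : (dilation r : Heis n → Heis n)
      = Prod.map (r • ·) (Prod.map (r • ·) ((r ^ 2) • ·)) := by
    ext1 a; simp [dilation, Prod.map]
  rw [e3, e4, ← Measure.map_prod_map _ _ (by fun_prop) (by fun_prop),
    ← Measure.map_prod_map _ _ (by fun_prop) (by fun_prop), e1, e2]
  simp only [Measure.prod_smul_left, Measure.prod_smul_right, smul_smul]
  congr 1
  rw [← ENNReal.ofReal_mul (by positivity), ← ENNReal.ofReal_mul (by positivity)]
  congr 1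
  simp only [finrank_euclideanSpace, Fintype.card_fin, Module.finrank_self]
  rw [abs_of_pos (by positivity), abs_of_pos (by positivity), Real.rpow_neg hr.le]
  have : r ^ homDim n = r ^ (2 * n + 2) := by
    rw [← Real.rpow_natCast]; congr 1; simp [homDim]
  rw [this]
  field_simp
  ring

theorem measurable_dilation (r : ℝ) : Measurable (dilation r : Heis n → Heis n) := by
  unfold dilation; fun_prop

theorem lintegral_dilation {r : ℝ} (hr : 0 < r) {F : Heis n → ℝ≥0∞} (hF : Measurable F) :
    ∫⁻ b, F (dilation r b) = ENNReal.ofReal (r ^ (-homDim n)) * ∫⁻ b, F b := by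
  rw [← lintegral_map hF (measurable_dilation r), map_dilation_volume hr, lintegral_smul_measure,
    smul_eq_mul]

end Heis
end

noncomputable section

namespace Heis

variable {n : ℕ}

/-! ### Volumes of balls -/

theorem volume_hball_eq_zero_center (a : Heis n) (r : ℝ) :
    volume (hball a r) = volume (hball (0 : Heis n) r) := by
  have h := (measurePreserving_op_left (inverse a)).measure_preimage
    (measurableSet_hball (0 : Heis n) r).nullMeasurableSet
  rw [← h]
  congr 1
  ext b
  simp [mem_hball, inverse_zero, zero_op]

theorem volume_hball (a : Heis n) {r : ℝ} (hr : 0 < r) :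
    volume (hball a r) = ENNReal.ofReal (r ^ homDim n) * volume (hball (0 : Heis n) 1) := by
  rw [volume_hball_eq_zero_center]
  have h := congrArg (fun μ => μ (hball (0 : Heis n) 1)) (map_dilation_volume (n := n) (inv_pos.2 hr))
  simp only [Measure.smul_apply, smul_eq_mul] at h
  rw [Measure.map_apply (measurable_dilation _) (measurableSet_hball _ _)] at h
  rw [Real.inv_rpow hr.le, ← Real.rpow_neg hr.le, neg_neg] at h
  rw [← h]
  congr 1
  ext b
  simp only [mem_hball, mem_preimage, inverse_zero, zero_op, hnorm_dilation (inv_pos.2 hr).le]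
  rw [inv_mul_lt_iff₀ hr, mul_one]

theorem volume_hball_lt_top (a : Heis n) (r : ℝ) : volume (hball a r) < ⊤ :=
  (measure_mono (hball_subset_closedHball a r)).trans_lt (isCompact_closedHball a r).measure_lt_top

theorem volume_hball_pos (a : Heis n) {r : ℝ} (hr : 0 < r) : 0 < volume (hball a r) :=
  (isOpen_hball a r).measure_pos _ ⟨a, mem_hball_self hr⟩

/-! ### Integrals of the kernel -/

/-- Comparison of an integral with a series: the piece `A j` contributes at most `c j` times the
volume of a ball of radius `R j`. It is applied to dyadic annuli. -/
theorem lintegral_lt_top_of_forall_le {F : Heis n → ℝ≥0∞} {S : Set (Heis n)}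
    (A : ℕ → Set (Heis n)) (c R : ℕ → ℝ) (hS : S ⊆ ⋃ j, A j) (hR : ∀ j, 0 < R j)
    (hc : ∀ j, 0 ≤ c j) (hA : ∀ j, A j ⊆ hball 0 (R j)) (hAm : ∀ j, MeasurableSet (A j))
    (hF : ∀ j, ∀ h ∈ A j, F h ≤ ENNReal.ofReal (c j))
    (hsum : Summable fun j => c j * R j ^ homDim n) : ∫⁻ h in S, F h < ⊤ := by
  calc ∫⁻ h in S, F h ≤ ∫⁻ h in ⋃ j, A j, F h := lintegral_mono_set hS
    _ ≤ ∑' j, ∫⁻ h in A j, F h := lintegral_iUnion_le _ _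
    _ ≤ ∑' j, ENNReal.ofReal (c j * R j ^ homDim n) * volume (hball (0 : Heis n) 1) := by
        refine ENNReal.tsum_le_tsum fun j => ?_
        calc ∫⁻ h in A j, F h ≤ ∫⁻ h in A j, ENNReal.ofReal (c j) :=
              setLIntegral_mono' (hAm j) (hF j)
          _ = ENNReal.ofReal (c j) * volume (A j) := setLIntegral_const _ _
          _ ≤ ENNReal.ofReal (c j) * volume (hball (0 : Heis n) (R j)) := by
              gcongr; exact hA j
          _ = _ := by rw [volume_hball _ (hR j), ENNReal.ofReal_mul (hc j), mul_assoc]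
    _ = (∑' j, ENNReal.ofReal (c j * R j ^ homDim n)) * volume (hball (0 : Heis n) 1) :=
        ENNReal.tsum_mul_right
    _ < ⊤ := by
        refine ENNReal.mul_lt_top ?_ (volume_hball_lt_top _ _)
        rw [← ENNReal.ofReal_tsum_of_nonneg (fun j => ?_) hsum]
        · exact ENNReal.ofReal_lt_top
        · have := hR j; have := hc j; positivity

/-- The kernel `min(1, L|h|)^p |h|^(-(Q + sp))`. -/
def cutKernel (s p L : ℝ) (h : Heis n) : ℝ≥0∞ :=
  ENNReal.ofReal (min 1 (L * hnorm h) ^ p * hnorm h ^ (-(homDim n + s * p)))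

theorem measurable_cutKernel (s p L : ℝ) : Measurable (cutKernel s p L : Heis n → ℝ≥0∞) := by
  unfold cutKernel
  fun_prop

/-- At infinity the kernel is at most |h|^(-Q-sp), and the j-th dyadic annulus contributes a
multiple of 2^(-spj). Near the origin the factor |h|^p leaves |h|^(p-Q-sp), with contribution
2^(-(p-sp)j), summable because s < 1. At the origin itself the factor 0^p makes the kernel vanish.
-/
theorem lintegral_cutKernel_one_lt_top {s p : ℝ} (hs : 0 < s) (hs1 : s < 1) (hp : 1 < p) :
    ∫⁻ h : Heis n, cutKernel s p 1 h < ⊤ := by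
  have hp0 : 0 < p := by linarith
  have hQ := homDim_pos (n := n)
  have hsp : 0 < s * p := by positivity
  have hq : 0 < homDim n + s * p := by positivity
  have hcov : (univ : Set (Heis n)) ⊆
      {h | 1 ≤ hnorm h} ∪ ({h | 0 < hnorm h ∧ hnorm h < 1} ∪ {0}) := by
    intro h _
    by_cases h0 : h = 0
    · exact Or.inr (Or.inr h0)
    · rcases lt_or_ge (hnorm h) 1 with h1 | h1
      · exact Or.inr (Or.inl ⟨hnorm_pos h0, h1⟩)
      · exact Or.inl h1
  rw [← setLIntegral_univ]
  refine (lintegral_mono_set hcov).trans_lt ((lintegral_union_le _ _ _).trans_lt ?_)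
  refine ENNReal.add_lt_top.2 ⟨?_, (lintegral_union_le _ _ _).trans_lt
    (ENNReal.add_lt_top.2 ⟨?_, ?_⟩)⟩
  · have e : ∀ j : ℕ, ((2 : ℝ) ^ j) ^ (-(homDim n + s * p)) * ((2 : ℝ) ^ (j + 1)) ^ homDim n
        = 2 ^ homDim n * ((2 : ℝ) ^ (-(s * p))) ^ j := by
      intro j
      rw [pow_succ, Real.mul_rpow (by positivity) (by norm_num), ← Real.rpow_natCast,
        ← Real.rpow_natCast, ← Real.rpow_mul (by norm_num), ← Real.rpow_mul (by norm_num),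
        ← Real.rpow_mul (by norm_num), ← Real.rpow_add (by norm_num), ← Real.rpow_add (by norm_num),
        ← Real.rpow_add (by norm_num)]
      congr 1; ring
    refine lintegral_lt_top_of_forall_le
      (fun j => {h | (2 : ℝ) ^ j ≤ hnorm h ∧ hnorm h < 2 ^ (j + 1)})
      (fun j => ((2 : ℝ) ^ j) ^ (-(homDim n + s * p))) (fun j => 2 ^ (j + 1)) ?_
      (fun j => by positivity) (fun j => by positivity) ?_ ?_ ?_ ?_
    · intro h hh
      obtain ⟨j, hj⟩ := exists_nat_pow_near (show 1 ≤ hnorm h from hh) one_lt_two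
      exact mem_iUnion.2 ⟨j, hj⟩
    · intro j h hh
      rw [mem_hball, inverse_zero, zero_op]
      exact hh.2
    · intro j
      exact (measurableSet_le measurable_const continuous_hnorm.measurable).inter
        (measurableSet_lt continuous_hnorm.measurable measurable_const)
    · intro j h hh
      refine ENNReal.ofReal_le_ofReal ?_
      have h2 : 0 < (2 : ℝ) ^ j := by positivity
      have h1 : (2 : ℝ) ^ j ≤ hnorm h := hh.1
      calc min 1 (1 * hnorm h) ^ p * hnorm h ^ (-(homDim n + s * p))
          ≤ 1 * hnorm h ^ (-(homDim n + s * p)) := by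
            have := hnorm_nonneg h
            gcongr
            exact Real.rpow_le_one (by positivity) (min_le_left _ _) hp0.le
        _ ≤ _ := by
            rw [one_mul]
            exact Real.rpow_le_rpow_of_nonpos h2 h1 (by linarith)
    · simp_rw [e]
      refine (summable_geometric_of_lt_one (by positivity) ?_).mul_left _
      exact Real.rpow_lt_one_of_one_lt_of_neg one_lt_two (by linarith)
  · have hps : 0 < p - s * p := by nlinarith
    have e : ∀ j : ℕ, ((((2 : ℝ)⁻¹) ^ j) ^ p * (((2 : ℝ)⁻¹) ^ (j + 1)) ^ (-(homDim n + s * p)))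
        * (2 * ((2 : ℝ)⁻¹) ^ j) ^ homDim n
        = (((2 : ℝ)⁻¹) ^ (-(homDim n + s * p)) * 2 ^ homDim n)
          * (((2 : ℝ)⁻¹) ^ (p - s * p)) ^ j := by
      intro j
      have h2 : (0 : ℝ) ≤ 2⁻¹ := by norm_num
      have h2' : (0 : ℝ) < 2⁻¹ := by norm_num
      rw [pow_succ, Real.mul_rpow (by positivity) (by positivity),
        Real.mul_rpow (by positivity) (by positivity), ← Real.rpow_natCast,
        ← Real.rpow_natCast, ← Real.rpow_mul h2, ← Real.rpow_mul h2,
        ← Real.rpow_mul h2, ← Real.rpow_mul h2]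
      have : (p - s * p) * (j : ℝ) = j * p + (j * (-(homDim n + s * p)) + j * homDim n) := by ring
      rw [this, Real.rpow_add h2', Real.rpow_add h2']
      ring
    -- The annuli contain their outer sphere while the balls are open; hence the factor 2 in the
    -- radius.
    refine lintegral_lt_top_of_forall_le
      (fun j => {h | ((2 : ℝ)⁻¹) ^ (j + 1) < hnorm h ∧ hnorm h ≤ (2⁻¹) ^ j})
      (fun j => (((2 : ℝ)⁻¹) ^ j) ^ p * (((2 : ℝ)⁻¹) ^ (j + 1)) ^ (-(homDim n + s * p)))
      (fun j => 2 * (2⁻¹) ^ j) ?_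
      (fun j => by positivity) (fun j => by positivity) ?_ ?_ ?_ ?_
    · intro h hh
      obtain ⟨j, hj⟩ := exists_nat_pow_near_of_lt_one hh.1 hh.2.le
        (by norm_num : (0 : ℝ) < 2⁻¹) (by norm_num)
      exact mem_iUnion.2 ⟨j, hj⟩
    · intro j h hh
      rw [mem_hball, inverse_zero, zero_op]
      have : 0 < ((2 : ℝ)⁻¹) ^ j := by positivity
      have := hh.2
      linarith
    · intro j
      exact (measurableSet_lt measurable_const continuous_hnorm.measurable).inter
        (measurableSet_le continuous_hnorm.measurable measurable_const)
    · intro j h hh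
      refine ENNReal.ofReal_le_ofReal ?_
      have h3 := hnorm_nonneg h
      refine mul_le_mul ?_ ?_ (by positivity) (by positivity)
      · refine Real.rpow_le_rpow (by positivity) ?_ hp0.le
        rw [one_mul]; exact (min_le_right _ _).trans hh.2
      · exact Real.rpow_le_rpow_of_nonpos (by positivity) hh.1.le (by linarith)
    · simp_rw [e]
      refine (summable_geometric_of_lt_one (by positivity) ?_).mul_left _
      exact Real.rpow_lt_one (by norm_num) (by norm_num) hps
  · refine (setLIntegral_congr_fun (g := fun _ => 0) (measurableSet_singleton _) ?_).trans_lt ?_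
    · intro h hh
      rw [mem_singleton_iff] at hh
      simp [cutKernel, hh, hnorm_zero, Real.zero_rpow hp0.ne']
    · simp

/-- Dilating by L changes the slope from 1 to L at the price of L^(-Q-sp), and the Jacobian accounts
for L^(-Q); the power L^(sp) is left. -/
theorem lintegral_cutKernel (s p : ℝ) {L : ℝ} (hL : 0 < L) :
    ∫⁻ h : Heis n, cutKernel s p L h
      = ENNReal.ofReal (L ^ (s * p)) * ∫⁻ h : Heis n, cutKernel s p 1 h := by
  have h1 := lintegral_dilation hL (measurable_cutKernel (n := n) s p 1)
  have h2 : ∀ h : Heis n, cutKernel s p 1 (dilation L h)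
      = ENNReal.ofReal (L ^ (-(homDim n + s * p))) * cutKernel s p L h := by
    intro h
    unfold cutKernel
    rw [hnorm_dilation hL.le, ← ENNReal.ofReal_mul (by positivity),
      Real.mul_rpow hL.le (hnorm_nonneg h), one_mul]
    congr 1; ring
  simp_rw [h2] at h1
  rw [lintegral_const_mul _ (measurable_cutKernel s p L)] at h1
  have h3 : ENNReal.ofReal (L ^ (homDim n + s * p)) * ENNReal.ofReal (L ^ (-(homDim n + s * p))) = 1 := by
    rw [← ENNReal.ofReal_mul (by positivity), ← Real.rpow_add hL]; simp
  calc ∫⁻ h : Heis n, cutKernel s p L h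
      = ENNReal.ofReal (L ^ (homDim n + s * p)) * (ENNReal.ofReal (L ^ (-(homDim n + s * p)))
        * ∫⁻ h : Heis n, cutKernel s p L h) := by rw [← mul_assoc, h3, one_mul]
    _ = _ := by
        rw [h1, ← mul_assoc, ← ENNReal.ofReal_mul (by positivity), ← Real.rpow_add hL]
        congr 3; ring

/-- The kernel `|η⁻¹ ∘ ξ|^(-q)`. -/
def kern (q : ℝ) (ξ η : Heis n) : ℝ≥0∞ :=
  ENNReal.ofReal (hnorm (op (inverse η) ξ) ^ (-q))

theorem kern_comm (q : ℝ) (ξ η : Heis n) : kern q ξ η = kern q η ξ := by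
  unfold kern; rw [hnorm_inverse_op_comm]

@[fun_prop]
theorem measurable_kern_comp {X : Type*} [MeasurableSpace X] {q : ℝ} {f g : X → Heis n}
    (hf : Measurable f) (hg : Measurable g) : Measurable fun x => kern q (f x) (g x) := by
  unfold kern; fun_prop

/-- The kernel is integrable away from its pole. -/
theorem lintegral_kern_compl_hball_le (s p : ℝ) (ξ : Heis n) {r : ℝ}
    (hr : 0 < r) :
    ∫⁻ η in (hball ξ r)ᶜ, kern (homDim n + s * p) η ξ
      ≤ ENNReal.ofReal (r ^ (-(s * p))) * ∫⁻ h : Heis n, cutKernel s p 1 h := by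
  -- Off B_r the minimum in the cut kernel of slope 1/r equals 1, so the bare kernel is dominated
  -- there by the cut one.
  have e : ENNReal.ofReal (r ^ (-(s * p))) * ∫⁻ h : Heis n, cutKernel s p 1 h
      = ∫⁻ η : Heis n, cutKernel s p r⁻¹ (op (inverse ξ) η) := by
    rw [lintegral_op_left _ (measurable_cutKernel _ _ _), lintegral_cutKernel s p (inv_pos.2 hr),
      Real.inv_rpow hr.le, Real.rpow_neg hr.le]
  rw [e]
  refine (setLIntegral_mono' (measurableSet_hball ξ r).compl fun η hη => ?_).trans
    (setLIntegral_le_lintegral _ _)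
  have h1 : r ≤ hnorm (op (inverse ξ) η) := not_lt.1 hη
  unfold cutKernel kern
  have h2 : min 1 (r⁻¹ * hnorm (op (inverse ξ) η)) = 1 := by
    rw [min_eq_left_iff, ← div_eq_inv_mul, le_div_iff₀ hr, one_mul]; exact h1
  rw [h2, Real.one_rpow, one_mul]

/-! ### Comparison of homogeneous norms -/

/-- The extrema of d on the compact unit sphere are positive, and homogeneity carries them to all of
the group. -/
theorem IsHomogeneousNorm.exists_bounds {d : Heis n → ℝ} (hd : IsHomogeneousNorm d) :
    ∃ c C : ℝ, 0 < c ∧ 0 < C ∧ ∀ h, c * hnorm h ≤ d h ∧ d h ≤ C * hnorm h := by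
  set S : Set (Heis n) := {h | hnorm h = 1} with hS
  have hSc : IsCompact S := (isCompact_hnorm_le 1).of_isClosed_subset
    (isClosed_eq continuous_hnorm continuous_const) fun h hh => le_of_eq hh
  have hne : S.Nonempty := by
    refine ⟨(0, 0, 1), ?_⟩
    simp [hS, hnorm]
  obtain ⟨a, ha, hmin⟩ := hSc.exists_isMinOn hne hd.continuous.continuousOn
  obtain ⟨b, hb, hmax⟩ := hSc.exists_isMaxOn hne hd.continuous.continuousOn
  have hpos : ∀ h ∈ S, 0 < d h := by
    intro h hh
    refine lt_of_le_of_ne (hd.nonneg h) fun h0 => ?_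
    have h1 : hnorm h = 1 := hh
    rw [(hd.eq_zero_iff h).1 h0.symm, hnorm_zero] at h1
    exact zero_ne_one h1
  refine ⟨d a, d b, hpos a ha, hpos b hb, fun h => ?_⟩
  by_cases h0 : h = 0
  · rw [h0, hnorm_zero, (hd.eq_zero_iff 0).2 rfl]; simp
  have hn := hnorm_pos h0
  have hmem : Heis.dilation (hnorm h)⁻¹ h ∈ S := by
    change hnorm _ = 1
    rw [hnorm_dilation (by positivity), inv_mul_cancel₀ hn.ne']
  have h1 := hmin hmem
  have h2 := hmax hmem
  simp only [mem_ofPred_eq, hd.dilation _ (inv_pos.2 hn)] at h1 h2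
  rw [← div_eq_inv_mul, le_div_iff₀ hn] at h1
  rw [← div_eq_inv_mul, div_le_iff₀ hn] at h2
  exact ⟨h1, h2⟩

end Heis
end

noncomputable section

/-! ### Averages over measure preserving actions -/

section Average

variable {G X ι : Type*} [TopologicalSpace X] [MeasurableSpace X] [BorelSpace X] [R1Space X]
  {μ : Measure X} [μ.InnerRegularCompactLTTop] [IsLocallyFiniteMeasure μ]

/-- Strong continuity in L^q of a continuous action by measure preserving maps. Stated abstractly
because it is needed for left translations on ℍⁿ, for the same translations acting diagonally on ℍⁿ
× ℍⁿ, and for right translations. -/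
theorem tendsto_eLpNorm_comp_sub [TopologicalSpace G] {τ : G → X → X} (hτ : Continuous (Function.uncurry τ))
    (hmp : ∀ g, MeasurePreserving (τ g) μ μ) {g₀ : G} (h₀ : ∀ x, τ g₀ x = x)
    {q : ℝ≥0∞} (hq : 1 ≤ q) (hq' : q ≠ ⊤) {F : X → ℝ} (hF : MemLp F q μ) :
    Tendsto (fun g => eLpNorm (fun x => F (τ g x) - F x) q μ) (𝓝 g₀) (𝓝 0) := by
  have : Fact (1 ≤ q) := ⟨hq⟩
  let T : C(G, C(X, X)) := ContinuousMap.curry ⟨Function.uncurry τ, hτ⟩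
  have hT : ∀ g, MeasurePreserving (T g) μ μ := hmp
  have h1 := (tendsto_const_nhds (x := hF.toLp F) (f := 𝓝 g₀)).compMeasurePreservingLp
    (T.continuous.tendsto g₀) hT (hT g₀) hq'
  rw [tendsto_iff_edist_tendsto_0] at h1
  refine h1.congr fun g => ?_
  rw [Lp.edist_def]
  refine eLpNorm_congr_ae ?_
  have e1 := Lp.coeFn_compMeasurePreserving (hF.toLp F) (hT g)
  have e2 := Lp.coeFn_compMeasurePreserving (hF.toLp F) (hT g₀)
  have e3 := hF.coeFn_toLp
  have e4 := (hT g).quasiMeasurePreserving.ae_eq_comp e3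
  have e5 := (hT g₀).quasiMeasurePreserving.ae_eq_comp e3
  filter_upwards [e1, e2, e4, e5] with x h1 h2 h4 h5
  rw [Pi.sub_apply, h1, h2, h4, h5]
  simp only [Function.comp_apply]
  change F (τ g x) - F (τ g₀ x) = _
  rw [h₀]

theorem integrable_of_lintegral_rpow_lt_top [MeasurableSpace G] {ν : Measure G} [IsProbabilityMeasure ν] {f : G → ℝ}
    (hf : Measurable f) {p : ℝ} (hp : 1 ≤ p) (h : ∫⁻ g, ‖f g‖ₑ ^ p ∂ν < ⊤) : Integrable f ν := by
  have h1 : MemLp f (ENNReal.ofReal p) ν := by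
    refine ⟨hf.aestronglyMeasurable, ?_⟩
    rw [eLpNorm_lt_top_iff_lintegral_rpow_enorm_lt_top (by simp; linarith) ENNReal.ofReal_ne_top,
      ENNReal.toReal_ofReal (by linarith)]
    exact h
  exact h1.integrable (by simpa using hp)

theorem enorm_integral_rpow_le [MeasurableSpace G] {ν : Measure G} [IsProbabilityMeasure ν] {f : G → ℝ}
    (hf : Measurable f) {p : ℝ} (hp : 1 ≤ p) :
    ‖∫ g, f g ∂ν‖ₑ ^ p ≤ ∫⁻ g, ‖f g‖ₑ ^ p ∂ν := by
  have hp0 : 0 < p := by linarith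
  have h1 : ‖∫ g, f g ∂ν‖ₑ ≤ eLpNorm f (ENNReal.ofReal p) ν := by
    refine (enorm_integral_le_lintegral_enorm _).trans ?_
    rw [← eLpNorm_one_eq_lintegral_enorm]
    exact eLpNorm_le_eLpNorm_of_exponent_le (by simpa using hp) hf.aestronglyMeasurable
  calc ‖∫ g, f g ∂ν‖ₑ ^ p ≤ eLpNorm f (ENNReal.ofReal p) ν ^ p := by gcongr
    _ = _ := by
      rw [eLpNorm_eq_lintegral_rpow_enorm_toReal (by simpa using hp0) ENNReal.ofReal_ne_top,
        ENNReal.toReal_ofReal hp0.le, ← ENNReal.rpow_mul, one_div, inv_mul_cancel₀ hp0.ne',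
        ENNReal.rpow_one]

/-- Jensen and Fubini bound the p-th power of the norm by the average over g of ‖F ∘ τ g - F‖_p^p.
That norm is small for g near g₀, where the measures concentrate. -/
theorem tendsto_eLpNorm_average_sub [TopologicalSpace G] [MeasurableSpace G] [SFinite μ]
    {τ : G → X → X} (hτ : Continuous (Function.uncurry τ))
    (hτm : Measurable (Function.uncurry τ))
    (hmp : ∀ g, MeasurePreserving (τ g) μ μ) {g₀ : G} (h₀ : ∀ x, τ g₀ x = x)
    {p : ℝ} (hp : 1 ≤ p) {F : X → ℝ} (hFm : Measurable F) (hF : MemLp F (ENNReal.ofReal p) μ)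
    {l : Filter ι} {ν : ι → Measure G} [∀ i, IsProbabilityMeasure (ν i)]
    (hν : ∀ N ∈ 𝓝 g₀, ∀ᶠ i in l, ∀ᵐ g ∂(ν i), g ∈ N) :
    Tendsto (fun i => eLpNorm (fun x => ∫ g, F (τ g x) ∂(ν i) - F x) (ENNReal.ofReal p) μ) l
      (𝓝 0) := by
  have hp0 : 0 < p := by linarith
  have hq0 : ENNReal.ofReal p ≠ 0 := by simpa using hp0
  have hpow : ∀ f : X → ℝ, ∫⁻ x, ‖f x‖ₑ ^ p ∂μ = eLpNorm f (ENNReal.ofReal p) μ ^ p := by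
    intro f
    rw [eLpNorm_eq_lintegral_rpow_enorm_toReal hq0 ENNReal.ofReal_ne_top,
      ENNReal.toReal_ofReal hp0.le, ← ENNReal.rpow_mul, one_div, inv_mul_cancel₀ hp0.ne',
      ENNReal.rpow_one]
  have hFτ : Measurable (fun z : G × X => F (τ z.1 z.2)) := hFm.comp hτm
  have key : ∀ i, eLpNorm (fun x => ∫ g, F (τ g x) ∂(ν i) - F x) (ENNReal.ofReal p) μ ^ p ≤
      ∫⁻ g, eLpNorm (fun x => F (τ g x) - F x) (ENNReal.ofReal p) μ ^ p ∂(ν i) := by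
    intro i
    have hfin : ∫⁻ x, ∫⁻ g, ‖F (τ g x)‖ₑ ^ p ∂(ν i) ∂μ < ⊤ := by
      rw [lintegral_lintegral_swap (by fun_prop)]
      have : ∀ g, ∫⁻ x, ‖F (τ g x)‖ₑ ^ p ∂μ = eLpNorm F (ENNReal.ofReal p) μ ^ p := by
        intro g
        rw [← hpow]
        exact (hmp g).lintegral_comp (f := fun x => ‖F x‖ₑ ^ p) (by fun_prop)
      simp_rw [this]
      simp only [lintegral_const, measure_univ, mul_one]
      exact ENNReal.rpow_lt_top_of_nonneg hp0.le hF.2.ne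
    have hae := ae_lt_top (by fun_prop) hfin.ne
    simp_rw [← hpow]
    rw [lintegral_lintegral_swap (by fun_prop)]
    refine lintegral_mono_ae ?_
    filter_upwards [hae] with x hx
    have hint : Integrable (fun g => F (τ g x)) (ν i) :=
      integrable_of_lintegral_rpow_lt_top (by fun_prop) hp hx
    have e : ∫ g, F (τ g x) ∂(ν i) - F x = ∫ g, (F (τ g x) - F x) ∂(ν i) := by
      rw [integral_sub hint (integrable_const _)]; simp
    rw [e]
    exact enorm_integral_rpow_le (by fun_prop) hp
  have hδ := tendsto_eLpNorm_comp_sub hτ hmp h₀ (by simpa using hp) ENNReal.ofReal_ne_top hF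
  rw [ENNReal.tendsto_nhds_zero] at hδ ⊢
  intro ε hε
  filter_upwards [hν _ (hδ ε hε)] with i hi
  have h1 : eLpNorm (fun x => ∫ g, F (τ g x) ∂(ν i) - F x) (ENNReal.ofReal p) μ ^ p ≤ ε ^ p := by
    refine (key i).trans ?_
    calc _ ≤ ∫⁻ _, ε ^ p ∂(ν i) := by
          refine lintegral_mono_ae ?_
          filter_upwards [hi] with g hg
          exact ENNReal.rpow_le_rpow hg hp0.le
      _ = ε ^ p := by simp
  exact (ENNReal.rpow_le_rpow_iff hp0).1 h1

end Average

/-! ### Elementary inequalities -/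

theorem Real.rpow_sub_rpow_le {a b p : ℝ} (ha : 0 ≤ a) (hab : a ≤ b) (hp : 1 ≤ p) :
    b ^ p - a ^ p ≤ p * b ^ (p - 1) * (b - a) := by
  rcases (ha.trans hab).eq_or_lt with h0 | hb
  · have : a = 0 := le_antisymm (h0 ▸ hab) ha
    rw [this, ← h0]; simp
  have h := one_add_mul_self_le_rpow_one_add (s := a / b - 1)
    (by have : 0 ≤ a / b := by positivity
        linarith) hp
  rw [add_sub_cancel, Real.div_rpow ha hb.le, le_div_iff₀ (by positivity)] at h
  rw [Real.rpow_sub_one hb.ne']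
  have e : (1 + p * (a / b - 1)) * b ^ p = b ^ p - p * (b ^ p / b) * (b - a) := by
    field_simp; ring
  linarith

/-- The heart of the Caccioppoli inequality. The left side is positive only if w₂ a₂^p > w₁ a₁^p,
that is (a₁/a₂)^p < w₂/w₁. Bernoulli's inequality then bounds the jump of w by that of a, in the
form a₂ (w₁ - w₂) ≤ p w₁ (a₂ - a₁), and no absorption by Young's inequality is needed. -/
theorem Real.rpow_mul_sub_le {p w₁ w₂ a₁ a₂ : ℝ} (hp : 1 < p) (hw₂ : 0 ≤ w₂) (hw : w₂ ≤ w₁)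
    (ha₁ : 0 ≤ a₁) (ha₂ : 0 ≤ a₂) :
    (w₁ - w₂) ^ (p - 1) * (w₂ * a₂ ^ p - w₁ * a₁ ^ p) ≤ p ^ p * (w₁ ^ p * |a₂ - a₁| ^ p) := by
  have hp0 : 0 < p := by linarith
  have hw₁ : 0 ≤ w₁ := hw₂.trans hw
  have hRHS : 0 ≤ p ^ p * (w₁ ^ p * |a₂ - a₁| ^ p) := by positivity
  rcases le_or_gt (w₂ * a₂ ^ p) (w₁ * a₁ ^ p) with h | h
  · refine le_trans (mul_nonpos_of_nonneg_of_nonpos ?_ (by linarith)) hRHS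
    exact Real.rpow_nonneg (by linarith) _
  rcases hw.eq_or_lt with hX | hX
  · rw [hX, sub_self, Real.zero_rpow (by linarith), zero_mul]
    exact hX ▸ hRHS
  have hw₁p : 0 < w₁ := hw₂.trans_lt hX
  have haa : a₁ < a₂ := by
    by_contra hcon
    have : w₂ * a₂ ^ p ≤ w₁ * a₁ ^ p := by
      have := Real.rpow_le_rpow ha₂ (not_lt.1 hcon) hp0.le
      gcongr
    linarith
  have ha₂p : 0 < a₂ := ha₁.trans_lt haa
  set X := w₁ - w₂ with hXdef
  have hXp : 0 < X := by linarith
  set D := a₂ - a₁ with hD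
  have hDp : 0 < D := by linarith
  -- `a₂ X ≤ p w₁ D`
  have h1 : a₂ * X ≤ p * w₁ * D := by
    have hb := one_add_mul_self_le_rpow_one_add (s := a₁ / a₂ - 1)
      (by have : 0 ≤ a₁ / a₂ := by positivity
          linarith) hp.le
    rw [add_sub_cancel, Real.div_rpow ha₁ ha₂] at hb
    have h2 : a₁ ^ p / a₂ ^ p ≤ w₂ / w₁ := by
      rw [div_le_div_iff₀ (by positivity) hw₁p]; linarith
    have h3 : 1 + p * (a₁ / a₂ - 1) ≤ w₂ / w₁ := hb.trans h2
    have h4 : (1 + p * (a₁ / a₂ - 1)) * (a₂ * w₁) ≤ w₂ / w₁ * (a₂ * w₁) := by gcongr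
    have e1 : (1 + p * (a₁ / a₂ - 1)) * (a₂ * w₁) = a₂ * w₁ - p * w₁ * D := by
      rw [hD]; field_simp; ring
    have e2 : w₂ / w₁ * (a₂ * w₁) = a₂ * w₂ := by field_simp
    rw [e1, e2] at h4
    rw [hXdef]; linarith
  have h2 : w₂ * a₂ ^ p - w₁ * a₁ ^ p ≤ w₁ * (p * a₂ ^ (p - 1) * D) := by
    have := Real.rpow_sub_rpow_le ha₁ haa.le hp.le
    have h3 : w₂ * a₂ ^ p ≤ w₁ * a₂ ^ p := by gcongr
    nlinarith
  rw [abs_of_pos hDp]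
  calc X ^ (p - 1) * (w₂ * a₂ ^ p - w₁ * a₁ ^ p)
      ≤ X ^ (p - 1) * (w₁ * (p * a₂ ^ (p - 1) * D)) := by gcongr
    _ = p * w₁ * D * (a₂ * X) ^ (p - 1) := by
        rw [Real.mul_rpow ha₂ hXp.le]; ring
    _ ≤ p * w₁ * D * (p * w₁ * D) ^ (p - 1) := by
        gcongr
    _ = (p * w₁ * D) ^ p := by
        rw [Real.rpow_sub_one (by positivity)]; field_simp
    _ = p ^ p * (w₁ ^ p * D ^ p) := by
        rw [Real.mul_rpow (by positivity) hDp.le, Real.mul_rpow hp0.le hw₁, mul_assoc]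

end

noncomputable section

namespace Heis

variable {n : ℕ}

instance sigmaFinite_prod :
    SigmaFinite ((volume : Measure (Heis n)).prod (volume : Measure (Heis n))) :=
  Measure.prod.instSigmaFinite

/-- The continuity of translations in L^p over pairs of points requires regularity of the product
measure. -/
theorem regular_prod : ((volume : Measure (Heis n)).prod (volume : Measure (Heis n))).Regular :=
  Measure.Regular.of_sigmaCompactSpace_of_isLocallyFiniteMeasure _

instance innerRegularCompactLTTop_prod :
    ((volume : Measure (Heis n)).prod (volume : Measure (Heis n))).InnerRegularCompactLTTop :=
  regular_prod.instInnerRegularCompactLTTop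

/-! ### Mollification by left translations -/

/-- Right translation as a homeomorphism. -/
def opRightHomeomorph (a : Heis n) : Heis n ≃ₜ Heis n where
  toFun b := op b a
  invFun b := op b (inverse a)
  left_inv b := op_inverse_cancel_right b a
  right_inv b := inverse_op_cancel_right b a
  continuous_toFun := by fun_prop
  continuous_invFun := by fun_prop

theorem integral_op_right (a : Heis n) (F : Heis n → ℝ) : ∫ b, F (op b a) = ∫ b, F b :=
  (measurePreserving_op_right a).integral_comp (opRightHomeomorph a).measurableEmbedding F

theorem integrable_comp_op_right {F : Heis n → ℝ} (hF : Integrable F) (a : Heis n) :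
    Integrable fun b => F (op b a) :=
  (measurePreserving_op_right a).integrable_comp_of_integrable hF

/-- The average of the left translates of `ψ` against the weight `ρ`. -/
def mollify (ρ ψ : Heis n → ℝ) (ξ : Heis n) : ℝ := ∫ ζ, ρ ζ * ψ (op ζ ξ)

/-- Invariance under right translations moves ξ from ψ into the smooth weight, where it can be
differentiated. -/
theorem mollify_eq (ρ ψ : Heis n → ℝ) (ξ : Heis n) :
    mollify ρ ψ ξ = ∫ ζ, ψ ζ * ρ (op ζ (inverse ξ)) := by
  unfold mollify
  rw [← integral_op_right (inverse ξ)]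
  simp_rw [inverse_op_cancel_right, mul_comm]

open scoped Convolution in
theorem contDiff_mollify {ρ ψ : Heis n → ℝ} (hρ : ContDiff ℝ ∞ ρ) (hρc : HasCompactSupport ρ)
    (hψ : Integrable ψ) : ContDiff ℝ ∞ (mollify ρ ψ) := by
  rw [contDiff_iff_contDiffAt]
  intro ξ₀
  set S : Set (Heis n) := hball ξ₀ 1
  -- Evaluated at 0, the Euclidean convolution of ψ with g ξ is ∫ ψ(ζ) g ξ (-ζ); the sign in g makes
  -- this the mollification at ξ. Smoothness is then smoothness of a convolution in its parameter.
  set g : Heis n → Heis n → ℝ := fun ξ x => ρ (op (-x) (inverse ξ)) with hg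
  -- One compact set that carries g ξ for all ξ in the unit ball about ξ₀.
  set k : Set (Heis n) := (fun z : Heis n × Heis n => -(op z.1 z.2)) ''
    (tsupport ρ ×ˢ closedHball ξ₀ 1) with hk
  have hkc : IsCompact k :=
    (hρc.isCompact.prod (isCompact_closedHball ξ₀ 1)).image continuous_op.neg
  have h1 : ContDiffOn ℝ ∞
      (fun ξ => (ψ ⋆[ContinuousLinearMap.mul ℝ ℝ, volume] g ξ) (0 : Heis n)) S := by
    refine contDiffOn_convolution_right_with_param_comp (n := (⊤ : ℕ∞)) _ contDiffOn_const
      (isOpen_hball ξ₀ 1) hkc ?_ hψ.locallyIntegrable ?_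
    · intro ξ x hξ hx
      by_contra hne
      apply hx
      refine ⟨(op (-x) (inverse ξ), ξ), ⟨subset_tsupport ρ hne, hball_subset_closedHball _ _ hξ⟩, ?_⟩
      simp only [inverse_op_cancel_right, neg_neg]
    · refine ContDiff.contDiffOn ?_
      exact hρ.comp (contDiff_op.comp (contDiff_snd.neg.prodMk (contDiff_inverse.comp contDiff_fst)))
  have h2 : (fun ξ => (ψ ⋆[ContinuousLinearMap.mul ℝ ℝ, volume] g ξ) (0 : Heis n)) = mollify ρ ψ := by
    ext ξ
    rw [mollify_eq]
    simp [convolution, hg]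
  rw [h2] at h1
  exact h1.contDiffAt ((isOpen_hball ξ₀ 1).mem_nhds (mem_hball_self one_pos))

theorem mollify_nonneg {ρ ψ : Heis n → ℝ} (hρ : ∀ ζ, 0 ≤ ρ ζ) (hψ : ∀ ξ, 0 ≤ ψ ξ) (ξ : Heis n) :
    0 ≤ mollify ρ ψ ξ :=
  integral_nonneg fun ζ => mul_nonneg (hρ ζ) (hψ _)

/-- A sequence of smooth bumps shrinking to the origin. -/
def bumpSeq (n : ℕ) (i : ℕ) : ContDiffBump (0 : Heis n) where
  rIn := 1 / (i + 1) / 2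
  rOut := 1 / (i + 1)
  rIn_pos := by positivity
  rIn_lt_rOut := half_lt_self (by positivity)

/-- The bumps `bumpSeq` normalized to have integral one. -/
def mollifier (n : ℕ) (i : ℕ) : Heis n → ℝ := (bumpSeq n i).normed volume

/-- The probability measure with density `mollifier`. -/
def mollMeasure (n : ℕ) (i : ℕ) : Measure (Heis n) :=
  volume.withDensity fun ζ => ENNReal.ofReal (mollifier n i ζ)

theorem mollifier_nonneg (i : ℕ) (ζ : Heis n) : 0 ≤ mollifier n i ζ :=
  (bumpSeq n i).nonneg_normed ζ

theorem contDiff_mollifier (i : ℕ) : ContDiff ℝ ∞ (mollifier n i) :=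
  (bumpSeq n i).contDiff_normed

theorem hasCompactSupport_mollifier (i : ℕ) : HasCompactSupport (mollifier n i) :=
  (bumpSeq n i).hasCompactSupport_normed

theorem measurable_mollifier (i : ℕ) : Measurable (mollifier n i) :=
  (contDiff_mollifier i).continuous.measurable

theorem integrable_mollifier (i : ℕ) : Integrable (mollifier n i) :=
  (bumpSeq n i).integrable_normed

instance (i : ℕ) : IsProbabilityMeasure (mollMeasure n i) := by
  constructor
  rw [mollMeasure, withDensity_apply _ MeasurableSet.univ, setLIntegral_univ,
    ← ofReal_integral_eq_lintegral_ofReal (integrable_mollifier i)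
      (ae_of_all _ (mollifier_nonneg i))]
  simp [mollifier, (bumpSeq n i).integral_normed]

theorem mollifier_eventually_zero {N : Set (Heis n)} (hN : N ∈ 𝓝 (0 : Heis n)) :
    ∀ᶠ i in atTop, ∀ ζ, ζ ∉ N → mollifier n i ζ = 0 := by
  obtain ⟨ε, hε, hb⟩ := Metric.mem_nhds_iff.1 hN
  filter_upwards [(tendsto_one_div_add_atTop_nhds_zero_nat (𝕜 := ℝ)).eventually_lt_const hε]
    with i hi ζ hζ
  by_contra hne
  have h1 : ζ ∈ Function.support ((bumpSeq n i).normed volume) := hne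
  rw [(bumpSeq n i).support_normed_eq] at h1
  exact hζ (hb (Metric.ball_subset_ball hi.le h1))

theorem mollMeasure_eventually {N : Set (Heis n)} (hN : N ∈ 𝓝 (0 : Heis n)) :
    ∀ᶠ i in atTop, ∀ᵐ ζ ∂(mollMeasure n i), ζ ∈ N := by
  filter_upwards [mollifier_eventually_zero hN] with i hi
  rw [mollMeasure, ae_withDensity_iff (measurable_mollifier i).ennreal_ofReal]
  refine ae_of_all _ fun ζ h => ?_
  by_contra hζ
  exact h (by rw [hi ζ hζ, ENNReal.ofReal_zero])

theorem integral_mollMeasure (i : ℕ) (F : Heis n → ℝ) :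
    ∫ ζ, F ζ ∂(mollMeasure n i) = ∫ ζ, mollifier n i ζ * F ζ := by
  rw [mollMeasure, integral_withDensity_eq_integral_toReal_smul
    (measurable_mollifier i).ennreal_ofReal (ae_of_all _ fun _ => ENNReal.ofReal_lt_top)]
  simp only [ENNReal.toReal_ofReal (mollifier_nonneg i _), smul_eq_mul]

theorem integrable_mollifier_mul {ψ : Heis n → ℝ} (hψ : Integrable ψ) (i : ℕ) :
    Integrable fun ζ => mollifier n i ζ * ψ ζ := by
  obtain ⟨C, hC⟩ := (contDiff_mollifier (n := n) i).continuous.bounded_above_of_compact_support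
    (hasCompactSupport_mollifier i)
  exact hψ.bdd_mul (measurable_mollifier i).aestronglyMeasurable (ae_of_all _ hC)

theorem mollify_sub_mollify {ψ : Heis n → ℝ} (hψ : Integrable ψ) (i : ℕ) (ξ η : Heis n) :
    mollify (mollifier n i) ψ ξ - mollify (mollifier n i) ψ η
      = ∫ ζ, (ψ (op ζ ξ) - ψ (op ζ η)) ∂(mollMeasure n i) := by
  rw [integral_mollMeasure, mollify, mollify, ← integral_sub]
  · simp_rw [mul_sub]
  · exact integrable_mollifier_mul (integrable_comp_op_right hψ ξ) i
  · exact integrable_mollifier_mul (integrable_comp_op_right hψ η) i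

theorem tendsto_eLpNorm_mollify_sub {p : ℝ} (hp : 1 ≤ p) {ψ : Heis n → ℝ} (hψm : Measurable ψ)
    (hψ : MemLp ψ (ENNReal.ofReal p)) :
    Tendsto (fun i => eLpNorm (fun ξ => mollify (mollifier n i) ψ ξ - ψ ξ) (ENNReal.ofReal p) volume)
      atTop (𝓝 0) := by
  have := tendsto_eLpNorm_average_sub (μ := (volume : Measure (Heis n))) (G := Heis n)
    (τ := fun ζ ξ => op ζ ξ) (g₀ := 0) (by unfold Function.uncurry; fun_prop)
    (by unfold Function.uncurry; fun_prop) measurePreserving_op_left zero_op hp hψm hψ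
    (fun N hN => mollMeasure_eventually hN)
  simpa only [integral_mollMeasure, mollify] using this

/-- The difference quotient of order `α`. -/
def diffQuot (α : ℝ) (ψ : Heis n → ℝ) (z : Heis n × Heis n) : ℝ :=
  (ψ z.1 - ψ z.2) * hnorm (op (inverse z.2) z.1) ^ (-α)

theorem measurable_diffQuot (α : ℝ) {ψ : Heis n → ℝ} (hψ : Measurable ψ) :
    Measurable (diffQuot α ψ) := by
  unfold diffQuot; fun_prop

/-- By left invariance of the kernel, the difference quotient of the mollification is the average of
the diagonal left translates of the difference quotient of ψ. Convergence in the fractional seminorm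
is thus convergence of averages in L^p over pairs of points. -/
theorem tendsto_eLpNorm_diffQuot_mollify_sub {p α : ℝ} (hp : 1 ≤ p) {ψ : Heis n → ℝ}
    (hψm : Measurable ψ) (hψi : Integrable ψ)
    (hψ : MemLp (diffQuot α ψ) (ENNReal.ofReal p) (volume.prod volume)) :
    Tendsto (fun i => eLpNorm (fun z => diffQuot α (mollify (mollifier n i) ψ) z - diffQuot α ψ z)
      (ENNReal.ofReal p) (volume.prod volume)) atTop (𝓝 0) := by
  have := tendsto_eLpNorm_average_sub (μ := (volume : Measure (Heis n)).prod volume) (G := Heis n)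
    (τ := fun ζ z => (op ζ z.1, op ζ z.2)) (g₀ := 0) (by unfold Function.uncurry; fun_prop)
    (by unfold Function.uncurry; fun_prop)
    (fun ζ => (measurePreserving_op_left ζ).prod (measurePreserving_op_left ζ))
    (fun z => by simp only [zero_op]) hp (measurable_diffQuot α hψm) hψ
    (fun N hN => mollMeasure_eventually hN)
  refine this.congr fun i => ?_
  congr 1
  ext z
  congr 1
  simp only [diffQuot, inverse_op_op_left]
  rw [mollify_sub_mollify hψi, integral_mul_const]

/-- If ζ is close to 0 and ζ ∘ ξ lies in K, then ξ = ζ⁻¹ ∘ (ζ ∘ ξ) lies in K', uniformly over K by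
compactness. -/
theorem exists_compact_mollify_eq_zero {K U : Set (Heis n)} (hK : IsCompact K) (hU : IsOpen U)
    (hKU : K ⊆ U) :
    ∃ K', IsCompact K' ∧ K ⊆ interior K' ∧ K' ⊆ U ∧ ∀ ψ : Heis n → ℝ, (∀ ξ, ξ ∉ K → ψ ξ = 0) →
      ∀ᶠ i in atTop, ∀ ξ, ξ ∉ K' → mollify (mollifier n i) ψ ξ = 0 := by
  obtain ⟨K', hK', h1, h2⟩ := exists_compact_between hK hU hKU
  refine ⟨K', hK', h1, h2, fun ψ hψ => ?_⟩
  have hN : ∀ᶠ ζ in 𝓝 (0 : Heis n), ∀ ξ ∈ K, op (inverse ζ) ξ ∈ interior K' := by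
    refine hK.eventually_forall_of_forall_eventually fun ξ hξ => ?_
    have hc : Continuous fun z : Heis n × Heis n => op (inverse z.1) z.2 := by fun_prop
    refine hc.continuousAt.eventually_mem (isOpen_interior.mem_nhds ?_)
    simp only [inverse_zero, zero_op]
    exact h1 hξ
  filter_upwards [mollifier_eventually_zero hN] with i hi ξ hξ
  refine integral_eq_zero_of_ae (ae_of_all _ fun ζ => ?_)
  by_cases hζ : op ζ ξ ∈ K
  · have : mollifier n i ζ = 0 := by
      refine hi ζ fun hζN => hξ ?_
      have := hζN _ hζ
      rw [inverse_op_cancel] at this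
      exact interior_subset this
    simp [this]
  · simp [hψ _ hζ]

end Heis
end

noncomputable section

/-! ### Integral inequalities with powers -/

theorem lintegral_ofReal_rpow_eq_eLpNorm {X : Type*} [MeasurableSpace X] {μ : Measure X} {p : ℝ}
    (hp : 0 < p) (g : X → ℝ) :
    ∫⁻ x, ENNReal.ofReal (|g x| ^ p) ∂μ = eLpNorm g (ENNReal.ofReal p) μ ^ p := by
  rw [eLpNorm_eq_lintegral_rpow_enorm_toReal (by simpa using hp) ENNReal.ofReal_ne_top,
    ENNReal.toReal_ofReal hp.le, ← ENNReal.rpow_mul, one_div, inv_mul_cancel₀ hp.ne',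
    ENNReal.rpow_one]
  refine lintegral_congr fun x => ?_
  rw [← Real.norm_eq_abs, ← ENNReal.ofReal_rpow_of_nonneg (norm_nonneg _) hp.le,
    ofReal_norm]

/-- The Hölder inequality for `|a|^(p-1) |b|`. -/
theorem lintegral_rpow_sub_one_mul_le {X : Type*} [MeasurableSpace X] {μ : Measure X} {p : ℝ}
    (hp : 1 < p) {a b : X → ℝ} (ha : Measurable a) (hb : Measurable b) :
    ∫⁻ x, ENNReal.ofReal (|a x| ^ (p - 1) * |b x|) ∂μ ≤
      eLpNorm a (ENNReal.ofReal p) μ ^ (p - 1) * eLpNorm b (ENNReal.ofReal p) μ := by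
  have hp0 : 0 < p := by linarith
  have hconj : (p / (p - 1)).HolderConjugate p := (Real.HolderConjugate.conjExponent hp).symm
  have h := ENNReal.lintegral_mul_le_Lp_mul_Lq μ hconj
    (f := fun x => ENNReal.ofReal (|a x| ^ (p - 1))) (g := fun x => ENNReal.ofReal |b x|)
    (by fun_prop) (by fun_prop)
  have e1 : ∀ x, ENNReal.ofReal (|a x| ^ (p - 1)) ^ (p / (p - 1)) = ENNReal.ofReal (|a x| ^ p) := by
    intro x
    have : 0 < p - 1 := by linarith
    rw [ENNReal.ofReal_rpow_of_nonneg (by positivity) (by positivity),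
      ← Real.rpow_mul (abs_nonneg _), mul_div_cancel₀ _ this.ne']
  have e2 : ∀ x, ENNReal.ofReal |b x| ^ p = ENNReal.ofReal (|b x| ^ p) := fun x =>
    ENNReal.ofReal_rpow_of_nonneg (abs_nonneg _) hp0.le
  simp only [Pi.mul_apply, e1, e2] at h
  rw [lintegral_ofReal_rpow_eq_eLpNorm hp0, lintegral_ofReal_rpow_eq_eLpNorm hp0,
    ← ENNReal.rpow_mul, ← ENNReal.rpow_mul] at h
  have e3 : p * (1 / (p / (p - 1))) = p - 1 := by field_simp
  have e4 : p * (1 / p) = 1 := by field_simp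
  rw [e3, e4, ENNReal.rpow_one] at h
  refine le_trans (le_of_eq (lintegral_congr fun x => ?_)) h
  rw [ENNReal.ofReal_mul (by positivity)]

theorem Real.add_rpow_le_two_rpow {a b t : ℝ} (ha : 0 ≤ a) (hb : 0 ≤ b) (ht : 0 ≤ t) :
    (a + b) ^ t ≤ 2 ^ t * (a ^ t + b ^ t) := by
  have h1 : (a + b) ^ t ≤ (2 * max a b) ^ t := by
    refine Real.rpow_le_rpow (by positivity) ?_ ht
    linarith [le_max_left a b, le_max_right a b]
  refine h1.trans ?_
  rw [Real.mul_rpow (by norm_num) (by positivity)]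
  gcongr
  rcases le_total a b with h | h
  · rw [max_eq_right h]; linarith [Real.rpow_nonneg ha t]
  · rw [max_eq_left h]; linarith [Real.rpow_nonneg hb t]

namespace Heis

variable {n : ℕ}

/-! ### Tails -/

theorem lintegral_weight_lt_top {s p : ℝ} (hs : 0 < s) (hs1 : s < 1) (hp : 1 < p) :
    ∫⁻ η : Heis n, ENNReal.ofReal ((1 + hnorm η) ^ (-(homDim n + s * p))) < ⊤ := by
  have hQ := homDim_pos (n := n)
  have hsp : 0 < s * p := by nlinarith
  rw [← lintegral_add_compl _ (measurableSet_hball (0 : Heis n) 1)]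
  refine ENNReal.add_lt_top.2 ⟨?_, ?_⟩
  · refine (setLIntegral_mono' (measurableSet_hball _ _) (g := fun _ => 1) fun η _ => ?_).trans_lt ?_
    · rw [← ENNReal.ofReal_one]
      refine ENNReal.ofReal_le_ofReal (Real.rpow_le_one_of_one_le_of_nonpos ?_ (by linarith))
      linarith [hnorm_nonneg η]
    · simpa using volume_hball_lt_top _ _
  · refine (setLIntegral_mono' (measurableSet_hball _ _).compl
      (g := fun η => kern (homDim n + s * p) η 0) fun η hη => ?_).trans_lt
      ((lintegral_kern_compl_hball_le s p 0 one_pos).trans_lt ?_)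
    · refine ENNReal.ofReal_le_ofReal ?_
      have h1 : 1 ≤ hnorm (op (inverse 0) η) := not_lt.1 hη
      rw [inverse_zero, zero_op] at h1 ⊢
      exact Real.rpow_le_rpow_of_nonpos (by linarith) (by linarith) (by linarith)
    · exact ENNReal.mul_lt_top ENNReal.ofReal_lt_top (lintegral_cutKernel_one_lt_top hs hs1 hp)

/-- The weight itself is integrable, so adding a constant keeps a function in the tail space. -/
theorem MemTailSpace.lintegral_one_add_lt_top {s p : ℝ} (hs : 0 < s) (hs1 : s < 1) (hp : 1 < p)
    {v : Heis n → ℝ} (hv : MemTailSpace s p v) (hv0 : ∀ η, 0 ≤ v η) (b : ℝ) (hb : 0 ≤ b) :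
    ∫⁻ η : Heis n, ENNReal.ofReal ((b + v η) ^ (p - 1) * (1 + hnorm η) ^ (-(homDim n + s * p)))
      < ⊤ := by
  have h1 := hv.2.lintegral_lt_top
  have h2 : ∀ η : Heis n,
      ENNReal.ofReal ((b + v η) ^ (p - 1) * (1 + hnorm η) ^ (-(homDim n + s * p)))
      ≤ ENNReal.ofReal (2 ^ (p - 1) * b ^ (p - 1))
          * ENNReal.ofReal ((1 + hnorm η) ^ (-(homDim n + s * p)))
        + ENNReal.ofReal (2 ^ (p - 1)) *
          ENNReal.ofReal (|v η| ^ (p - 1) / (1 + hnorm η) ^ (homDim n + s * p)) := by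
    intro η
    have h0 := hnorm_nonneg η
    rw [← ENNReal.ofReal_mul (by positivity), ← ENNReal.ofReal_mul (by positivity),
      ← ENNReal.ofReal_add (by positivity) (by positivity)]
    refine ENNReal.ofReal_le_ofReal ?_
    rw [abs_of_nonneg (hv0 η), div_eq_mul_inv, ← Real.rpow_neg (by positivity)]
    have h3 := Real.add_rpow_le_two_rpow hb (hv0 η) (t := p - 1) (by linarith)
    calc _ ≤ 2 ^ (p - 1) * (b ^ (p - 1) + v η ^ (p - 1))
          * (1 + hnorm η) ^ (-(homDim n + s * p)) := by gcongr
      _ = _ := by ring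
  refine (lintegral_mono h2).trans_lt ?_
  rw [lintegral_add_left (by fun_prop), lintegral_const_mul _ (by fun_prop),
    lintegral_const_mul' _ _ ENNReal.ofReal_ne_top]
  exact ENNReal.add_lt_top.2 ⟨ENNReal.mul_lt_top ENNReal.ofReal_lt_top
    (lintegral_weight_lt_top hs hs1 hp), ENNReal.mul_lt_top ENNReal.ofReal_lt_top h1⟩

/-- Off a neighbourhood of a compact set, the kernel is controlled by the weight of the tail
space. -/
theorem exists_kern_le_weight {q : ℝ} (hq : 0 ≤ q) {K U : Set (Heis n)} (hK : IsCompact K)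
    (hU : IsOpen U) (hKU : K ⊆ U) :
    ∃ C : ℝ, 0 ≤ C ∧ ∀ ξ ∈ K, ∀ η, η ∉ U →
      hnorm (op (inverse η) ξ) ^ (-q) ≤ C * (1 + hnorm η) ^ (-q) := by
  have hN : ∀ᶠ ζ in 𝓝 (0 : Heis n), ∀ ξ ∈ K, op ξ ζ ∈ U := by
    refine hK.eventually_forall_of_forall_eventually fun ξ hξ => ?_
    have hc : Continuous fun z : Heis n × Heis n => op z.2 z.1 := by fun_prop
    refine hc.continuousAt.eventually_mem (hU.mem_nhds ?_)
    simp only [op_zero]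
    exact hKU hξ
  obtain ⟨V, hV, hVo, hV0⟩ := mem_nhds_iff.1 hN
  obtain ⟨δ, hδ, hδV⟩ := exists_closedHball_subset hVo hV0
  obtain ⟨R, hR⟩ := (hK.image continuous_hnorm).bddAbove
  set R' := max R 0 with hR'
  have hR0 : 0 ≤ R' := le_max_right _ _
  -- With t = |ξ⁻¹ ∘ η| ≥ δ and |ξ| ≤ R', one has 1 + |η| ≤ 1 + R' + t ≤ ((1 + R')/δ + 1) t.
  refine ⟨((1 + R') / δ + 1) ^ q, by positivity, fun ξ hξ η hη => ?_⟩
  have h1 : δ ≤ hnorm (op (inverse ξ) η) := by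
    by_contra hcon
    apply hη
    have h2 : op (inverse ξ) η ∈ closedHball (0 : Heis n) δ := by
      rw [mem_closedHball, inverse_zero, zero_op]; exact (not_le.1 hcon).le
    have h3 := hV (hδV h2) ξ hξ
    rwa [op_inverse_cancel] at h3
  rw [hnorm_inverse_op_comm]
  set t := hnorm (op (inverse ξ) η)
  have ht : 0 < t := hδ.trans_le h1
  have h2 : hnorm ξ ≤ R' := (hR (mem_image_of_mem _ hξ)).trans (le_max_left _ _)
  have h3 : 1 + hnorm η ≤ ((1 + R') / δ + 1) * t := by
    have h4 : hnorm η ≤ hnorm ξ + t := by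
      have := hnorm_op_le ξ (op (inverse ξ) η)
      rwa [op_inverse_cancel] at this
    have h5 : 1 + R' ≤ (1 + R') / δ * t := by
      rw [div_mul_eq_mul_div, le_div_iff₀ hδ]; gcongr
    linarith
  have h6 := hnorm_nonneg η
  rw [Real.rpow_neg ht.le, Real.rpow_neg (by positivity), ← div_eq_mul_inv,
    le_div_iff₀ (by positivity), inv_mul_le_iff₀ (by positivity), mul_comm,
    ← Real.mul_rpow (by positivity) ht.le]
  exact Real.rpow_le_rpow (by positivity) h3 hq

end Heis
end

noncomputable section

namespace Heis

variable {n : ℕ}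

/-! ### Testing with functions of fractional Sobolev regularity -/

/-- The weak inequality rearranged so that every term lies in [0, ∞]. In this form it makes sense
without integrability of the energy and can be passed to limits. -/
theorem IsWeakSupersolution.lintegral_neg_energy_le_of_contDiff {s p : ℝ} {d : Heis n → ℝ}
    {f : Heis n → ℝ → ℝ} {Ω : Set (Heis n)} {u : Heis n → ℝ}
    (hu : IsWeakSupersolution s p d f Ω u) {U : Set (Heis n)} (hU : MeasurableSet U) {F : ℝ}
    (hF : ∀ᵐ ξ ∂(volume.restrict U), |f ξ (u ξ)| ≤ F) {ψ : Heis n → ℝ} (hψ : ContDiff ℝ ∞ ψ)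
    (hψc : HasCompactSupport ψ) (hψΩ : tsupport ψ ⊆ Ω) (hψ0 : ∀ ξ, 0 ≤ ψ ξ)
    (hψU : ∀ ξ, ξ ∉ U → ψ ξ = 0) :
    ∫⁻ z, ENNReal.ofReal (-energyIntegrand s p d u ψ z) ∂(volume.prod volume) ≤
      ∫⁻ z, ENNReal.ofReal (energyIntegrand s p d u ψ z) ∂(volume.prod volume)
        + ENNReal.ofReal F * ∫⁻ ξ, ENNReal.ofReal (ψ ξ) := by
  obtain ⟨hint, hle⟩ := hu.weak ψ hψ hψc hψΩ hψ0
  have hψi : Integrable ψ := hψ.continuous.integrable_of_hasCompactSupport hψc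
  rw [integral_eq_lintegral_pos_part_sub_lintegral_neg_part hint] at hle
  have h1 : ‖∫ ξ, f ξ (u ξ) * ψ ξ‖ ≤ ∫ ξ, F * ψ ξ := by
    refine norm_integral_le_of_norm_le (hψi.const_mul F) ?_
    filter_upwards [(ae_restrict_iff' hU).1 hF] with ξ hξ
    by_cases h : ξ ∈ U
    · rw [norm_mul, Real.norm_eq_abs, Real.norm_eq_abs, abs_of_nonneg (hψ0 ξ)]
      exact mul_le_mul_of_nonneg_right (hξ h) (hψ0 ξ)
    · simp [hψU ξ h]
  rw [integral_const_mul] at h1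
  have h2 := (abs_le.1 (Real.norm_eq_abs _ ▸ h1)).1
  set P := ∫⁻ z, ENNReal.ofReal (energyIntegrand s p d u ψ z) ∂(volume.prod volume)
  set N := ∫⁻ z, ENNReal.ofReal (-energyIntegrand s p d u ψ z) ∂(volume.prod volume)
  have hP : P ≠ ⊤ := hint.lintegral_lt_top.ne
  have hN : N ≠ ⊤ := hint.neg.lintegral_lt_top.ne
  rw [← ofReal_integral_eq_lintegral_ofReal hψi (ae_of_all _ hψ0),
    ← ENNReal.ofReal_mul' (integral_nonneg hψ0), ← ENNReal.ofReal_toReal hP,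
    ← ENNReal.ofReal_toReal hN]
  refine le_trans (ENNReal.ofReal_le_ofReal ?_) ENNReal.ofReal_add_le
  linarith

theorem energyIntegrand_eq (s p : ℝ) (d : Heis n → ℝ) (u ψ : Heis n → ℝ) (z : Heis n × Heis n) :
    energyIntegrand s p d u ψ z = |u z.1 - u z.2| ^ (p - 2) * (u z.1 - u z.2) * (ψ z.1 - ψ z.2)
      * (d (op (inverse z.2) z.1) ^ (homDim n + s * p))⁻¹ := div_eq_mul_inv _ _

theorem Real.rpow_sub_two_mul_self {p t : ℝ} (hp : 1 < p) (ht : 0 ≤ t) :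
    |t| ^ (p - 2) * t = t ^ (p - 1) := by
  rcases ht.eq_or_lt with h | h
  · rw [← h, mul_zero, Real.zero_rpow (by linarith)]
  · rw [abs_of_pos h, ← Real.rpow_add_one h.ne']; congr 1; ring

theorem Real.abs_rpow_sub_two_mul_self {p : ℝ} (hp : 1 < p) (t : ℝ) :
    |(|t| ^ (p - 2) * t)| = |t| ^ (p - 1) := by
  rw [abs_mul, abs_of_nonneg (Real.rpow_nonneg (abs_nonneg t) _)]
  simpa using Real.rpow_sub_two_mul_self hp (abs_nonneg t)

theorem IsHomogeneousNorm.exists_inv_rpow_bounds {d : Heis n → ℝ} (hd : IsHomogeneousNorm d)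
    {q : ℝ} (hq : 0 < q) :
    ∃ c C : ℝ, 0 < c ∧ 0 < C ∧
      ∀ h, c * hnorm h ^ (-q) ≤ (d h ^ q)⁻¹ ∧ (d h ^ q)⁻¹ ≤ C * hnorm h ^ (-q) := by
  obtain ⟨c, C, hc, hC, hb⟩ := hd.exists_bounds
  refine ⟨C ^ (-q), c ^ (-q), by positivity, by positivity, fun h => ?_⟩
  -- At the pole both powers take the default value 0, and the bounds hold trivially.
  by_cases h0 : h = 0
  · rw [h0, (hd.eq_zero_iff 0).2 rfl, hnorm_zero, Real.zero_rpow (by linarith),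
      Real.zero_rpow hq.ne']
    simp
  · have hp := hnorm_pos h0
    have hdp : 0 < d h := (mul_pos hc hp).trans_le (hb h).1
    rw [← Real.mul_rpow hC.le hp.le, Real.rpow_neg (by positivity), ← Real.mul_rpow hc.le hp.le,
      Real.rpow_neg (by positivity)]
    have h1 := (hb h).1
    have h2 := (hb h).2
    constructor <;> gcongr

/-- The kernel splits for Hölder's inequality because (Q/p + s) p = Q + sp; p - 1 of the p factors
go to the flux. The hypothesis on h = 0 covers the diagonal. -/
theorem rpow_mul_rpow_neg_eq {s p : ℝ} (hp : 1 < p) {a b h : ℝ} (ha : 0 ≤ a) (hh : 0 ≤ h)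
    (hb : h = 0 → a = 0) (Q : ℝ) :
    |a / h ^ (Q / p + s)| ^ (p - 1) * |b * h ^ (-(Q / p + s))|
      = a ^ (p - 1) * |b| * h ^ (-(Q + s * p)) := by
  rcases hh.eq_or_lt with h0 | h0
  · rw [hb h0.symm]
    simp [Real.zero_rpow (by linarith : p - 1 ≠ 0)]
  · rw [abs_of_nonneg (by positivity), abs_mul, abs_of_nonneg (by positivity : 0 ≤ h ^ (-(Q / p + s))),
      div_eq_mul_inv, ← Real.rpow_neg hh, Real.mul_rpow ha (by positivity), ← Real.rpow_mul hh]
    have : -(Q + s * p) = -(Q / p + s) * (p - 1) + -(Q / p + s) := by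
      field_simp; ring
    rw [this, Real.rpow_add h0]; ring

section Convergence

variable {s p : ℝ} {u χ : Heis n → ℝ} {U K : Set (Heis n)}

/-- Hölder's inequality: near the diagonal the flux is paired with the difference quotient of χ, and
the local fractional regularity of u bounds the flux. -/
theorem lintegral_diag_le (hp : 1 < p) (hu : Measurable u) (hχ : Measurable χ)
    (U : Set (Heis n)) :
    ∫⁻ z in U ×ˢ U, ENNReal.ofReal (|u z.1 - u z.2| ^ (p - 1) * |χ z.1 - χ z.2|
        * hnorm (op (inverse z.2) z.1) ^ (-(homDim n + s * p))) ∂(volume.prod volume) ≤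
      eLpNorm (fun z : Heis n × Heis n =>
        |u z.1 - u z.2| / hnorm (op (inverse z.2) z.1) ^ (homDim n / p + s)) (ENNReal.ofReal p)
        ((volume.restrict U).prod (volume.restrict U)) ^ (p - 1)
      * eLpNorm (diffQuot (homDim n / p + s) χ) (ENNReal.ofReal p) (volume.prod volume) := by
  rw [Measure.prod_restrict]
  refine le_trans ?_ ((lintegral_rpow_sub_one_mul_le hp (by fun_prop)
    (measurable_diffQuot _ hχ)).trans (mul_le_mul_right (eLpNorm_mono_measure _ Measure.restrict_le_self) _))
  refine le_of_eq (lintegral_congr fun z => ?_)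
  rw [diffQuot, rpow_mul_rpow_neg_eq hp (abs_nonneg _) (hnorm_nonneg _)]
  intro h0
  rw [hnorm_eq_zero] at h0
  have := op_inverse_cancel z.2 z.1
  rw [h0, op_zero] at this
  rw [this]; simp

theorem memLp_abs_add_one (hU : IsCompact (closure U))
    (hu : MemLp u (ENNReal.ofReal p) (volume.restrict U)) :
    MemLp (fun ξ => |u ξ| + 1) (ENNReal.ofReal p) (volume.restrict U) := by
  have hfin : IsFiniteMeasure (volume.restrict U) :=
    ⟨by simpa using (measure_mono subset_closure).trans_lt hU.measure_lt_top⟩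
  exact hu.abs.add (memLp_const 1)

theorem lintegral_abs_add_one_mul_le (hp : 1 < p) (hu : Measurable u) (hχ : Measurable χ)
    (U : Set (Heis n)) :
    ∫⁻ ξ in U, ENNReal.ofReal ((|u ξ| + 1) ^ (p - 1) * |χ ξ|) ≤
      eLpNorm (fun ξ => |u ξ| + 1) (ENNReal.ofReal p) (volume.restrict U) ^ (p - 1)
        * eLpNorm χ (ENNReal.ofReal p) volume := by
  refine le_trans ?_ ((lintegral_rpow_sub_one_mul_le hp (by fun_prop)
    hχ).trans (mul_le_mul_right (eLpNorm_mono_measure _ Measure.restrict_le_self) _))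
  refine le_of_eq (lintegral_congr fun ξ => ?_)
  rw [abs_of_nonneg (by positivity : 0 ≤ |u ξ| + 1)]

theorem lintegral_abs_le (hp : 1 < p) (hu : Measurable u) (hχ : Measurable χ)
    (U : Set (Heis n)) :
    ∫⁻ ξ in U, ENNReal.ofReal |χ ξ| ≤
      eLpNorm (fun ξ => |u ξ| + 1) (ENNReal.ofReal p) (volume.restrict U) ^ (p - 1)
        * eLpNorm χ (ENNReal.ofReal p) volume := by
  refine le_trans (lintegral_mono fun ξ => ENNReal.ofReal_le_ofReal ?_)
    (lintegral_abs_add_one_mul_le hp hu hχ U)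
  have : 1 ≤ (|u ξ| + 1) ^ (p - 1) :=
    Real.one_le_rpow (by linarith [abs_nonneg (u ξ)]) (by linarith)
  nlinarith [abs_nonneg (χ ξ)]

/-- Only the positive part of u(ξ) - u(η) occurs, so far values of u enter through u_- alone, which
is in the tail space. The bound (u(ξ) - u(η))_+ ≤ (|u(ξ)| + 1)(1 + u_-(η)) separates the variables,
and Hölder in ξ brings out the norm of χ; the constant does not depend on χ. -/
theorem exists_lintegral_offDiag_le (hs : 0 < s) (hs1 : s < 1) (hp : 1 < p) (hu : Measurable u)
    (huU : MemLp u (ENNReal.ofReal p) (volume.restrict U))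
    (hut : MemTailSpace s p fun ξ => max (-u ξ) 0)
    (hU : IsOpen U) (hUc : IsCompact (closure U)) (hK : IsCompact K) (hKU : K ⊆ U) :
    ∃ A : ℝ≥0∞, A ≠ ⊤ ∧ ∀ χ : Heis n → ℝ, Measurable χ →
      ∫⁻ z in K ×ˢ Uᶜ, ENNReal.ofReal (max (u z.1 - u z.2) 0 ^ (p - 1) * |χ z.1|
        * hnorm (op (inverse z.2) z.1) ^ (-(homDim n + s * p))) ∂(volume.prod volume) ≤
      A * eLpNorm χ (ENNReal.ofReal p) volume := by
  have hQ := homDim_pos (n := n)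
  have hsp : 0 < s * p := by nlinarith
  obtain ⟨C, hC, hker⟩ := exists_kern_le_weight (q := homDim n + s * p) (by positivity) hK hU hKU
  have hT := hut.lintegral_one_add_lt_top hs hs1 hp (fun η => le_max_right _ _) 1 zero_le_one
  set T := ∫⁻ η : Heis n, ENNReal.ofReal ((1 + max (-u η) 0) ^ (p - 1)
    * (1 + hnorm η) ^ (-(homDim n + s * p)))
  refine ⟨ENNReal.ofReal C * T *
    eLpNorm (fun ξ => |u ξ| + 1) (ENNReal.ofReal p) (volume.restrict U) ^ (p - 1),
    ENNReal.mul_ne_top (ENNReal.mul_ne_top ENNReal.ofReal_ne_top hT.ne)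
      (ENNReal.rpow_ne_top_of_nonneg (by linarith) (memLp_abs_add_one hUc huU).2.ne),
    fun χ hχ => ?_⟩
  rw [← Measure.prod_restrict, lintegral_prod _ (by fun_prop)]
  calc ∫⁻ ξ in K, ∫⁻ η in Uᶜ, ENNReal.ofReal (max (u ξ - u η) 0 ^ (p - 1) * |χ ξ|
        * hnorm (op (inverse η) ξ) ^ (-(homDim n + s * p)))
      ≤ ∫⁻ ξ in K, ENNReal.ofReal ((|u ξ| + 1) ^ (p - 1) * |χ ξ|) * (ENNReal.ofReal C * T) := by
        refine setLIntegral_mono' hK.measurableSet fun ξ hξ => ?_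
        refine (setLIntegral_mono' (g := fun η => ENNReal.ofReal ((|u ξ| + 1) ^ (p - 1) * |χ ξ|) *
          (ENNReal.ofReal C * ENNReal.ofReal ((1 + max (-u η) 0) ^ (p - 1)
            * (1 + hnorm η) ^ (-(homDim n + s * p))))) hU.measurableSet.compl
          fun η hη => ?_).trans ?_
        · have h0 := hnorm_nonneg η
          rw [← ENNReal.ofReal_mul hC, ← ENNReal.ofReal_mul (by positivity)]
          refine ENNReal.ofReal_le_ofReal ?_
          have h1 : max (u ξ - u η) 0 ≤ (|u ξ| + 1) * (1 + max (-u η) 0) := by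
            have h2 := le_abs_self (u ξ)
            have h3 := le_max_left (-u η) 0
            have h4 := le_max_right (-u η) 0
            have h5 := abs_nonneg (u ξ)
            refine max_le ?_ (by positivity)
            nlinarith
          have h6 : max (u ξ - u η) 0 ^ (p - 1)
              ≤ (|u ξ| + 1) ^ (p - 1) * (1 + max (-u η) 0) ^ (p - 1) := by
            rw [← Real.mul_rpow (by positivity) (by positivity)]
            exact Real.rpow_le_rpow (le_max_right _ _) h1 (by linarith)
          calc _ ≤ ((|u ξ| + 1) ^ (p - 1) * (1 + max (-u η) 0) ^ (p - 1)) * |χ ξ|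
                * (C * (1 + hnorm η) ^ (-(homDim n + s * p))) := by
                refine mul_le_mul (by gcongr) (hker ξ hξ η hη)
                  (Real.rpow_nonneg (hnorm_nonneg _) _) (by positivity)
            _ = _ := by ring
        · rw [lintegral_const_mul' _ _ ENNReal.ofReal_ne_top,
            lintegral_const_mul' _ _ ENNReal.ofReal_ne_top]
          gcongr
          exact setLIntegral_le_lintegral _ _
    _ = (∫⁻ ξ in K, ENNReal.ofReal ((|u ξ| + 1) ^ (p - 1) * |χ ξ|)) * (ENNReal.ofReal C * T) :=
        lintegral_mul_const _ (by fun_prop)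
    _ ≤ (eLpNorm (fun ξ => |u ξ| + 1) (ENNReal.ofReal p) (volume.restrict U) ^ (p - 1)
        * eLpNorm χ (ENNReal.ofReal p) volume) * (ENNReal.ofReal C * T) := by
        gcongr
        exact (lintegral_mono_set hKU).trans (lintegral_abs_add_one_mul_le hp hu hχ U)
    _ = _ := by ring

end Convergence

end Heis
end

noncomputable section

namespace Heis

variable {n : ℕ}

theorem measurable_energyIntegrand {s p : ℝ} {d : Heis n → ℝ} (hd : Measurable d)
    {u ψ : Heis n → ℝ} (hu : Measurable u) (hψ : Measurable ψ) :
    Measurable (energyIntegrand s p d u ψ) := by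
  have : Measurable fun z : Heis n × Heis n => d (op (inverse z.2) z.1) := hd.comp (by fun_prop)
  unfold energyIntegrand
  fun_prop

/-- The positive part of the energy of `ψ'` is that of `ψ` up to controlled errors. -/
theorem ofReal_energyIntegrand_le {s p : ℝ} (hp : 1 < p) {d : Heis n → ℝ} {C : ℝ} (hC : 0 ≤ C)
    (hd0 : ∀ h, 0 ≤ (d h ^ (homDim n + s * p))⁻¹)
    (hd : ∀ h, (d h ^ (homDim n + s * p))⁻¹ ≤ C * hnorm h ^ (-(homDim n + s * p)))
    {u ψ ψ' : Heis n → ℝ} (hψ' : ∀ ξ, 0 ≤ ψ' ξ) (hψ : ∀ ξ, 0 ≤ ψ ξ)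
    {K U : Set (Heis n)} (hKU : K ⊆ U) (hψK : ∀ ξ, ξ ∉ K → ψ ξ = 0) (hψK' : ∀ ξ, ξ ∉ K → ψ' ξ = 0)
    (z : Heis n × Heis n) :
    ENNReal.ofReal (energyIntegrand s p d u ψ' z) ≤ ENNReal.ofReal (energyIntegrand s p d u ψ z)
      + ENNReal.ofReal C * ((U ×ˢ U).indicator (fun z => ENNReal.ofReal (|u z.1 - u z.2| ^ (p - 1)
          * |(ψ' z.1 - ψ z.1) - (ψ' z.2 - ψ z.2)|
          * hnorm (op (inverse z.2) z.1) ^ (-(homDim n + s * p)))) z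
        + ((K ×ˢ Uᶜ).indicator (fun z => ENNReal.ofReal (max (u z.1 - u z.2) 0 ^ (p - 1)
          * |ψ' z.1 - ψ z.1| * hnorm (op (inverse z.2) z.1) ^ (-(homDim n + s * p)))) z
        + (K ×ˢ Uᶜ).indicator (fun z => ENNReal.ofReal (max (u z.1 - u z.2) 0 ^ (p - 1)
          * |ψ' z.1 - ψ z.1| * hnorm (op (inverse z.2) z.1) ^ (-(homDim n + s * p)))) z.swap)) := by
  obtain ⟨ξ, η⟩ := z
  simp only [energyIntegrand_eq, Prod.swap_prod_mk]
  have hk0 : 0 ≤ hnorm (op (inverse η) ξ) ^ (-(homDim n + s * p)) :=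
    Real.rpow_nonneg (hnorm_nonneg _) _
  have hdd := hd (op (inverse η) ξ)
  have hdd0 := hd0 (op (inverse η) ξ)
  have hsym := hnorm_inverse_op_comm ξ η
  generalize (d (op (inverse η) ξ) ^ (homDim n + s * p))⁻¹ = D at *
  obtain ⟨k, hk⟩ : ∃ k, hnorm (op (inverse η) ξ) ^ (-(homDim n + s * p)) = k := ⟨_, rfl⟩
  rw [hk] at hk0 hdd
  have hJ := Real.abs_rpow_sub_two_mul_self hp (u ξ - u η)
  -- one point inside, the other one outside
  have mixed : ∀ a b v v' : ℝ, 0 ≤ v → 0 ≤ v' →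
      ENNReal.ofReal (|a - b| ^ (p - 2) * (a - b) * v' * D) ≤
      ENNReal.ofReal (|a - b| ^ (p - 2) * (a - b) * v * D)
        + ENNReal.ofReal C * ENNReal.ofReal (max (a - b) 0 ^ (p - 1) * |v' - v| * k) := by
    intro a b v v' hv hv'
    -- Where the inner value is the smaller one, the energy of v' is nonpositive and its positive
    -- part vanishes. This is why the error contains only (a - b)_+.
    rcases le_or_gt a b with hab | hab
    · rw [ENNReal.ofReal_of_nonpos]
      · exact zero_le
      · refine mul_nonpos_of_nonpos_of_nonneg (mul_nonpos_of_nonpos_of_nonneg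
          (mul_nonpos_of_nonneg_of_nonpos ?_ ?_) hv') hdd0
        · positivity
        · linarith
    · have hab' : 0 < a - b := by linarith
      rw [Real.rpow_sub_two_mul_self hp hab'.le, max_eq_left hab'.le, ← ENNReal.ofReal_mul hC,
        ← ENNReal.ofReal_add (by positivity) (by positivity)]
      refine ENNReal.ofReal_le_ofReal ?_
      have h1 : v' ≤ v + |v' - v| := by linarith [le_abs_self (v' - v)]
      calc (a - b) ^ (p - 1) * v' * D ≤ (a - b) ^ (p - 1) * (v + |v' - v|) * D := by gcongr
        _ = (a - b) ^ (p - 1) * v * D + (a - b) ^ (p - 1) * |v' - v| * D := by ring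
        _ ≤ (a - b) ^ (p - 1) * v * D + (a - b) ^ (p - 1) * |v' - v| * (C * k) := by gcongr
        _ = _ := by ring
  by_cases hξ : ξ ∈ U <;> by_cases hη : η ∈ U
  · -- both inside
    rw [indicator_of_mem (by exact ⟨hξ, hη⟩), mul_add, hk, ← ENNReal.ofReal_mul hC]
    refine le_trans ?_ (add_le_add_right le_self_add _)
    refine le_trans (ENNReal.ofReal_le_ofReal ?_) ENNReal.ofReal_add_le
    have h1 : |u ξ - u η| ^ (p - 2) * (u ξ - u η) * ((ψ' ξ - ψ ξ) - (ψ' η - ψ η)) * D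
        ≤ |u ξ - u η| ^ (p - 1) * |(ψ' ξ - ψ ξ) - (ψ' η - ψ η)| * (C * k) := by
      refine mul_le_mul ?_ hdd hdd0 (by positivity)
      refine (le_abs_self _).trans (le_of_eq ?_)
      rw [abs_mul, hJ]
    linarith
  · have hηK : η ∉ K := fun h => hη (hKU h)
    rw [hψK η hηK, hψK' η hηK, sub_zero, sub_zero]
    by_cases hξK : ξ ∈ K
    · rw [indicator_of_mem (s := K ×ˢ Uᶜ) (by exact ⟨hξK, hη⟩), hk]
      refine (mixed (u ξ) (u η) (ψ ξ) (ψ' ξ) (hψ ξ) (hψ' ξ)).trans ?_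
      gcongr
      exact le_trans le_self_add le_add_self
    · rw [hψK' ξ hξK]; simp
  · have hξK : ξ ∉ K := fun h => hξ (hKU h)
    rw [hψK ξ hξK, hψK' ξ hξK, zero_sub, zero_sub]
    by_cases hηK : η ∈ K
    · rw [indicator_of_mem (s := K ×ˢ Uᶜ) (a := (η, ξ)) (by exact ⟨hηK, hξ⟩), hsym, hk]
      have e : ∀ v : ℝ, |u ξ - u η| ^ (p - 2) * (u ξ - u η) * (-v) * D
          = |u η - u ξ| ^ (p - 2) * (u η - u ξ) * v * D := by
        intro v; rw [abs_sub_comm]; ring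
      rw [e, e]
      refine (mixed (u η) (u ξ) (ψ η) (ψ' η) (hψ η) (hψ' η)).trans ?_
      gcongr
      exact le_trans le_add_self le_add_self
    · rw [hψK' η hηK]; simp
  · have hξK : ξ ∉ K := fun h => hξ (hKU h)
    have hηK : η ∉ K := fun h => hη (hKU h)
    rw [hψK' η hηK, hψK' ξ hξK]; simp

/-- The weak formulation holds for nonnegative test functions of fractional Sobolev regularity. -/
theorem IsWeakSupersolution.lintegral_neg_energy_le {s p : ℝ} (hs : 0 < s) (hs1 : s < 1)
    (hp : 1 < p) {d : Heis n → ℝ} (hd : IsHomogeneousNorm d)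
    {f : Heis n → ℝ → ℝ} {Ω : Set (Heis n)} {u : Heis n → ℝ}
    (hu : IsWeakSupersolution s p d f Ω u) (hum : Measurable u)
    {U K : Set (Heis n)} (hU : IsOpen U) (hUc : IsCompact (closure U)) (hUΩ : closure U ⊆ Ω)
    (hK : IsCompact K) (hKU : K ⊆ U) {F : ℝ}
    (hF : ∀ᵐ ξ ∂(volume.restrict U), |f ξ (u ξ)| ≤ F) {ψ : Heis n → ℝ} (hψm : Measurable ψ)
    (hψ0 : ∀ ξ, 0 ≤ ψ ξ) (hψK : ∀ ξ, ξ ∉ K → ψ ξ = 0) (hψp : MemLp ψ (ENNReal.ofReal p))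
    (hψs : MemLp (diffQuot (homDim n / p + s) ψ) (ENNReal.ofReal p) (volume.prod volume)) :
    ∫⁻ z, ENNReal.ofReal (-energyIntegrand s p d u ψ z) ∂(volume.prod volume) ≤
      ∫⁻ z, ENNReal.ofReal (energyIntegrand s p d u ψ z) ∂(volume.prod volume)
        + ENNReal.ofReal F * ∫⁻ ξ, ENNReal.ofReal (ψ ξ) := by
  have hQ := homDim_pos (n := n)
  have hsp : 0 < s * p := by nlinarith
  have hq : 0 < homDim n + s * p := by positivity
  have hdm : Measurable d := hd.continuous.measurable
  obtain ⟨_, C, _, hC, hdb⟩ := hd.exists_inv_rpow_bounds hq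
  have hd0 : ∀ h, 0 ≤ (d h ^ (homDim n + s * p))⁻¹ := fun h => by
    have := hd.nonneg h; positivity
  obtain ⟨K', hK', hKK', hK'U, hmol⟩ := exists_compact_mollify_eq_zero hK hU hKU
  have hψi : Integrable ψ := by
    have h1 : IntegrableOn ψ K := by
      have : IsFiniteMeasure (volume.restrict K) := ⟨by simpa using hK.measure_lt_top⟩
      exact (hψp.restrict K).integrable (by simpa using hp.le)
    exact (integrableOn_iff_integrable_of_support_subset
      (fun ξ hξ => by by_contra h; exact hξ (hψK ξ h))).1 h1
  have hψK' : ∀ ξ, ξ ∉ K' → ψ ξ = 0 := fun ξ h => hψK ξ fun h' => h (interior_subset (hKK' h'))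
  set ψ' : ℕ → Heis n → ℝ := fun i => mollify (mollifier n i) ψ with hψ'def
  have hψ's : ∀ i, ContDiff ℝ ∞ (ψ' i) := fun i =>
    contDiff_mollify (contDiff_mollifier i) (hasCompactSupport_mollifier i) hψi
  have hψ'm : ∀ i, Measurable (ψ' i) := fun i => (hψ's i).continuous.measurable
  have hψ'0 : ∀ i ξ, 0 ≤ ψ' i ξ := fun i => mollify_nonneg (mollifier_nonneg i) hψ0
  have hsob := hu.memLoc U hU hUc hUΩ
  have hconv := tendsto_eLpNorm_mollify_sub hp.le hψm hψp
  have hconvs := tendsto_eLpNorm_diffQuot_mollify_sub hp.le hψm hψi hψs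
  obtain ⟨A, hA, hoff⟩ := exists_lintegral_offDiag_le hs hs1 hp hum hsob.1 hu.negPart hU hUc hK' hK'U
  -- the errors
  set a : ℕ → ℝ≥0∞ := fun i => eLpNorm (fun ξ => ψ' i ξ - ψ ξ) (ENNReal.ofReal p) volume with ha
  set b : ℕ → ℝ≥0∞ := fun i => eLpNorm (fun z => diffQuot (homDim n / p + s) (ψ' i) z
    - diffQuot (homDim n / p + s) ψ z) (ENNReal.ofReal p) (volume.prod volume) with hb
  set B := eLpNorm (fun z : Heis n × Heis n =>
        |u z.1 - u z.2| / hnorm (op (inverse z.2) z.1) ^ (homDim n / p + s)) (ENNReal.ofReal p)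
        ((volume.restrict U).prod (volume.restrict U)) ^ (p - 1) with hBdef
  have hB : B ≠ ⊤ := ENNReal.rpow_ne_top_of_nonneg (by linarith) hsob.2.2.ne
  set B' := eLpNorm (fun ξ => |u ξ| + 1) (ENNReal.ofReal p) (volume.restrict U) ^ (p - 1) with hB'def
  have hB' : B' ≠ ⊤ := ENNReal.rpow_ne_top_of_nonneg (by linarith)
    (memLp_abs_add_one hUc hsob.1).2.ne
  set Em := ∫⁻ z, ENNReal.ofReal (-energyIntegrand s p d u ψ z) ∂(volume.prod volume)
  set Ep := ∫⁻ z, ENNReal.ofReal (energyIntegrand s p d u ψ z) ∂(volume.prod volume)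
  set M := ∫⁻ ξ, ENNReal.ofReal (ψ ξ)
  -- The positive parts of the energies of ψ and of its mollification differ by errors linear in the
  -- two L^p distances a i and b i, both of which tend to 0. The negative part, where u_+ at
  -- infinity enters, is not estimated here.
  have hstep : ∀ᶠ i in atTop,
      ∫⁻ z, ENNReal.ofReal (-energyIntegrand s p d u (ψ' i) z) ∂(volume.prod volume) ≤
      Ep + ENNReal.ofReal C * (B * b i + (A * a i + A * a i))
        + ENNReal.ofReal F * (M + B' * a i) := by
    filter_upwards [hmol ψ hψK] with i hi
    have hts : tsupport (ψ' i) ⊆ K' := closure_minimal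
      (fun ξ hξ => by by_contra h; exact hξ (hi ξ h)) hK'.isClosed
    have h1 := hu.lintegral_neg_energy_le_of_contDiff hU.measurableSet hF (hψ's i)
      (HasCompactSupport.intro hK' hi) (hts.trans (hK'U.trans (subset_closure.trans hUΩ))) (hψ'0 i)
      (fun ξ hξ => hi ξ fun h => hξ (hK'U h))
    have hχm : Measurable fun ξ => ψ' i ξ - ψ ξ := (hψ'm i).sub hψm
    refine h1.trans (add_le_add ?_ (mul_le_mul_right ?_ _))
    · refine (lintegral_mono (ofReal_energyIntegrand_le hp hC.le hd0 (fun h => (hdb h).2) (hψ'0 i)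
        hψ0 hK'U hψK' hi)).trans ?_
      rw [lintegral_add_left (measurable_energyIntegrand hdm hum hψm).ennreal_ofReal]
      refine add_le_add_right ?_ _
      rw [lintegral_const_mul' _ _ ENNReal.ofReal_ne_top]
      refine mul_le_mul_right ?_ _
      have hm1 : Measurable fun z : Heis n × Heis n => ENNReal.ofReal (|u z.1 - u z.2| ^ (p - 1)
          * |(ψ' i z.1 - ψ z.1) - (ψ' i z.2 - ψ z.2)|
          * hnorm (op (inverse z.2) z.1) ^ (-(homDim n + s * p))) := by
        have := hψ'm i
        fun_prop
      have hm2 : Measurable fun z : Heis n × Heis n => ENNReal.ofReal (max (u z.1 - u z.2) 0 ^ (p - 1)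
          * |ψ' i z.1 - ψ z.1| * hnorm (op (inverse z.2) z.1) ^ (-(homDim n + s * p))) := by
        have := hψ'm i
        fun_prop
      have hS1 : MeasurableSet (U ×ˢ U) := hU.measurableSet.prod hU.measurableSet
      have hS2 : MeasurableSet (K' ×ˢ Uᶜ) := hK'.measurableSet.prod hU.measurableSet.compl
      have hm3 := hm2.indicator hS2
      rw [lintegral_add_left (hm1.indicator hS1), lintegral_add_left hm3]
      refine add_le_add ?_ (add_le_add ?_ ?_)
      · rw [lintegral_indicator hS1]
        refine (lintegral_diag_le hp hum hχm U).trans (le_of_eq ?_)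
        congr 2
        ext z
        simp only [diffQuot, hψ'def]; ring
      · rw [lintegral_indicator hS2]
        exact hoff _ hχm
      · rw [lintegral_prod_swap, lintegral_indicator hS2]
        exact hoff _ hχm
    · calc ∫⁻ ξ, ENNReal.ofReal (ψ' i ξ)
          ≤ ∫⁻ ξ, (ENNReal.ofReal (ψ ξ) + U.indicator (fun ξ => ENNReal.ofReal |ψ' i ξ - ψ ξ|) ξ) := by
            refine lintegral_mono fun ξ => ?_
            by_cases h : ξ ∈ U
            · rw [indicator_of_mem h]
              refine le_trans (ENNReal.ofReal_le_ofReal ?_) ENNReal.ofReal_add_le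
              linarith [le_abs_self (ψ' i ξ - ψ ξ)]
            · have h0 : ψ' i ξ = 0 := hi ξ fun h' => h (hK'U h')
              rw [h0]; simp
        _ = M + ∫⁻ ξ in U, ENNReal.ofReal |ψ' i ξ - ψ ξ| := by
            rw [lintegral_add_left hψm.ennreal_ofReal, lintegral_indicator hU.measurableSet]
        _ ≤ M + B' * a i := add_le_add_right (lintegral_abs_le hp hum hχm U) _
  have hlim : Tendsto (fun i => Ep + ENNReal.ofReal C * (B * b i + (A * a i + A * a i))
        + ENNReal.ofReal F * (M + B' * a i)) atTop
      (𝓝 (Ep + ENNReal.ofReal C * (B * 0 + (A * 0 + A * 0)) + ENNReal.ofReal F * (M + B' * 0))) := by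
    have t1 : Tendsto (fun i => B * b i) atTop (𝓝 (B * 0)) :=
      ENNReal.Tendsto.const_mul hconvs (Or.inr hB)
    have t2 : Tendsto (fun i => A * a i) atTop (𝓝 (A * 0)) :=
      ENNReal.Tendsto.const_mul hconv (Or.inr hA)
    have t3 : Tendsto (fun i => B' * a i) atTop (𝓝 (B' * 0)) :=
      ENNReal.Tendsto.const_mul hconv (Or.inr hB')
    exact (tendsto_const_nhds.add (ENNReal.Tendsto.const_mul (t1.add (t2.add t2))
      (Or.inr ENNReal.ofReal_ne_top))).add (ENNReal.Tendsto.const_mul (tendsto_const_nhds.add t3)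
      (Or.inr ENNReal.ofReal_ne_top))
  simp only [mul_zero, add_zero] at hlim
  -- an almost everywhere convergent subsequence
  have hmeas := tendstoInMeasure_of_tendsto_eLpNorm (p := ENNReal.ofReal p) (f := ψ') (g := ψ)
    (by simp; linarith) (fun i => (hψ'm i).aestronglyMeasurable) hψm.aestronglyMeasurable hconv
  obtain ⟨ns, hns, hae⟩ := hmeas.exists_seq_tendsto_ae
  have hE : ∀ᵐ z ∂((volume : Measure (Heis n)).prod volume), Tendsto
      (fun i => ENNReal.ofReal (-energyIntegrand s p d u (ψ' (ns i)) z)) atTop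
      (𝓝 (ENNReal.ofReal (-energyIntegrand s p d u ψ z))) := by
    filter_upwards [Measure.quasiMeasurePreserving_fst.ae hae,
      Measure.quasiMeasurePreserving_snd.ae hae] with z h1 h2
    refine ENNReal.tendsto_ofReal (Tendsto.neg ?_)
    unfold energyIntegrand
    exact (tendsto_const_nhds.mul (h1.sub h2)).div_const _
  -- Fatou's lemma loses mass only in the harmless direction, since the negative part is the
  -- quantity to be bounded from above.
  calc Em ≤ liminf (fun i => ∫⁻ z, ENNReal.ofReal (-energyIntegrand s p d u (ψ' (ns i)) z)
        ∂(volume.prod volume)) atTop := by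
        refine le_trans (le_of_eq (lintegral_congr_ae ?_)) (lintegral_liminf_le fun i =>
          (measurable_energyIntegrand hdm hum (hψ'm (ns i))).neg.ennreal_ofReal)
        filter_upwards [hE] with z hz
        exact hz.liminf_eq.symm
    _ ≤ liminf (fun i => Ep + ENNReal.ofReal C * (B * b (ns i) + (A * a (ns i) + A * a (ns i)))
        + ENNReal.ofReal F * (M + B' * a (ns i))) atTop :=
        liminf_le_liminf (hns.tendsto_atTop.eventually hstep)
    _ = _ := (hlim.comp hns.tendsto_atTop).liminf_eq

end Heis
end

noncomputable section

namespace Heis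

variable {n : ℕ}

/-! ### Cutoff functions -/

/-- The cutoff function equal to `1` on `B_R(ξ₀)` and to `0` off `B_{R+δ}(ξ₀)`. -/
def cutoff (ξ₀ : Heis n) (R δ : ℝ) (ξ : Heis n) : ℝ :=
  max 0 (min 1 ((R + δ - hnorm (op (inverse ξ₀) ξ)) / δ))

variable {ξ₀ ξ η : Heis n} {R δ : ℝ}

theorem cutoff_nonneg : 0 ≤ cutoff ξ₀ R δ ξ := le_max_left _ _

theorem cutoff_le_one : cutoff ξ₀ R δ ξ ≤ 1 := max_le zero_le_one (min_le_left _ _)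

theorem cutoff_eq_one (hδ : 0 < δ) (h : ξ ∈ hball ξ₀ R) : cutoff ξ₀ R δ ξ = 1 := by
  have h' := mem_hball.1 h
  unfold cutoff
  rw [min_eq_left, max_eq_right zero_le_one]
  rw [le_div_iff₀ hδ]; linarith

theorem cutoff_eq_zero (hδ : 0 < δ) (h : ξ ∉ hball ξ₀ (R + δ)) : cutoff ξ₀ R δ ξ = 0 := by
  have h' := not_lt.1 (mt mem_hball.2 h)
  unfold cutoff
  rw [max_eq_left]
  exact (min_le_right _ _).trans (div_nonpos_of_nonpos_of_nonneg (by linarith) hδ.le)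

theorem measurable_cutoff : Measurable (cutoff ξ₀ R δ) := by
  unfold cutoff; fun_prop

/-- The cutoff is Lipschitz with constant 1/δ by the triangle inequality. Together with the trivial
bound 1, this is the base of the power in `cutKernel` with slope 1/δ. -/
theorem abs_cutoff_sub_le (hδ : 0 < δ) :
    |cutoff ξ₀ R δ ξ - cutoff ξ₀ R δ η| ≤ min 1 (δ⁻¹ * hnorm (op (inverse η) ξ)) := by
  refine le_min ?_ ?_
  · rw [abs_le]
    constructor <;>
    linarith [cutoff_nonneg (ξ₀ := ξ₀) (R := R) (δ := δ) (ξ := ξ),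
      cutoff_nonneg (ξ₀ := ξ₀) (R := R) (δ := δ) (ξ := η),
      cutoff_le_one (ξ₀ := ξ₀) (R := R) (δ := δ) (ξ := ξ),
      cutoff_le_one (ξ₀ := ξ₀) (R := R) (δ := δ) (ξ := η)]
  · have h1 : |hnorm (op (inverse ξ₀) ξ) - hnorm (op (inverse ξ₀) η)|
        ≤ hnorm (op (inverse η) ξ) := by
      rw [abs_le]
      have h2 := hnorm_inverse_op_triangle ξ₀ η ξ
      have h3 := hnorm_inverse_op_triangle ξ₀ ξ η
      rw [hnorm_inverse_op_comm ξ η] at h3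
      constructor <;> linarith
    have clamp : ∀ a b : ℝ, |max 0 (min 1 a) - max 0 (min 1 b)| ≤ |a - b| := by
      intro a b
      rw [max_comm 0, max_comm 0, min_comm 1, min_comm 1]
      refine (abs_max_sub_max_le_abs _ _ _).trans ?_
      refine (abs_min_sub_min_le_max _ _ _ _).trans ?_
      simp
    refine (clamp _ _).trans ?_
    rw [← sub_div, abs_div, abs_of_pos hδ, div_eq_inv_mul]
    gcongr
    rw [abs_sub_comm] at h1
    refine le_trans (le_of_eq ?_) h1
    congr 1; ring

theorem cutKernel_comm (s p L : ℝ) (ξ η : Heis n) :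
    cutKernel s p L (op (inverse η) ξ) = cutKernel s p L (op (inverse ξ) η) := by
  unfold cutKernel; rw [hnorm_inverse_op_comm]

theorem measurable_cutKernel_op (s p L : ℝ) :
    Measurable fun z : Heis n × Heis n => cutKernel s p L (op (inverse z.2) z.1) :=
  (measurable_cutKernel s p L).comp (by fun_prop)

/-- Integrating first in the other variable gives a constant, by translation invariance. With slope
1/δ it is the factor δ^(-sp) of the Caccioppoli estimate. -/
theorem lintegral_fst_mul_cutKernel (s p : ℝ) {L : ℝ} (hL : 0 < L) {g : Heis n → ℝ≥0∞}
    (hg : Measurable g) :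
    ∫⁻ z, g z.1 * cutKernel s p L (op (inverse z.2) z.1)
        ∂((volume : Measure (Heis n)).prod volume)
      = (∫⁻ ξ, g ξ) * (ENNReal.ofReal (L ^ (s * p)) * ∫⁻ h : Heis n, cutKernel s p 1 h) := by
  have hm : Measurable fun z : Heis n × Heis n => g z.1 * cutKernel s p L (op (inverse z.2) z.1) :=
    (hg.comp measurable_fst).mul (measurable_cutKernel_op s p L)
  rw [lintegral_prod _ hm.aemeasurable, ← lintegral_mul_const _ hg]
  refine lintegral_congr fun ξ => ?_
  simp only [cutKernel_comm s p L ξ]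
  have hm' : Measurable fun η : Heis n => cutKernel s p L (op (inverse ξ) η) :=
    (measurable_cutKernel s p L).comp (by fun_prop)
  rw [lintegral_const_mul _ hm', lintegral_op_left _ (measurable_cutKernel s p L), lintegral_cutKernel s p hL]

theorem lintegral_snd_mul_cutKernel (s p : ℝ) {L : ℝ} (hL : 0 < L) {g : Heis n → ℝ≥0∞}
    (hg : Measurable g) :
    ∫⁻ z, g z.2 * cutKernel s p L (op (inverse z.2) z.1)
        ∂((volume : Measure (Heis n)).prod volume)
      = (∫⁻ ξ, g ξ) * (ENNReal.ofReal (L ^ (s * p)) * ∫⁻ h : Heis n, cutKernel s p 1 h) := by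
  rw [← lintegral_fst_mul_cutKernel s p hL hg, ← lintegral_prod_swap]
  refine lintegral_congr fun z => ?_
  simp only [Prod.fst_swap, Prod.snd_swap]
  rw [cutKernel_comm]

theorem rpow_mul_le_cutKernel {s p L : ℝ} (hp : 0 ≤ p) {t c : ℝ} (hc : 0 ≤ c) (ht0 : 0 ≤ t)
    {h : Heis n} (ht : t ≤ min 1 (L * hnorm h)) :
    ENNReal.ofReal (c * t ^ p * hnorm h ^ (-(homDim n + s * p)))
      ≤ ENNReal.ofReal c * cutKernel s p L h := by
  unfold cutKernel
  rw [← ENNReal.ofReal_mul hc, mul_assoc]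
  refine ENNReal.ofReal_le_ofReal (mul_le_mul_of_nonneg_left ?_ hc)
  have := hnorm_nonneg h
  gcongr

/-! ### The test function -/

theorem abs_max_sub_max_le (k a b : ℝ) : |max (k - a) 0 - max (k - b) 0| ≤ |a - b| := by
  refine (abs_max_sub_max_le_abs _ _ _).trans (le_of_eq ?_)
  rw [abs_sub_comm]; congr 1; ring

theorem abs_mul_rpow_sub_le {p w₁ w₂ a₁ a₂ : ℝ} (hp : 1 < p) (hw₂ : 0 ≤ w₂) (h₁ : 0 ≤ a₁)
    (h₁' : a₁ ≤ 1) (h₂ : 0 ≤ a₂) (h₂' : a₂ ≤ 1) :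
    |w₁ * a₁ ^ p - w₂ * a₂ ^ p| ≤ |w₁ - w₂| + w₂ * (p * |a₁ - a₂|) := by
  have hp0 : 0 < p := by linarith
  have aux : ∀ a b : ℝ, 0 ≤ a → a ≤ b → b ≤ 1 → |b ^ p - a ^ p| ≤ p * |b - a| := by
    intro a b ha hab hb
    have h := Real.rpow_sub_rpow_le ha hab hp.le
    rw [abs_of_nonneg (sub_nonneg.2 (Real.rpow_le_rpow ha hab hp0.le)), abs_of_nonneg (by linarith)]
    refine h.trans ?_
    have h3 : b ^ (p - 1) ≤ 1 := Real.rpow_le_one (ha.trans hab) hb (by linarith)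
    have h4 : 0 ≤ b - a := by linarith
    calc p * b ^ (p - 1) * (b - a) ≤ p * 1 * (b - a) := by gcongr
      _ = _ := by ring
  have h3 : |a₁ ^ p - a₂ ^ p| ≤ p * |a₁ - a₂| := by
    rcases le_total a₁ a₂ with h | h
    · rw [abs_sub_comm, abs_sub_comm a₁]; exact aux _ _ h₁ h h₂'
    · exact aux _ _ h₂ h h₁'
  have h4 : a₁ ^ p ≤ 1 := Real.rpow_le_one h₁ h₁' hp0.le
  have h5 : 0 ≤ a₁ ^ p := Real.rpow_nonneg h₁ _
  calc |w₁ * a₁ ^ p - w₂ * a₂ ^ p| = |(w₁ - w₂) * a₁ ^ p + w₂ * (a₁ ^ p - a₂ ^ p)| := by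
        congr 1; ring
    _ ≤ |w₁ - w₂| * a₁ ^ p + w₂ * |a₁ ^ p - a₂ ^ p| := by
        refine (abs_add_le _ _).trans (le_of_eq ?_)
        rw [abs_mul, abs_mul, abs_of_nonneg h5, abs_of_nonneg hw₂]
    _ ≤ |w₁ - w₂| * 1 + w₂ * (p * |a₁ - a₂|) := by gcongr
    _ = _ := by ring

/-- The test function `(k - u)_+ φ^p`. -/
def testFun (p k : ℝ) (u : Heis n → ℝ) (ξ₀ : Heis n) (R δ : ℝ) (ξ : Heis n) : ℝ :=
  max (k - u ξ) 0 * cutoff ξ₀ R δ ξ ^ p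

section TestFun

variable {s p k : ℝ} {u : Heis n → ℝ}

theorem testFun_nonneg : 0 ≤ testFun p k u ξ₀ R δ ξ :=
  mul_nonneg (le_max_right _ _) (Real.rpow_nonneg cutoff_nonneg _)

theorem testFun_eq_zero (hp : 1 < p) (hδ : 0 < δ) (h : ξ ∉ hball ξ₀ (R + δ)) :
    testFun p k u ξ₀ R δ ξ = 0 := by
  rw [testFun, cutoff_eq_zero hδ h, Real.zero_rpow (by linarith), mul_zero]

theorem testFun_le (hp : 1 < p) : testFun p k u ξ₀ R δ ξ ≤ max (k - u ξ) 0 := by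
  have h1 : cutoff ξ₀ R δ ξ ^ p ≤ 1 := Real.rpow_le_one cutoff_nonneg cutoff_le_one (by linarith)
  have h2 : 0 ≤ max (k - u ξ) 0 := le_max_right _ _
  unfold testFun
  nlinarith

theorem measurable_testFun (hu : Measurable u) : Measurable (testFun p k u ξ₀ R δ) := by
  have := measurable_cutoff (ξ₀ := ξ₀) (R := R) (δ := δ)
  unfold testFun
  fun_prop

/-- The truncation `(k - u)_+` is in `L^p` where `u` is. -/
theorem lintegral_trunc_lt_top (hp : 1 < p) {U : Set (Heis n)} (hU : IsCompact (closure U))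
    (hu : MemLp u (ENNReal.ofReal p) (volume.restrict U)) (k : ℝ) :
    ∫⁻ ξ in U, ENNReal.ofReal (max (k - u ξ) 0 ^ p) < ⊤ := by
  have hfin : IsFiniteMeasure (volume.restrict U) :=
    ⟨by simpa using (measure_mono subset_closure).trans_lt hU.measure_lt_top⟩
  have h1 : MemLp (fun ξ => k - u ξ) (ENNReal.ofReal p) (volume.restrict U) :=
    (memLp_const k).sub hu
  refine lt_of_le_of_lt ?_ (ENNReal.rpow_lt_top_of_nonneg (by linarith : 0 ≤ p) h1.2.ne)
  rw [← lintegral_ofReal_rpow_eq_eLpNorm (by linarith)]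
  refine lintegral_mono fun ξ => ENNReal.ofReal_le_ofReal ?_
  exact Real.rpow_le_rpow (le_max_right _ _) (max_le (le_abs_self _) (abs_nonneg _)) (by linarith)

theorem memLp_testFun (hp : 1 < p) (hδ : 0 < δ) (hum : Measurable u)
    (hu : MemLp u (ENNReal.ofReal p) (volume.restrict (hball ξ₀ (R + δ)))) :
    MemLp (testFun p k u ξ₀ R δ) (ENNReal.ofReal p) := by
  have hp0 : 0 < p := by linarith
  refine ⟨(measurable_testFun hum).aestronglyMeasurable, ?_⟩
  rw [eLpNorm_lt_top_iff_lintegral_rpow_enorm_lt_top (by simpa using hp0) ENNReal.ofReal_ne_top,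
    ENNReal.toReal_ofReal hp0.le]
  refine lt_of_le_of_lt ?_ (lintegral_trunc_lt_top hp (isCompact_closure_hball ξ₀ (R + δ)) hu k)
  rw [← lintegral_indicator (measurableSet_hball _ _)]
  refine lintegral_mono fun ξ => ?_
  by_cases h : ξ ∈ hball ξ₀ (R + δ)
  · rw [indicator_of_mem h, ← ofReal_norm, ENNReal.ofReal_rpow_of_nonneg (norm_nonneg _) hp0.le,
      Real.norm_eq_abs, abs_of_nonneg testFun_nonneg]
    exact ENNReal.ofReal_le_ofReal (Real.rpow_le_rpow testFun_nonneg (testFun_le hp) hp0.le)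
  · rw [testFun_eq_zero hp hδ h]
    simp [hp0]

theorem abs_diffQuot_rpow (hp : 1 < p) (ψ : Heis n → ℝ) (z : Heis n × Heis n) :
    |diffQuot (homDim n / p + s) ψ z| ^ p
      = |ψ z.1 - ψ z.2| ^ p * hnorm (op (inverse z.2) z.1) ^ (-(homDim n + s * p)) := by
  have h0 := hnorm_nonneg (op (inverse z.2) z.1)
  rw [diffQuot, abs_mul, abs_of_nonneg (Real.rpow_nonneg h0 _),
    Real.mul_rpow (abs_nonneg _) (Real.rpow_nonneg h0 _), ← Real.rpow_mul h0]
  congr 2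
  field_simp

/-- With both points in the ball, the product rule bounds the jump of the test function by the jump
of u plus a truncation times the jump of the cutoff. With one point outside, the cutoff vanishes
there and the whole value is governed by the jump of the cutoff. Cutoff jumps are integrated by
means of `cutKernel`. -/
theorem memLp_diffQuot_testFun (hs : 0 < s) (hs1 : s < 1) (hp : 1 < p) (hδ : 0 < δ)
    (hum : Measurable u) (hu : MemFracSobolev s p (hball ξ₀ (R + δ)) u) :
    MemLp (diffQuot (homDim n / p + s) (testFun p k u ξ₀ R δ)) (ENNReal.ofReal p)
      (volume.prod volume) := by
  have hp0 : 0 < p := by linarith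
  set B := hball ξ₀ (R + δ) with hB
  have hBm : MeasurableSet B := measurableSet_hball _ _
  set q := homDim n + s * p with hq
  set g : Heis n → ℝ≥0∞ := B.indicator fun ξ => ENNReal.ofReal (max (k - u ξ) 0 ^ p) with hg
  have hgm : Measurable g := Measurable.indicator (by fun_prop) hBm
  have hgfin : ∫⁻ ξ, g ξ < ⊤ := by
    rw [lintegral_indicator hBm]
    exact lintegral_trunc_lt_top hp (isCompact_closure_hball ξ₀ (R + δ)) hu.1 k
  refine ⟨(measurable_diffQuot _ (measurable_testFun hum)).aestronglyMeasurable, ?_⟩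
  have hfin : ∫⁻ z, ENNReal.ofReal (|diffQuot (homDim n / p + s) (testFun p k u ξ₀ R δ) z| ^ p)
      ∂((volume : Measure (Heis n)).prod volume) < ⊤ := by
    have hpt : ∀ z : Heis n × Heis n,
        ENNReal.ofReal (|diffQuot (homDim n / p + s) (testFun p k u ξ₀ R δ) z| ^ p) ≤
        ENNReal.ofReal (2 ^ p) * ((B ×ˢ B).indicator (fun z => ENNReal.ofReal
            (|diffQuot (homDim n / p + s) u z| ^ p)) z
          + ENNReal.ofReal (p ^ p) * (g z.1 * cutKernel s p δ⁻¹ (op (inverse z.2) z.1)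
            + g z.2 * cutKernel s p δ⁻¹ (op (inverse z.2) z.1))) := by
      rintro ⟨ξ, η⟩
      rw [abs_diffQuot_rpow hp]
      simp only
      have hk0 : 0 ≤ hnorm (op (inverse η) ξ) ^ (-q) := Real.rpow_nonneg (hnorm_nonneg _) _
      have h2p : (1 : ℝ) ≤ 2 ^ p := Real.one_le_rpow (by norm_num) hp0.le
      have hpp : (1 : ℝ) ≤ p ^ p := Real.one_le_rpow hp.le hp0.le
      have hcut := abs_cutoff_sub_le (ξ₀ := ξ₀) (R := R) (ξ := ξ) (η := η) hδ
      have hbase := rpow_mul_le_cutKernel (s := s) hp0.le (zero_le_one' ℝ) (abs_nonneg _) hcut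
      rw [one_mul, ENNReal.ofReal_one, one_mul] at hbase
      -- one point inside, the other one outside
      have mixed : ∀ w c : ℝ, 0 ≤ w → 0 ≤ c → c ≤ 1 →
          c = |cutoff ξ₀ R δ ξ - cutoff ξ₀ R δ η| →
          ENNReal.ofReal (|w * c ^ p| ^ p * hnorm (op (inverse η) ξ) ^ (-q)) ≤
          ENNReal.ofReal (w ^ p) * cutKernel s p δ⁻¹ (op (inverse η) ξ) := by
        intro w c hw hc hc1 hcc
        refine le_trans ?_ (mul_le_mul_right hbase _)
        rw [← ENNReal.ofReal_mul (by positivity), ← hcc, abs_of_nonneg (by positivity),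
          Real.mul_rpow hw (by positivity), mul_assoc]
        refine ENNReal.ofReal_le_ofReal ?_
        have : c ^ p ≤ c := by
          simpa using Real.rpow_le_rpow_of_exponent_ge' hc hc1 zero_le_one hp.le
        gcongr
      have hmul : ∀ x : ℝ≥0∞, x ≤ ENNReal.ofReal (2 ^ p) * x := fun x =>
        le_mul_of_one_le_left zero_le (by rw [← ENNReal.ofReal_one]; exact ENNReal.ofReal_le_ofReal h2p)
      have hmul' : ∀ x : ℝ≥0∞, x ≤ ENNReal.ofReal (p ^ p) * x := fun x =>
        le_mul_of_one_le_left zero_le (by rw [← ENNReal.ofReal_one]; exact ENNReal.ofReal_le_ofReal hpp)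
      by_cases hξ : ξ ∈ B <;> by_cases hη : η ∈ B
      · rw [indicator_of_mem (by exact ⟨hξ, hη⟩), abs_diffQuot_rpow hp]
        simp only
        set w₁ := max (k - u ξ) 0 with hw₁
        set w₂ := max (k - u η) 0 with hw₂
        have hw₂0 : 0 ≤ w₂ := le_max_right _ _
        have h1 : |testFun p k u ξ₀ R δ ξ - testFun p k u ξ₀ R δ η| ≤
            |u ξ - u η| + w₂ * (p * |cutoff ξ₀ R δ ξ - cutoff ξ₀ R δ η|) :=
          (abs_mul_rpow_sub_le hp hw₂0 cutoff_nonneg cutoff_le_one cutoff_nonneg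
            cutoff_le_one).trans (add_le_add_left (abs_max_sub_max_le k _ _) _)
        set t := |cutoff ξ₀ R δ ξ - cutoff ξ₀ R δ η| with ht
        have ht0 : 0 ≤ t := abs_nonneg _
        have h2 : |testFun p k u ξ₀ R δ ξ - testFun p k u ξ₀ R δ η| ^ p ≤
            2 ^ p * (|u ξ - u η| ^ p + p ^ p * (w₂ ^ p * t ^ p)) := by
          refine (Real.rpow_le_rpow (abs_nonneg _) h1 hp0.le).trans
            ((Real.add_rpow_le_two_rpow (abs_nonneg _) (by positivity) hp0.le).trans (le_of_eq ?_))
          rw [Real.mul_rpow hw₂0 (by positivity), Real.mul_rpow hp0.le ht0]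
          ring
        have h3 : g η = ENNReal.ofReal (w₂ ^ p) := indicator_of_mem hη _
        calc _ ≤ ENNReal.ofReal (2 ^ p * (|u ξ - u η| ^ p * hnorm (op (inverse η) ξ) ^ (-q)
              + p ^ p * (w₂ ^ p * (t ^ p * hnorm (op (inverse η) ξ) ^ (-q))))) := by
              refine ENNReal.ofReal_le_ofReal ((mul_le_mul_of_nonneg_right h2 hk0).trans
                (le_of_eq (by ring)))
          _ = ENNReal.ofReal (2 ^ p) * (ENNReal.ofReal (|u ξ - u η| ^ p
                * hnorm (op (inverse η) ξ) ^ (-q))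
              + ENNReal.ofReal (p ^ p) * (ENNReal.ofReal (w₂ ^ p)
                * ENNReal.ofReal (t ^ p * hnorm (op (inverse η) ξ) ^ (-q)))) := by
              rw [ENNReal.ofReal_mul (by positivity), ENNReal.ofReal_add (by positivity)
                (by positivity), ENNReal.ofReal_mul (p := p ^ p) (by positivity),
                ENNReal.ofReal_mul (p := w₂ ^ p) (by positivity)]
          _ ≤ _ := by
              rw [h3]
              gcongr
              exact (mul_le_mul_right hbase _).trans le_add_self
      · rw [testFun_eq_zero hp hδ hη, sub_zero]
        have h3 : g ξ = ENNReal.ofReal (max (k - u ξ) 0 ^ p) := indicator_of_mem hξ _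
        refine (mixed (max (k - u ξ) 0) (cutoff ξ₀ R δ ξ) (le_max_right _ _) cutoff_nonneg
          cutoff_le_one ?_).trans ?_
        · rw [cutoff_eq_zero hδ hη, sub_zero, abs_of_nonneg cutoff_nonneg]
        · rw [← h3]
          exact (hmul' _).trans (le_trans (le_trans (mul_le_mul_right le_self_add _) le_add_self)
            (hmul _))
      · rw [testFun_eq_zero hp hδ hξ, zero_sub, abs_neg]
        have h3 : g η = ENNReal.ofReal (max (k - u η) 0 ^ p) := indicator_of_mem hη _
        refine (mixed (max (k - u η) 0) (cutoff ξ₀ R δ η) (le_max_right _ _) cutoff_nonneg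
          cutoff_le_one ?_).trans ?_
        · rw [cutoff_eq_zero hδ hξ, zero_sub, abs_neg, abs_of_nonneg cutoff_nonneg]
        · rw [← h3]
          exact (hmul' _).trans (le_trans (le_trans (mul_le_mul_right le_add_self _) le_add_self)
            (hmul _))
      · rw [testFun_eq_zero hp hδ hξ, testFun_eq_zero hp hδ hη]
        simp [Real.zero_rpow hp0.ne']
    refine (lintegral_mono hpt).trans_lt ?_
    have hm0 := measurable_cutKernel_op (n := n) s p δ⁻¹
    have hm1 : Measurable fun z : Heis n × Heis n =>
        g z.1 * cutKernel s p δ⁻¹ (op (inverse z.2) z.1) := (hgm.comp measurable_fst).mul hm0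
    have hm2 : Measurable fun z : Heis n × Heis n =>
        g z.2 * cutKernel s p δ⁻¹ (op (inverse z.2) z.1) := (hgm.comp measurable_snd).mul hm0
    have hI := lintegral_cutKernel_one_lt_top (n := n) hs hs1 hp
    have hm3 : Measurable fun z : Heis n × Heis n => ENNReal.ofReal (p ^ p) *
        (g z.1 * cutKernel s p δ⁻¹ (op (inverse z.2) z.1)
          + g z.2 * cutKernel s p δ⁻¹ (op (inverse z.2) z.1)) := (hm1.add hm2).const_mul _
    rw [lintegral_const_mul' _ _ ENNReal.ofReal_ne_top,
      lintegral_add_right _ hm3, lintegral_const_mul' _ _ ENNReal.ofReal_ne_top,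
      lintegral_add_left hm1, lintegral_fst_mul_cutKernel s p (inv_pos.2 hδ) hgm,
      lintegral_snd_mul_cutKernel s p (inv_pos.2 hδ) hgm, lintegral_indicator (hBm.prod hBm)]
    have hI' := ENNReal.mul_lt_top hgfin (ENNReal.mul_lt_top
      (ENNReal.ofReal_lt_top (r := δ⁻¹ ^ (s * p))) hI)
    refine ENNReal.mul_lt_top ENNReal.ofReal_lt_top (ENNReal.add_lt_top.2 ⟨?_,
      ENNReal.mul_lt_top ENNReal.ofReal_lt_top (ENNReal.add_lt_top.2 ⟨hI', hI'⟩)⟩)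
    rw [← Measure.prod_restrict, lintegral_ofReal_rpow_eq_eLpNorm hp0]
    refine ENNReal.rpow_lt_top_of_nonneg hp0.le (ne_of_lt (lt_of_le_of_lt (le_of_eq ?_) hu.2.2))
    refine eLpNorm_congr_norm_ae (ae_of_all _ fun z => ?_)
    have h0 := hnorm_nonneg (op (inverse z.2) z.1)
    rw [diffQuot, norm_mul, norm_div, Real.norm_eq_abs, Real.norm_eq_abs, Real.norm_eq_abs,
      Real.norm_eq_abs, abs_abs, abs_of_nonneg (Real.rpow_nonneg h0 _),
      abs_of_nonneg (Real.rpow_nonneg h0 _), Real.rpow_neg h0]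
    exact (div_eq_mul_inv _ _).symm
  rw [lintegral_ofReal_rpow_eq_eLpNorm hp0] at hfin
  exact (ENNReal.rpow_lt_top_iff_of_pos hp0).1 hfin

end TestFun

end Heis
end

noncomputable section

namespace Heis

variable {n : ℕ}

/-! ### The Caccioppoli inequality -/

/-- If the larger of the two values is at least k, its truncation vanishes and the product is
nonpositive. Otherwise the jump of u equals the jump of (k - u)_+ and `Real.rpow_mul_sub_le`
applies. -/
theorem flux_mul_trunc_le {p k a b φ₁ φ₂ : ℝ} (hp : 1 < p) (h₁ : 0 ≤ φ₁) (h₂ : 0 ≤ φ₂) :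
    |a - b| ^ (p - 2) * (a - b) * (max (k - a) 0 * φ₁ ^ p - max (k - b) 0 * φ₂ ^ p) ≤
      p ^ p * ((max (k - a) 0 ^ p + max (k - b) 0 ^ p) * |φ₁ - φ₂| ^ p) := by
  have hp0 : 0 < p := by linarith
  have aux : ∀ a b φ₁ φ₂ : ℝ, 0 ≤ φ₁ → 0 ≤ φ₂ → a ≤ b →
      |a - b| ^ (p - 2) * (a - b) * (max (k - a) 0 * φ₁ ^ p - max (k - b) 0 * φ₂ ^ p) ≤
      p ^ p * (max (k - a) 0 ^ p * |φ₁ - φ₂| ^ p) := by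
    intro a b φ₁ φ₂ h₁ h₂ hab
    have hw : max (k - b) 0 ≤ max (k - a) 0 := max_le_max (by linarith) le_rfl
    have hw₂ : 0 ≤ max (k - b) 0 := le_max_right _ _
    have hw₁ : 0 ≤ max (k - a) 0 := le_max_right _ _
    have e : |a - b| ^ (p - 2) * (a - b) = -(b - a) ^ (p - 1) := by
      rw [← Real.rpow_sub_two_mul_self hp (by linarith : 0 ≤ b - a), abs_sub_comm]; ring
    rw [e]
    have hJ : 0 ≤ (b - a) ^ (p - 1) := Real.rpow_nonneg (by linarith) _
    rcases le_or_gt k b with hkb | hkb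
    · rw [max_eq_right (by linarith : k - b ≤ 0)]
      have h3 : 0 ≤ (b - a) ^ (p - 1) * (max (k - a) 0 * φ₁ ^ p) := by positivity
      have h4 : 0 ≤ p ^ p * (max (k - a) 0 ^ p * |φ₁ - φ₂| ^ p) := by positivity
      linarith
    · have h3 := Real.rpow_mul_sub_le hp hw₂ hw h₁ h₂
      have h4 : max (k - a) 0 - max (k - b) 0 = b - a := by
        rw [max_eq_left (by linarith), max_eq_left (by linarith)]; ring
      rw [h4, abs_sub_comm] at h3
      linarith
  have hw₁ : 0 ≤ max (k - a) 0 ^ p := Real.rpow_nonneg (le_max_right _ _) _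
  have hw₂ : 0 ≤ max (k - b) 0 ^ p := Real.rpow_nonneg (le_max_right _ _) _
  rcases le_total a b with h | h
  · refine (aux a b φ₁ φ₂ h₁ h₂ h).trans ?_
    gcongr
    linarith
  · have h3 := aux b a φ₂ φ₁ h₂ h₁ h
    have e : |a - b| ^ (p - 2) * (a - b) * (max (k - a) 0 * φ₁ ^ p - max (k - b) 0 * φ₂ ^ p)
        = |b - a| ^ (p - 2) * (b - a) * (max (k - b) 0 * φ₂ ^ p - max (k - a) 0 * φ₁ ^ p) := by
      rw [abs_sub_comm]; ring
    rw [e]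
    refine h3.trans ?_
    rw [abs_sub_comm]
    gcongr
    linarith

/-- The product is positive only for b < a < k, and then a - b ≤ (k - b)_+. -/
theorem flux_mul_trunc_le_tail {p k a b φ : ℝ} (hp : 1 < p) (h : 0 ≤ φ) (h' : φ ≤ 1) :
    |a - b| ^ (p - 2) * (a - b) * (max (k - a) 0 * φ ^ p) ≤
      max (k - a) 0 * max (k - b) 0 ^ (p - 1) := by
  have hw₁ : 0 ≤ max (k - a) 0 := le_max_right _ _
  have hw₂ : 0 ≤ max (k - b) 0 := le_max_right _ _
  have hφ : φ ^ p ≤ 1 := Real.rpow_le_one h h' (by linarith)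
  have hφ0 : 0 ≤ φ ^ p := Real.rpow_nonneg h _
  have hR : 0 ≤ max (k - a) 0 * max (k - b) 0 ^ (p - 1) := by positivity
  rcases le_or_gt k a with hka | hka
  · rw [max_eq_right (by linarith : k - a ≤ 0)]; simp
  rcases le_or_gt a b with hab | hab
  · refine le_trans (mul_nonpos_of_nonpos_of_nonneg (mul_nonpos_of_nonneg_of_nonpos ?_ ?_) ?_) hR
    · positivity
    · linarith
    · positivity
  · rw [Real.rpow_sub_two_mul_self hp (by linarith)]
    have h1 : a - b ≤ max (k - b) 0 := le_max_of_le_left (by linarith)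
    have h2 : (a - b) ^ (p - 1) ≤ max (k - b) 0 ^ (p - 1) :=
      Real.rpow_le_rpow (by linarith) h1 (by linarith)
    calc (a - b) ^ (p - 1) * (max (k - a) 0 * φ ^ p)
        ≤ max (k - b) 0 ^ (p - 1) * (max (k - a) 0 * 1) := by gcongr
      _ = _ := by ring

/-- The coercive half: between a value below k and a value b ≥ k, the jump b - a is at least k - a,
and the second truncation is 0, so its factor x is arbitrary. -/
theorem trunc_rpow_le_neg_flux {p k a b x : ℝ} (hp : 1 < p) (hb : k ≤ b) :
    max (k - a) 0 ^ p ≤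
      -(|a - b| ^ (p - 2) * (a - b) * (max (k - a) 0 * 1 ^ p - max (k - b) 0 * x)) := by
  rw [max_eq_right (by linarith : k - b ≤ 0), Real.one_rpow]
  rcases le_or_gt k a with hka | hka
  · rw [max_eq_right (by linarith : k - a ≤ 0), Real.zero_rpow (by linarith)]; simp
  · have hw : 0 < k - a := by linarith
    rw [max_eq_left hw.le]
    have e : |a - b| ^ (p - 2) * (a - b) = -(b - a) ^ (p - 1) := by
      rw [← Real.rpow_sub_two_mul_self hp (by linarith : 0 ≤ b - a), abs_sub_comm]; ring
    rw [e]
    have h1 : (k - a) ^ (p - 1) ≤ (b - a) ^ (p - 1) :=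
      Real.rpow_le_rpow hw.le (by linarith) (by linarith)
    have h2 : (k - a) ^ p = (k - a) ^ (p - 1) * (k - a) := by
      rw [← Real.rpow_add_one hw.ne']; congr 1; ring
    rw [h2]
    nlinarith

section Caccioppoli

variable {s p k r : ℝ} {u : Heis n → ℝ} {d : Heis n → ℝ} {ξ₀ : Heis n} {R δ : ℝ}

/-- The tail of `(k - u)_+` off the ball `B_ρ(ξ₀)`. -/
def tail (s p k : ℝ) (u : Heis n → ℝ) (ξ₀ : Heis n) (ρ : ℝ) : ℝ≥0∞ :=
  ∫⁻ η in (hball ξ₀ ρ)ᶜ,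
    ENNReal.ofReal (max (k - u η) 0 ^ (p - 1)) * kern (homDim n + s * p) η ξ₀

/-- For ξ in B_{R+δ} and η off B_{R+2δ}, the distances from η to ξ₀ and to ξ are comparable with
constant r/δ. The pole can therefore be moved to the centre and the tail taken there. -/
theorem lintegral_trunc_mul_kern_le (hp : 1 < p) (hs : 0 < s) (hR : 0 < R) (hδ : 0 < δ)
    (hr : R + 2 * δ ≤ r) {k₀ ρ : ℝ} (hk : k ≤ k₀) (hρ : ρ ≤ R + 2 * δ) {ξ : Heis n}
    (hξ : ξ ∈ hball ξ₀ (R + δ)) :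
    ∫⁻ η in (hball ξ₀ (R + 2 * δ))ᶜ,
      ENNReal.ofReal (max (k - u η) 0 ^ (p - 1)) * kern (homDim n + s * p) ξ η ≤
      ENNReal.ofReal ((r / δ) ^ (homDim n + s * p)) * tail s p k₀ u ξ₀ ρ := by
  have hQ := homDim_pos (n := n)
  have hsp : 0 < s * p := by nlinarith
  have hq : 0 < homDim n + s * p := by positivity
  have hr0 : 0 < r := by linarith
  calc _ ≤ ∫⁻ η in (hball ξ₀ (R + 2 * δ))ᶜ, ENNReal.ofReal ((r / δ) ^ (homDim n + s * p)) *
        (ENNReal.ofReal (max (k₀ - u η) 0 ^ (p - 1)) * kern (homDim n + s * p) η ξ₀) := by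
        refine setLIntegral_mono' (measurableSet_hball _ _).compl fun η hη => ?_
        have h1 : R + 2 * δ ≤ hnorm (op (inverse ξ₀) η) := not_lt.1 hη
        have h2 := mem_hball.1 hξ
        have h3 := hnorm_inverse_op_triangle ξ₀ ξ η
        rw [hnorm_inverse_op_comm ξ η] at h3
        have h4 : max (k - u η) 0 ^ (p - 1) ≤ max (k₀ - u η) 0 ^ (p - 1) :=
          Real.rpow_le_rpow (le_max_right _ _) (max_le_max (by linarith) le_rfl) (by linarith)
        have h5 : kern (homDim n + s * p) ξ η ≤
            ENNReal.ofReal ((r / δ) ^ (homDim n + s * p)) * kern (homDim n + s * p) η ξ₀ := by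
          unfold kern
          rw [← ENNReal.ofReal_mul (by positivity)]
          refine ENNReal.ofReal_le_ofReal ?_
          set x := hnorm (op (inverse ξ₀) η)
          set y := hnorm (op (inverse η) ξ)
          have hx : 0 < x := by linarith
          have hy : 0 < y := by linarith
          have hxy : x ≤ r / δ * y := by
            rw [div_mul_eq_mul_div, le_div_iff₀ hδ]
            -- The quotient x / (x - (R + δ)) decreases in x, so its worst value (R + 2δ)/δ is
            -- attained at x = R + 2δ.
            have h7 : x * δ ≤ (R + 2 * δ) * (x - (R + δ)) := by nlinarith
            have h6 : (R + 2 * δ) * (x - (R + δ)) ≤ r * y := by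
              apply mul_le_mul hr (by linarith) (by linarith) hr0.le
            linarith
          rw [Real.rpow_neg hy.le, Real.rpow_neg hx.le, ← div_eq_mul_inv,
            le_div_iff₀ (by positivity), inv_mul_le_iff₀ (by positivity),
            mul_comm (y ^ _), ← Real.mul_rpow (by positivity) hy.le]
          exact Real.rpow_le_rpow hx.le hxy hq.le
        calc _ ≤ ENNReal.ofReal (max (k₀ - u η) 0 ^ (p - 1)) *
              (ENNReal.ofReal ((r / δ) ^ (homDim n + s * p)) * kern (homDim n + s * p) η ξ₀) := by
              gcongr
          _ = _ := by ring
    _ = ENNReal.ofReal ((r / δ) ^ (homDim n + s * p)) * ∫⁻ η in (hball ξ₀ (R + 2 * δ))ᶜ,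
        (ENNReal.ofReal (max (k₀ - u η) 0 ^ (p - 1)) * kern (homDim n + s * p) η ξ₀) :=
        lintegral_const_mul' _ _ ENNReal.ofReal_ne_top
    _ ≤ _ := by
        unfold tail
        gcongr
        exact hball_mono hρ

/-- Pairs inside B_{R+2δ} give the local term, through the jumps of the cutoff. A pair with a point
outside contributes only if the other lies in B_{R+δ}; the gap δ between these balls keeps the
kernel away from its pole and yields the tail term. -/
theorem lintegral_energy_testFun_le (hp : 1 < p) (hs : 0 < s) (hum : Measurable u) (hR : 0 < R)
    (hδ : 0 < δ) (hr : R + 2 * δ ≤ r) {k₀ ρ : ℝ} (hk : k ≤ k₀) (hρ : ρ ≤ R + 2 * δ) {C : ℝ}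
    (hC : 0 ≤ C) (hd0 : ∀ h, 0 ≤ (d h ^ (homDim n + s * p))⁻¹)
    (hd : ∀ h, (d h ^ (homDim n + s * p))⁻¹ ≤ C * hnorm h ^ (-(homDim n + s * p))) :
    ∫⁻ z, ENNReal.ofReal (energyIntegrand s p d u (testFun p k u ξ₀ R δ) z)
        ∂(volume.prod volume) ≤
      ENNReal.ofReal C * (ENNReal.ofReal (p ^ p) * (2 *
        ((∫⁻ ξ in hball ξ₀ (R + 2 * δ), ENNReal.ofReal (max (k - u ξ) 0 ^ p)) *
          (ENNReal.ofReal (δ⁻¹ ^ (s * p)) * ∫⁻ h : Heis n, cutKernel s p 1 h)))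
      + 2 * ((∫⁻ ξ in hball ξ₀ (R + 2 * δ), ENNReal.ofReal (max (k - u ξ) 0)) *
        (ENNReal.ofReal ((r / δ) ^ (homDim n + s * p)) * tail s p k₀ u ξ₀ ρ))) := by
  have hp0 : 0 < p := by linarith
  set q := homDim n + s * p with hq
  set B₂ := hball ξ₀ (R + δ) with hB₂
  set B₃ := hball ξ₀ (R + 2 * δ) with hB₃
  have hB₂m : MeasurableSet B₂ := measurableSet_hball _ _
  have hB₃m : MeasurableSet B₃ := measurableSet_hball _ _
  have hB₂₃ : B₂ ⊆ B₃ := hball_mono (by linarith)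
  set g : Heis n → ℝ≥0∞ := B₃.indicator fun ξ => ENNReal.ofReal (max (k - u ξ) 0 ^ p) with hg
  have hgm : Measurable g := Measurable.indicator (by fun_prop) hB₃m
  set H : Heis n × Heis n → ℝ≥0∞ := (B₂ ×ˢ B₃ᶜ).indicator fun z =>
    ENNReal.ofReal (max (k - u z.1) 0) *
      (ENNReal.ofReal (max (k - u z.2) 0 ^ (p - 1)) * kern q z.1 z.2) with hH
  have hHm' : Measurable fun z : Heis n × Heis n => ENNReal.ofReal (max (k - u z.1) 0) *
      (ENNReal.ofReal (max (k - u z.2) 0 ^ (p - 1)) * kern q z.1 z.2) := by fun_prop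
  have hHm : Measurable H := hHm'.indicator (hB₂m.prod hB₃m.compl)
  have hpt : ∀ z : Heis n × Heis n,
      ENNReal.ofReal (energyIntegrand s p d u (testFun p k u ξ₀ R δ) z) ≤
      ENNReal.ofReal C * (ENNReal.ofReal (p ^ p) *
        (g z.1 * cutKernel s p δ⁻¹ (op (inverse z.2) z.1)
          + g z.2 * cutKernel s p δ⁻¹ (op (inverse z.2) z.1)) + (H z + H z.swap)) := by
    rintro ⟨ξ, η⟩
    simp only [energyIntegrand_eq, Prod.swap_prod_mk]
    have hk0 : 0 ≤ hnorm (op (inverse η) ξ) ^ (-q) := Real.rpow_nonneg (hnorm_nonneg _) _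
    have hdd := hd (op (inverse η) ξ)
    have hdd0 := hd0 (op (inverse η) ξ)
    -- from a pointwise bound of the flux to one of the energy
    have conv : ∀ x y : ℝ, 0 ≤ y → x ≤ y →
        ENNReal.ofReal (x * (d (op (inverse η) ξ) ^ q)⁻¹) ≤
          ENNReal.ofReal C * ENNReal.ofReal (y * hnorm (op (inverse η) ξ) ^ (-q)) := by
      intro x y hy hxy
      rw [← ENNReal.ofReal_mul hC]
      refine ENNReal.ofReal_le_ofReal ?_
      calc x * (d (op (inverse η) ξ) ^ q)⁻¹ ≤ y * (d (op (inverse η) ξ) ^ q)⁻¹ := by gcongr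
        _ ≤ y * (C * hnorm (op (inverse η) ξ) ^ (-q)) := by gcongr
        _ = _ := by ring
    have mixed : ∀ x a b : ℝ, x ≤ max (k - a) 0 * max (k - b) 0 ^ (p - 1) →
        ENNReal.ofReal (x * (d (op (inverse η) ξ) ^ q)⁻¹) ≤
          ENNReal.ofReal C * (ENNReal.ofReal (max (k - a) 0) *
            (ENNReal.ofReal (max (k - b) 0 ^ (p - 1)) * kern q ξ η)) := by
      intro x a b hx
      have h1 : 0 ≤ max (k - a) 0 := le_max_right _ _
      have h2 : 0 ≤ max (k - b) 0 := le_max_right _ _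
      refine (conv x _ (by positivity) hx).trans (le_of_eq ?_)
      rw [ENNReal.ofReal_mul (by positivity), ENNReal.ofReal_mul h1, mul_assoc]
      rfl
    by_cases hξ : ξ ∈ B₃ <;> by_cases hη : η ∈ B₃
    · have e1 : g ξ = ENNReal.ofReal (max (k - u ξ) 0 ^ p) := indicator_of_mem hξ _
      have e2 : g η = ENNReal.ofReal (max (k - u η) 0 ^ p) := indicator_of_mem hη _
      have hw₁ : 0 ≤ max (k - u ξ) 0 ^ p := Real.rpow_nonneg (le_max_right _ _) _
      have hw₂ : 0 ≤ max (k - u η) 0 ^ p := Real.rpow_nonneg (le_max_right _ _) _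
      have h1 := flux_mul_trunc_le (k := k) (a := u ξ) (b := u η) hp
        (cutoff_nonneg (ξ₀ := ξ₀) (R := R) (δ := δ) (ξ := ξ))
        (cutoff_nonneg (ξ₀ := ξ₀) (R := R) (δ := δ) (ξ := η))
      refine (conv _ _ (by positivity) h1).trans (mul_le_mul_right (le_trans ?_ le_self_add) _)
      rw [mul_assoc, ENNReal.ofReal_mul (by positivity), ← add_mul, e1, e2,
        ← ENNReal.ofReal_add hw₁ hw₂]
      refine mul_le_mul_right ?_ _
      exact rpow_mul_le_cutKernel hp0.le (by positivity) (abs_nonneg _) (abs_cutoff_sub_le hδ)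
    · rw [testFun_eq_zero hp hδ fun h => hη (hB₂₃ h), sub_zero]
      by_cases hξ₂ : ξ ∈ B₂
      · have e : H (ξ, η) = ENNReal.ofReal (max (k - u ξ) 0) *
          (ENNReal.ofReal (max (k - u η) 0 ^ (p - 1)) * kern q ξ η) :=
          indicator_of_mem (s := B₂ ×ˢ B₃ᶜ) (a := (ξ, η)) (by exact ⟨hξ₂, hη⟩) _
        refine (mixed _ _ _ (flux_mul_trunc_le_tail hp cutoff_nonneg cutoff_le_one)).trans ?_
        rw [← e]
        exact mul_le_mul_right (le_trans le_self_add le_add_self) _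
      · rw [testFun_eq_zero hp hδ hξ₂]; simp
    · rw [testFun_eq_zero hp hδ fun h => hξ (hB₂₃ h), zero_sub]
      by_cases hη₂ : η ∈ B₂
      · have e : H (η, ξ) = ENNReal.ofReal (max (k - u η) 0) *
          (ENNReal.ofReal (max (k - u ξ) 0 ^ (p - 1)) * kern q ξ η) := by
          rw [kern_comm]
          exact indicator_of_mem (s := B₂ ×ˢ B₃ᶜ) (a := (η, ξ)) (by exact ⟨hη₂, hξ⟩) _
        have e' : |u ξ - u η| ^ (p - 2) * (u ξ - u η) * -testFun p k u ξ₀ R δ η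
            = |u η - u ξ| ^ (p - 2) * (u η - u ξ) * testFun p k u ξ₀ R δ η := by
          rw [abs_sub_comm]; ring
        rw [e']
        refine (mixed _ _ _ (flux_mul_trunc_le_tail hp cutoff_nonneg cutoff_le_one)).trans ?_
        rw [← e]
        exact mul_le_mul_right (le_trans le_add_self le_add_self) _
      · rw [testFun_eq_zero hp hδ hη₂]; simp
    · rw [testFun_eq_zero hp hδ fun h => hη (hB₂₃ h), testFun_eq_zero hp hδ fun h => hξ (hB₂₃ h)]
      simp
  refine (lintegral_mono hpt).trans ?_
  have hm0 := measurable_cutKernel_op (n := n) s p δ⁻¹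
  have hm1 : Measurable fun z : Heis n × Heis n =>
      g z.1 * cutKernel s p δ⁻¹ (op (inverse z.2) z.1) := (hgm.comp measurable_fst).mul hm0
  have hm2 : Measurable fun z : Heis n × Heis n =>
      g z.2 * cutKernel s p δ⁻¹ (op (inverse z.2) z.1) := (hgm.comp measurable_snd).mul hm0
  have hm3 : Measurable fun z : Heis n × Heis n => H z + H z.swap :=
    hHm.add (hHm.comp measurable_swap)
  rw [lintegral_const_mul' _ _ ENNReal.ofReal_ne_top, lintegral_add_right _ hm3,
    lintegral_const_mul' _ _ ENNReal.ofReal_ne_top, lintegral_add_left hm1, lintegral_add_left hHm,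
    lintegral_fst_mul_cutKernel s p (inv_pos.2 hδ) hgm,
    lintegral_snd_mul_cutKernel s p (inv_pos.2 hδ) hgm, lintegral_prod_swap,
    lintegral_indicator hB₃m, ← two_mul, ← two_mul]
  refine mul_le_mul_right (add_le_add_right (mul_le_mul_right ?_ _) _) _
  rw [lintegral_indicator (hB₂m.prod hB₃m.compl), ← Measure.prod_restrict,
    lintegral_prod _ hHm'.aemeasurable]
  calc ∫⁻ ξ in B₂, ∫⁻ η in B₃ᶜ, ENNReal.ofReal (max (k - u ξ) 0) *
        (ENNReal.ofReal (max (k - u η) 0 ^ (p - 1)) * kern q ξ η)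
      ≤ ∫⁻ ξ in B₂, ENNReal.ofReal (max (k - u ξ) 0) *
        (ENNReal.ofReal ((r / δ) ^ q) * tail s p k₀ u ξ₀ ρ) := by
        refine setLIntegral_mono' hB₂m fun ξ hξ => ?_
        rw [lintegral_const_mul' _ _ ENNReal.ofReal_ne_top]
        exact mul_le_mul_right (lintegral_trunc_mul_kern_le hp hs hR hδ hr hk hρ hξ) _
    _ = (∫⁻ ξ in B₂, ENNReal.ofReal (max (k - u ξ) 0)) *
        (ENNReal.ofReal ((r / δ) ^ q) * tail s p k₀ u ξ₀ ρ) :=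
        lintegral_mul_const _ (by fun_prop)
    _ ≤ _ := by gcongr

/-- The energy of the test function controls `(k - u)_+` as if by a Sobolev inequality. -/
theorem lintegral_neg_energy_testFun_ge (hp : 1 < p) (hs : 0 < s) (hum : Measurable u)
    (hdm : Measurable d) (hδ : 0 < δ) {c ρ : ℝ} (hρ : ρ ≤ 2 * δ) (hρ0 : 0 < ρ)
    (hc : 0 ≤ c) (hd : ∀ h, c * hnorm h ^ (-(homDim n + s * p)) ≤ (d h ^ (homDim n + s * p))⁻¹) :
    ENNReal.ofReal (c * ρ ^ (-(homDim n + s * p))) *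
      (volume (hball (0 : Heis n) ρ) - volume ({ξ | u ξ < k} ∩ hball ξ₀ (R + 2 * δ))) *
      ∫⁻ ξ in hball ξ₀ R, ENNReal.ofReal (max (k - u ξ) 0 ^ p) ≤
    ∫⁻ z, ENNReal.ofReal (-energyIntegrand s p d u (testFun p k u ξ₀ R δ) z)
        ∂(volume.prod volume) := by
  have hQ := homDim_pos (n := n)
  have hsp : 0 < s * p := by nlinarith
  have hq : 0 < homDim n + s * p := by positivity
  set q := homDim n + s * p with hqdef
  have hm := measurable_energyIntegrand (s := s) (p := p) hdm hum
    (measurable_testFun (p := p) (k := k) (ξ₀ := ξ₀) (R := R) (δ := δ) hum)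
  have hAm : MeasurableSet {ξ | u ξ < k} := measurableSet_lt hum measurable_const
  have hm' : Measurable fun z : Heis n × Heis n => ENNReal.ofReal
      (-energyIntegrand s p d u (testFun p k u ξ₀ R δ) z) := hm.neg.ennreal_ofReal
  rw [lintegral_prod _ hm'.aemeasurable,
    ← lintegral_const_mul _ (by fun_prop)]
  refine le_trans ?_ (setLIntegral_le_lintegral (hball ξ₀ R) _)
  refine setLIntegral_mono' (measurableSet_hball _ _) fun ξ hξ => ?_
  -- Each ξ in B_R is paired with the points of B_ρ(ξ) where u ≥ k. Since ρ ≤ 2δ, this ball stays in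
  -- B_{R+2δ}, so at most |{u < k} ∩ B_{R+2δ}| of it is lost.
  set S := hball ξ ρ \ {η | u η < k} with hS
  have hSm : MeasurableSet S := (measurableSet_hball _ _).diff hAm
  have hvol : volume (hball (0 : Heis n) ρ) - volume ({ξ | u ξ < k} ∩ hball ξ₀ (R + 2 * δ))
      ≤ volume S := by
    rw [tsub_le_iff_right, ← volume_hball_eq_zero_center ξ]
    refine (measure_mono ?_).trans (measure_union_le _ _)
    intro η hη
    by_cases h : u η < k
    · refine Or.inr ⟨h, hball_subset_hball ?_ hη⟩
      linarith [mem_hball.1 hξ]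
    · exact Or.inl ⟨hη, h⟩
  calc _ ≤ ENNReal.ofReal (c * ρ ^ (-q)) * volume S * ENNReal.ofReal (max (k - u ξ) 0 ^ p) := by
        gcongr
    _ = ∫⁻ η in S, ENNReal.ofReal (c * ρ ^ (-q) * max (k - u ξ) 0 ^ p) := by
        rw [setLIntegral_const, ENNReal.ofReal_mul (p := c * ρ ^ (-q)) (by positivity)]; ring
    _ ≤ ∫⁻ η in S, ENNReal.ofReal (-energyIntegrand s p d u (testFun p k u ξ₀ R δ) (ξ, η)) := by
        refine setLIntegral_mono' hSm fun η hη => ENNReal.ofReal_le_ofReal ?_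
        have hηk : k ≤ u η := not_lt.1 hη.2
        have h1 := trunc_rpow_le_neg_flux (a := u ξ) (x := cutoff ξ₀ R δ η ^ p) hp hηk
        rw [energyIntegrand_eq, ← neg_mul]
        simp only [testFun, cutoff_eq_one hδ hξ]
        have hw0 : 0 ≤ max (k - u ξ) 0 ^ p := Real.rpow_nonneg (le_max_right _ _) _
        have hd' := hd (op (inverse η) ξ)
        have hk0 : 0 ≤ hnorm (op (inverse η) ξ) ^ (-q) := Real.rpow_nonneg (hnorm_nonneg _) _
        -- If u(ξ) ≥ k the truncation is 0. Otherwise η ≠ ξ, which excludes the default value of the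
        -- kernel on the diagonal, where its lower bound would fail.
        rcases le_or_gt k (u ξ) with hk | hk
        · have e : max (k - u ξ) 0 ^ p = 0 := by
            rw [max_eq_right (by linarith), Real.zero_rpow (by linarith)]
          rw [e, mul_zero]
          exact mul_nonneg (hw0.trans h1) ((by positivity : (0 : ℝ) ≤ _).trans hd')
        · have hne : η ≠ ξ := by
            rintro rfl; exact absurd hk (not_lt.2 hηk)
          have h2 : ρ ^ (-q) ≤ hnorm (op (inverse η) ξ) ^ (-q) := by
            refine Real.rpow_le_rpow_of_nonpos (hnorm_inverse_op_pos hne) ?_ (by linarith)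
            rw [hnorm_inverse_op_comm]
            exact (mem_hball.1 hη.1).le
          calc c * ρ ^ (-q) * max (k - u ξ) 0 ^ p
              ≤ c * hnorm (op (inverse η) ξ) ^ (-q) * max (k - u ξ) 0 ^ p := by gcongr
            _ = max (k - u ξ) 0 ^ p * (c * hnorm (op (inverse η) ξ) ^ (-q)) := by ring
            _ ≤ _ := mul_le_mul h1 hd' (by positivity) (hw0.trans h1)
    _ ≤ _ := setLIntegral_le_lintegral _ _

end Caccioppoli

end Heis
end

/-! ### The numerical part of the De Giorgi iteration -/

noncomputable section

/-- Fast geometric convergence. -/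
theorem exists_tendsto_zero_of_superlinear {N B σ : ℝ} (hN : 0 < N) (hB : 1 < B) (hσ : 0 < σ) :
    ∃ ν : ℝ, 0 < ν ∧ ∀ y : ℕ → ℝ, (∀ j, 0 ≤ y j) → (∀ j, y (j + 1) ≤ N * B ^ j * (y j ^ σ * y j)) →
      y 0 ≤ ν → Tendsto y atTop (𝓝 0) := by
  have hB0 : 0 < B := by linarith
  -- With B θ^σ = 1 and N ν^σ = θ, the bound y_j ≤ ν θ^j reproduces itself: N B^j (ν θ^j)^σ = θ.
  set θ := B ^ (-(1 / σ)) with hθ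
  have hθ0 : 0 < θ := by positivity
  have hθ1 : θ < 1 := Real.rpow_lt_one_of_one_lt_of_neg hB (by simpa using hσ)
  have hθσ : θ ^ σ = B⁻¹ := by
    rw [hθ, ← Real.rpow_mul hB0.le, neg_mul, one_div, inv_mul_cancel₀ hσ.ne', Real.rpow_neg_one]
  set ν := (θ / N) ^ (1 / σ) with hν
  have hν0 : 0 < ν := by positivity
  have hνσ : ν ^ σ = θ / N := by
    rw [hν, ← Real.rpow_mul (by positivity), one_div, inv_mul_cancel₀ hσ.ne', Real.rpow_one]
  refine ⟨ν, hν0, fun y hy hrec h0 => ?_⟩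
  have key : ∀ j, y j ≤ ν * θ ^ j := by
    intro j
    induction j with
    | zero => simpa using h0
    | succ j ih =>
      have h1 : y j ^ σ ≤ (ν * θ ^ j) ^ σ := Real.rpow_le_rpow (hy j) ih hσ.le
      have h2 : (ν * θ ^ j) ^ σ = θ / N * (B⁻¹) ^ j := by
        rw [Real.mul_rpow hν0.le (by positivity), hνσ, ← Real.rpow_natCast, ← Real.rpow_mul hθ0.le,
          mul_comm (j : ℝ), Real.rpow_mul hθ0.le, hθσ, Real.rpow_natCast]
      have h3 := hy j
      calc y (j + 1) ≤ N * B ^ j * (y j ^ σ * y j) := hrec j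
        _ ≤ N * B ^ j * ((θ / N * (B⁻¹) ^ j) * (ν * θ ^ j)) := by
            rw [h2] at h1
            gcongr
        _ = (B * B⁻¹) ^ j * (ν * (θ ^ j * θ)) * (N / N) := by rw [mul_pow]; ring
        _ = ν * θ ^ (j + 1) := by
            rw [mul_inv_cancel₀ hB0.ne', div_self hN.ne', one_pow, pow_succ]; ring
  refine squeeze_zero hy key ?_
  have := (tendsto_pow_atTop_nhds_zero_of_lt_one hθ0.le hθ1).const_mul ν
  simpa using this

/-- The arithmetic of one step of the De Giorgi iteration. -/
theorem deGiorgi_step_real {Q s p c C m I Λ ε r b y₁ y₃ : ℝ} (hQ : 0 < Q) (hs : 0 < s) (hp : 1 < p)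
    (hc : 0 < c) (hC : 0 < C) (hm : 0 < m) (hI : 0 ≤ I) (hΛ : 0 ≤ Λ) (hε : 0 < ε) (hr : 0 < r)
    (hb : 1 ≤ b) (hy₁ : 0 ≤ y₁) (hy : y₁ ≤ y₃)
    (h : ∀ ρ, 0 < ρ → ρ ≤ r / (4 * b) →
      c * ρ ^ (-(Q + s * p)) * (ρ ^ Q * m - (ε / (2 * b)) ^ (-p) * y₃) * y₁ ≤
        C * (p ^ p * (2 * (y₃ * ((r / (8 * b))⁻¹ ^ (s * p) * I)))
          + 2 * (((ε / (2 * b)) ^ (-(p - 1)) * y₃) *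
            ((r / (r / (8 * b))) ^ (Q + s * p) * (Λ * ε ^ (p - 1) * r ^ (-(s * p))))))
          + Λ * ε ^ (p - 1) * r ^ (-(s * p)) * ((ε / (2 * b)) ^ (-(p - 1)) * y₃)) :
    y₁ ≤ max 1 (2 * (2 * C * p ^ p * I + (2 * C + 1) * Λ) / (c * m)) * (2 / m) ^ (s * p / Q)
      * (8 * b) ^ (Q + s * p + p + p * (s * p / Q))
      * ((y₃ / (ε ^ p * r ^ Q)) ^ (s * p / Q) * y₃) := by
  have hp0 : 0 < p := by linarith
  have hsp : 0 < s * p := by positivity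
  -- One base X ≥ 1 absorbs 2b, 4b and 8b, so that all powers of b can be merged into a single
  -- exponent.
  set X := 8 * b with hX
  have hX1 : 1 ≤ X := by linarith
  have hX0 : 0 < X := by linarith
  have hy₃ : 0 ≤ y₃ := hy₁.trans hy
  rcases hy₃.eq_or_lt with h0 | hy₃p
  · rw [← h0] at hy ⊢
    simpa using hy
  set σ := s * p / Q with hσ
  have hσ0 : 0 < σ := by positivity
  set M := 2 * C * p ^ p * I + (2 * C + 1) * Λ with hM
  have hM0 : 0 ≤ M := by positivity
  -- the powers of `b`
  have hτ1 : (ε / (2 * b)) ^ (-(p - 1)) * ε ^ (p - 1) ≤ X ^ p := by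
    rw [Real.rpow_neg (by positivity), ← Real.inv_rpow (by positivity),
      ← Real.mul_rpow (by positivity) hε.le]
    have e : (ε / (2 * b))⁻¹ * ε = 2 * b := by field_simp
    rw [e]
    calc (2 * b) ^ (p - 1) ≤ X ^ (p - 1) :=
          Real.rpow_le_rpow (by positivity) (by linarith) (by linarith)
      _ ≤ X ^ p := Real.rpow_le_rpow_of_exponent_le hX1 (by linarith)
  have hτ2 : (ε / (2 * b)) ^ (-p) ≤ X ^ p / ε ^ p := by
    rw [Real.rpow_neg (by positivity), ← Real.inv_rpow (by positivity),
      ← Real.div_rpow hX0.le hε.le]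
    refine Real.rpow_le_rpow (by positivity) ?_ hp0.le
    rw [inv_div]; gcongr; linarith
  have hδ : (r / X)⁻¹ ^ (s * p) = X ^ (s * p) * r ^ (-(s * p)) := by
    rw [inv_div, Real.div_rpow hX0.le hr.le, Real.rpow_neg hr.le, div_eq_mul_inv]
  have hrδ : r / (r / X) = X := by field_simp
  have hXsp : X ^ (s * p) ≤ X ^ (Q + s * p + p) :=
    Real.rpow_le_rpow_of_exponent_le hX1 (by linarith)
  have hXp : X ^ p ≤ X ^ (Q + s * p + p) :=
    Real.rpow_le_rpow_of_exponent_le hX1 (by linarith)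
  have hXq : X ^ p * X ^ (Q + s * p) = X ^ (Q + s * p + p) := by
    rw [← Real.rpow_add hX0]; congr 1; ring
  have hrhs : ∀ ρ, 0 < ρ → ρ ≤ r / (4 * b) →
      c * ρ ^ (-(Q + s * p)) * (ρ ^ Q * m - X ^ p / ε ^ p * y₃) * y₁ ≤
        M * r ^ (-(s * p)) * X ^ (Q + s * p + p) * y₃ := by
    intro ρ hρ hρ'
    have h1 := h ρ hρ hρ'
    rw [hδ, hrδ] at h1
    refine le_trans ?_ (h1.trans ?_)
    · gcongr
    · set a := (ε / (2 * b)) ^ (-(p - 1)) with ha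
      have ha0 : 0 ≤ a := by positivity
      calc _ = (2 * C * p ^ p * I * X ^ (s * p)
            + 2 * C * Λ * ((a * ε ^ (p - 1)) * X ^ (Q + s * p))
            + Λ * (a * ε ^ (p - 1))) * (r ^ (-(s * p)) * y₃) := by ring
        _ ≤ (2 * C * p ^ p * I * X ^ (Q + s * p + p)
            + 2 * C * Λ * (X ^ p * X ^ (Q + s * p))
            + Λ * X ^ (Q + s * p + p)) * (r ^ (-(s * p)) * y₃) := by
            gcongr
            exact hτ1.trans hXp
        _ = _ := by rw [hXq, hM]; ring
  -- the choice of the radius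
  set z := X ^ p * (y₃ / (ε ^ p * r ^ Q)) with hz
  have hz0 : 0 < z := by positivity
  -- For ρ = r t the volume m ρ^Q is exactly twice the Chebyshev bound r^Q z of the sublevel set, so
  -- half of the ball is left. Then ρ^(-sp) on the left side becomes the gain t^(sp), a multiple of
  -- (y₃ / (ε^p r^Q))^(sp/Q).
  set t := (2 / m * z) ^ (1 / Q) with ht
  have ht0 : 0 < t := by positivity
  have htQ : t ^ Q = 2 / m * z := by
    rw [ht, ← Real.rpow_mul (by positivity), one_div, inv_mul_cancel₀ hQ.ne', Real.rpow_one]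
  have htsp : t ^ (s * p) = (2 / m) ^ σ * X ^ (p * σ) * (y₃ / (ε ^ p * r ^ Q)) ^ σ := by
    rw [ht, ← Real.rpow_mul (by positivity)]
    have e : 1 / Q * (s * p) = σ := by rw [hσ]; ring
    rw [e, Real.mul_rpow (by positivity) (by positivity), hz,
      Real.mul_rpow (by positivity) (by positivity), ← Real.rpow_mul hX0.le]
    ring
  have hgoal : y₁ ≤ max 1 (2 * M / (c * m)) * (t ^ (s * p) * X ^ (Q + s * p + p) * y₃) := by
    rcases le_or_gt (r * t) (r / (4 * b)) with hcase | hcase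
    · have h1 := hrhs (r * t) (by positivity) hcase
      have e1 : (r * t) ^ Q * m - X ^ p / ε ^ p * y₃ = (r * t) ^ Q * m / 2 := by
        have : X ^ p / ε ^ p * y₃ = r ^ Q * z := by rw [hz]; field_simp
        rw [this, Real.mul_rpow hr.le ht0.le, htQ]; field_simp; ring
      have e2 : (r * t) ^ (-(Q + s * p)) * (r * t) ^ Q = r ^ (-(s * p)) * (t ^ (s * p))⁻¹ := by
        rw [← Real.rpow_add (by positivity), ← Real.rpow_neg ht0.le,
          ← Real.mul_rpow hr.le ht0.le]
        congr 1; ring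
      rw [e1] at h1
      have h2 : c * m / 2 * (t ^ (s * p))⁻¹ * y₁ ≤ M * X ^ (Q + s * p + p) * y₃ := by
        have hrp : 0 < r ^ (-(s * p)) := by positivity
        refine le_of_mul_le_mul_left ?_ hrp
        calc r ^ (-(s * p)) * (c * m / 2 * (t ^ (s * p))⁻¹ * y₁)
            = c * ((r * t) ^ (-(Q + s * p)) * (r * t) ^ Q) * m / 2 * y₁ := by rw [e2]; ring
          _ = c * (r * t) ^ (-(Q + s * p)) * ((r * t) ^ Q * m / 2) * y₁ := by ring
          _ ≤ _ := h1
          _ = _ := by ring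
      have h3 : y₁ ≤ 2 * M / (c * m) * (t ^ (s * p) * X ^ (Q + s * p + p) * y₃) := by
        have htp : 0 < t ^ (s * p) := by positivity
        have e3 : y₁ = (2 / (c * m) * t ^ (s * p)) * (c * m / 2 * (t ^ (s * p))⁻¹ * y₁) := by
          field_simp
        calc y₁ = (2 / (c * m) * t ^ (s * p)) * (c * m / 2 * (t ^ (s * p))⁻¹ * y₁) := e3
          _ ≤ (2 / (c * m) * t ^ (s * p)) * (M * X ^ (Q + s * p + p) * y₃) := by gcongr
          _ = _ := by ring
      refine h3.trans ?_
      gcongr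
      exact le_max_right _ _
    -- If this radius is not admissible, then t X ≥ 1: the claimed bound is weaker than y₁ ≤ y₃ and
    -- needs no energy estimate.
    · have h1 : 1 ≤ t * X := by
        rw [div_lt_iff₀ (by positivity)] at hcase
        have : 1 < t * (4 * b) := by
          by_contra hcon
          nlinarith
        nlinarith
      have h2 : (1 : ℝ) ≤ t ^ (s * p) * X ^ (Q + s * p + p) := by
        calc (1 : ℝ) ≤ (t * X) ^ (s * p) := Real.one_le_rpow h1 hsp.le
          _ = t ^ (s * p) * X ^ (s * p) := Real.mul_rpow ht0.le hX0.le
          _ ≤ _ := by gcongr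
      calc y₁ ≤ y₃ := hy
        _ ≤ t ^ (s * p) * X ^ (Q + s * p + p) * y₃ := le_mul_of_one_le_left hy₃ h2
        _ ≤ _ := le_mul_of_one_le_left (by positivity) (le_max_left _ _)
  refine hgoal.trans (le_of_eq ?_)
  rw [htsp, Real.rpow_add hX0 (Q + s * p + p)]
  ring

end

noncomputable section

namespace Heis

variable {n : ℕ}

/-! ### The De Giorgi iteration -/

section DeGiorgi

variable {s p : ℝ} {u : Heis n → ℝ} {d : Heis n → ℝ} {ξ₀ : Heis n}

theorem trunc_le_trunc_rpow {t k k' a q : ℝ} (ht : 0 < t) (hk : k' = k - t) (hq : 0 ≤ q)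
    (h : a < k') : 1 ≤ t ^ (-q) * max (k - a) 0 ^ q := by
  have h1 : t ≤ max (k - a) 0 := le_max_of_le_left (by linarith)
  rw [Real.rpow_neg ht.le, ← div_eq_inv_mul, le_div_iff₀ (by positivity), one_mul]
  exact Real.rpow_le_rpow ht.le h1 hq

/-- The Chebyshev inequality for the truncations. -/
theorem volume_lt_le_lintegral_trunc (hp : 0 ≤ p) (hum : Measurable u) {t k k' : ℝ} (ht : 0 < t)
    (hk : k' = k - t) {S : Set (Heis n)} :
    volume ({ξ | u ξ < k'} ∩ S) ≤
      ENNReal.ofReal (t ^ (-p)) * ∫⁻ ξ in S, ENNReal.ofReal (max (k - u ξ) 0 ^ p) := by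
  have hm : MeasurableSet {ξ | u ξ < k'} := measurableSet_lt hum measurable_const
  rw [← lintegral_const_mul' _ _ ENNReal.ofReal_ne_top, ← Measure.restrict_apply hm,
    ← lintegral_indicator_one hm]
  refine lintegral_mono fun ξ => ?_
  by_cases h : ξ ∈ {ξ | u ξ < k'}
  · rw [indicator_of_mem h, ← ENNReal.ofReal_mul (by positivity), Pi.one_apply, ← ENNReal.ofReal_one]
    exact ENNReal.ofReal_le_ofReal (trunc_le_trunc_rpow ht hk hp h)
  · rw [indicator_of_notMem h]; exact zero_le

theorem lintegral_trunc_le (hp : 1 ≤ p) {t k k' : ℝ} (ht : 0 < t) (hk : k' = k - t)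
    {S : Set (Heis n)} :
    ∫⁻ ξ in S, ENNReal.ofReal (max (k' - u ξ) 0) ≤
      ENNReal.ofReal (t ^ (-(p - 1))) * ∫⁻ ξ in S, ENNReal.ofReal (max (k - u ξ) 0 ^ p) := by
  rw [← lintegral_const_mul' _ _ ENNReal.ofReal_ne_top]
  refine lintegral_mono fun ξ => ?_
  rw [← ENNReal.ofReal_mul (by positivity)]
  refine ENNReal.ofReal_le_ofReal ?_
  rcases lt_or_ge (u ξ) k' with h | h
  · have h1 := trunc_le_trunc_rpow ht hk (q := p - 1) (by linarith) h
    have h2 : 0 < k - u ξ := by linarith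
    rw [max_eq_left h2.le] at h1 ⊢
    rw [max_eq_left (by linarith)]
    have e : (k - u ξ) ^ p = (k - u ξ) ^ (p - 1) * (k - u ξ) := by
      rw [← Real.rpow_add_one h2.ne']; congr 1; ring
    rw [e]
    nlinarith
  · rw [max_eq_right (by linarith)]
    have : 0 ≤ max (k - u ξ) 0 := le_max_right _ _
    positivity

/-- The number ν depends on n, s, p, d and Λ only; the tail, the datum and the smallness are
measured in scale invariant units. The radii decrease from r to r/2 and the levels from k to k - ε,
both geometrically. Each step compares the energy bounds of the test function between consecutive
levels, and the truncated integrals tend to 0. -/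
theorem exists_deGiorgi (hs : 0 < s) (hs1 : s < 1) (hp : 1 < p) (hd : IsHomogeneousNorm d) {Λ : ℝ}
    (hΛ : 0 ≤ Λ) :
    ∃ ν : ℝ, 0 < ν ∧ ∀ (Ω : Set (Heis n)) (f : Heis n → ℝ → ℝ) (u : Heis n → ℝ)
      (_ : IsWeakSupersolution s p d f Ω u) (_ : Measurable u) (ξ₀ : Heis n) (r k ε F : ℝ),
      0 < r → 0 < ε → closedHball ξ₀ r ⊆ Ω →
      (∀ᵐ ξ ∂(volume.restrict (hball ξ₀ r)), |f ξ (u ξ)| ≤ F) →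
      F ≤ Λ * ε ^ (p - 1) * r ^ (-(s * p)) →
      tail s p k u ξ₀ (r / 2) ≤ ENNReal.ofReal (Λ * ε ^ (p - 1) * r ^ (-(s * p))) →
      ∫⁻ ξ in hball ξ₀ r, ENNReal.ofReal (max (k - u ξ) 0 ^ p)
        ≤ ENNReal.ofReal (ν * (ε ^ p * r ^ homDim n)) →
      ∀ᵐ ξ ∂(volume.restrict (hball ξ₀ (r / 2))), k - ε ≤ u ξ := by
  have hp0 : 0 < p := by linarith
  have hQ := homDim_pos (n := n)
  have hsp : 0 < s * p := by positivity
  have hq : 0 < homDim n + s * p := by positivity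
  obtain ⟨c, C, hc, hC, hdb⟩ := hd.exists_inv_rpow_bounds hq
  have hd0 : ∀ h, 0 ≤ (d h ^ (homDim n + s * p))⁻¹ := fun h => by
    have := hd.nonneg h; positivity
  have hIfin := lintegral_cutKernel_one_lt_top (n := n) hs hs1 hp
  set I := (∫⁻ h : Heis n, cutKernel s p 1 h).toReal with hI
  have hIe : ∫⁻ h : Heis n, cutKernel s p 1 h = ENNReal.ofReal I :=
    (ENNReal.ofReal_toReal hIfin.ne).symm
  have hI0 : 0 ≤ I := ENNReal.toReal_nonneg
  set m := (volume (hball (0 : Heis n) 1)).toReal with hm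
  have hme : volume (hball (0 : Heis n) 1) = ENNReal.ofReal m :=
    (ENNReal.ofReal_toReal (volume_hball_lt_top _ _).ne).symm
  have hm0 : 0 < m :=
    ENNReal.toReal_pos (volume_hball_pos _ one_pos).ne' (volume_hball_lt_top _ _).ne
  set σ := s * p / homDim n with hσ
  have hσ0 : 0 < σ := by positivity
  set κ := homDim n + s * p + p + p * σ with hκ
  have hκ0 : 0 < κ := by positivity
  set N := max 1 (2 * (2 * C * p ^ p * I + (2 * C + 1) * Λ) / (c * m)) * (2 / m) ^ σ with hN
  have hN0 : 0 < N := by positivity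
  -- At step j the factor (8 · 2^j)^κ appears, and it splits into 8^κ and (2^κ)^j.
  obtain ⟨ν, hν, hconv⟩ := exists_tendsto_zero_of_superlinear (N := N * 8 ^ κ) (B := 2 ^ κ) (σ := σ)
    (by positivity) (Real.one_lt_rpow one_lt_two hκ0) hσ0
  refine ⟨ν, hν, fun Ω f u hu hum ξ₀ r k ε F hr hε hrΩ hF hFle htail hstart => ?_⟩
  -- the iteration
  set rad : ℕ → ℝ := fun j => r / 2 * (1 + (2⁻¹) ^ j) with hrad
  set lev : ℕ → ℝ := fun j => k - ε * (1 - (2⁻¹) ^ j) with hlev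
  have hhalf0 : ∀ j : ℕ, 0 < ((2 : ℝ)⁻¹) ^ j := fun j => by positivity
  have hhalf1 : ∀ j : ℕ, ((2 : ℝ)⁻¹) ^ j ≤ 1 := fun j => pow_le_one₀ (by norm_num) (by norm_num)
  have hrad_le : ∀ j, rad j ≤ r := fun j => by
    have := hhalf1 j
    simp only [hrad]; nlinarith
  have hrad_gt : ∀ j, r / 2 < rad j := fun j => by
    have := hhalf0 j
    simp only [hrad]; nlinarith
  have hlev_le : ∀ j, lev j ≤ k := fun j => by
    have := hhalf1 j
    simp only [hlev]; nlinarith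
  set Y : ℕ → ℝ≥0∞ := fun j =>
    ∫⁻ ξ in hball ξ₀ (rad j), ENNReal.ofReal (max (lev j - u ξ) 0 ^ p) with hY
  have hsob : ∀ ρ, ρ ≤ r → MemFracSobolev s p (hball ξ₀ ρ) u := fun ρ hρ =>
    hu.memLoc _ (isOpen_hball _ _) (isCompact_closure_hball _ _)
      ((closure_mono (hball_mono hρ)).trans ((closure_hball_subset _ _).trans hrΩ))
  have hYfin : ∀ j, Y j ≠ ⊤ := fun j =>
    (lintegral_trunc_lt_top hp (isCompact_closure_hball _ _) (hsob _ (hrad_le j)).1 _).ne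
  have hYe : ∀ j, Y j = ENNReal.ofReal (Y j).toReal := fun j => (ENNReal.ofReal_toReal (hYfin j)).symm
  have hstep : ∀ j, (Y (j + 1)).toReal ≤
      N * (8 * 2 ^ j) ^ κ * (((Y j).toReal / (ε ^ p * r ^ homDim n)) ^ σ * (Y j).toReal) := by
    intro j
    set b : ℝ := 2 ^ j with hb
    have hb1 : 1 ≤ b := one_le_pow₀ (by norm_num)
    have hb0 : 0 < b := by linarith
    have hbinv : ((2 : ℝ)⁻¹) ^ j = b⁻¹ := by rw [inv_pow]
    -- A quarter of r / 2^(j+1), so that R + 2δ is the previous radius: one δ for the cutoff to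
    -- decay, one to separate its support from the tail region.
    set δ := r / (8 * b) with hδ
    have hδ0 : 0 < δ := by positivity
    set R := rad (j + 1) with hR
    have hR0 : 0 < R := by linarith [hrad_gt (j + 1)]
    have hRδ : R + 2 * δ = rad j := by
      simp only [hR, hrad, hδ, pow_succ, hbinv]
      field_simp; ring
    set t := ε / (2 * b) with ht
    have ht0 : 0 < t := by positivity
    have hlevt : lev (j + 1) = lev j - t := by
      simp only [hlev, ht, pow_succ, hbinv]
      field_simp; ring
    set y₁ := (Y (j + 1)).toReal with hy₁
    set y₃ := (Y j).toReal with hy₃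
    have hy₁0 : 0 ≤ y₁ := ENNReal.toReal_nonneg
    have hy₃0 : 0 ≤ y₃ := ENNReal.toReal_nonneg
    have hY₃' : ∫⁻ ξ in hball ξ₀ (rad j), ENNReal.ofReal (max (lev (j + 1) - u ξ) 0 ^ p) ≤ Y j := by
      refine lintegral_mono fun ξ => ENNReal.ofReal_le_ofReal ?_
      exact Real.rpow_le_rpow (le_max_right _ _) (max_le_max (by linarith) le_rfl) hp0.le
    have hYmono : Y (j + 1) ≤ Y j := by
      refine le_trans (lintegral_mono_set (hball_mono ?_)) hY₃'
      linarith
    refine deGiorgi_step_real hQ hs hp hc hC hm0 hI0 hΛ hε hr hb1 hy₁0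
      (ENNReal.toReal_mono (hYfin j) hYmono) fun ρ hρ hρ' => ?_
    have hρδ : ρ ≤ 2 * δ := by
      refine hρ'.trans (le_of_eq ?_)
      rw [hδ]; field_simp; ring
    have hW : ∫⁻ ξ in hball ξ₀ (rad j), ENNReal.ofReal (max (lev (j + 1) - u ξ) 0) ≤
        ENNReal.ofReal (t ^ (-(p - 1)) * y₃) := by
      refine (lintegral_trunc_le hp.le ht0 hlevt).trans (le_of_eq ?_)
      rw [ENNReal.ofReal_mul (by positivity), hy₃, ← hYe]
    have hA : volume ({ξ | u ξ < lev (j + 1)} ∩ hball ξ₀ (rad j)) ≤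
        ENNReal.ofReal (t ^ (-p) * y₃) := by
      refine (volume_lt_le_lintegral_trunc hp0.le hum ht0 hlevt).trans (le_of_eq ?_)
      rw [ENNReal.ofReal_mul (by positivity), hy₃, ← hYe]
    -- the three energy estimates
    have hRr : R + δ < r := by linarith [hrad_le j]
    have hlower := lintegral_neg_energy_testFun_ge (k := lev (j + 1)) (ξ₀ := ξ₀) (R := R) hp hs hum
      hd.continuous.measurable hδ0 hρδ hρ hc.le (fun h => (hdb h).1)
    -- Every tail that occurs is bounded by the single one at the top level k off the smallest ball
    -- B_{r/2}.
    have hupper := lintegral_energy_testFun_le (k := lev (j + 1)) (k₀ := k) (ξ₀ := ξ₀) (R := R)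
      (r := r) (ρ := r / 2) hp hs hum hR0 hδ0 (hRδ.le.trans (hrad_le j)) (hlev_le _)
      (by linarith [hrad_gt j]) hC.le hd0 (fun h => (hdb h).2)
    have hweak := hu.lintegral_neg_energy_le hs hs1 hp hd hum (isOpen_hball ξ₀ r)
      (isCompact_closure_hball ξ₀ r) ((closure_hball_subset ξ₀ r).trans hrΩ)
      (isCompact_closedHball ξ₀ (R + δ)) (closedHball_subset_hball hRr) hF
      (measurable_testFun (p := p) (k := lev (j + 1)) (ξ₀ := ξ₀) (R := R) (δ := δ) hum)
      (fun ξ => testFun_nonneg)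
      (fun ξ hξ => testFun_eq_zero hp hδ0 fun h => hξ (hball_subset_closedHball _ _ h))
      (memLp_testFun hp hδ0 hum (hsob _ hRr.le).1)
      (memLp_diffQuot_testFun hs hs1 hp hδ0 hum (hsob _ hRr.le))
    have htest : ∫⁻ ξ, ENNReal.ofReal (testFun p (lev (j + 1)) u ξ₀ R δ ξ) ≤
        ENNReal.ofReal (t ^ (-(p - 1)) * y₃) := by
      refine le_trans ?_ hW
      rw [← lintegral_indicator (measurableSet_hball _ _)]
      refine lintegral_mono fun ξ => ?_
      by_cases h : ξ ∈ hball ξ₀ (rad j)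
      · rw [indicator_of_mem h]
        exact ENNReal.ofReal_le_ofReal (testFun_le hp)
      · rw [testFun_eq_zero hp hδ0 fun h' => h (hball_mono (by linarith) h')]
        simp
    rw [hRδ] at hlower hupper
    have hfinal := hlower.trans (hweak.trans (add_le_add_left hupper _))
    have hFle' : ENNReal.ofReal F ≤ ENNReal.ofReal (Λ * ε ^ (p - 1) * r ^ (-(s * p))) :=
      ENNReal.ofReal_le_ofReal hFle
    have hLHS : ENNReal.ofReal (c * ρ ^ (-(homDim n + s * p)) *
        (ρ ^ homDim n * m - t ^ (-p) * y₃) * y₁) ≤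
        ENNReal.ofReal (c * ρ ^ (-(homDim n + s * p))) *
        (volume (hball (0 : Heis n) ρ)
          - volume ({ξ | u ξ < lev (j + 1)} ∩ hball ξ₀ (rad j))) * Y (j + 1) := by
      rw [ENNReal.ofReal_mul' hy₁0, ENNReal.ofReal_mul (by positivity), hy₁, ← hYe,
        ENNReal.ofReal_sub _ (by positivity), volume_hball _ hρ, hme,
        ← ENNReal.ofReal_mul (by positivity)]
      gcongr
    have hRHS := calc
      _ ≤ _ := hLHS
      _ ≤ _ := hfinal
      _ ≤ ENNReal.ofReal C * (ENNReal.ofReal (p ^ p) * (ENNReal.ofReal 2 * (ENNReal.ofReal y₃ *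
          (ENNReal.ofReal (δ⁻¹ ^ (s * p)) * ENNReal.ofReal I)))
        + ENNReal.ofReal 2 * (ENNReal.ofReal (t ^ (-(p - 1)) * y₃) *
          (ENNReal.ofReal ((r / δ) ^ (homDim n + s * p)) *
            ENNReal.ofReal (Λ * ε ^ (p - 1) * r ^ (-(s * p))))))
        + ENNReal.ofReal (Λ * ε ^ (p - 1) * r ^ (-(s * p))) *
          ENNReal.ofReal (t ^ (-(p - 1)) * y₃) := by
          rw [hIe, hy₃, ← hYe, ENNReal.ofReal_ofNat]
          gcongr
      _ = ENNReal.ofReal (C * (p ^ p * (2 * (y₃ * (δ⁻¹ ^ (s * p) * I)))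
          + 2 * ((t ^ (-(p - 1)) * y₃) *
            ((r / δ) ^ (homDim n + s * p) * (Λ * ε ^ (p - 1) * r ^ (-(s * p))))))
          + Λ * ε ^ (p - 1) * r ^ (-(s * p)) * (t ^ (-(p - 1)) * y₃)) := by
          have h1 : 0 ≤ t ^ (-(p - 1)) * y₃ := by positivity
          have h2 : 0 ≤ Λ * ε ^ (p - 1) * r ^ (-(s * p)) := by positivity
          have h3 : 0 ≤ δ⁻¹ ^ (s * p) * I := by positivity
          have h4 : 0 ≤ (r / δ) ^ (homDim n + s * p) := by positivity
          rw [ENNReal.ofReal_add (by positivity) (by positivity), ENNReal.ofReal_mul hC.le,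
            ENNReal.ofReal_add (by positivity) (by positivity), ENNReal.ofReal_mul (p := p ^ p)
            (by positivity), ENNReal.ofReal_mul (p := 2) (by positivity),
            ENNReal.ofReal_mul (p := 2) (by positivity), ENNReal.ofReal_mul h1,
            ENNReal.ofReal_mul h4, ENNReal.ofReal_mul h2, ENNReal.ofReal_mul hy₃0,
            ENNReal.ofReal_mul (p := δ⁻¹ ^ (s * p)) (by positivity)]
    refine (ENNReal.ofReal_le_ofReal_iff ?_).1 hRHS
    positivity
  -- convergence
  set D := ε ^ p * r ^ homDim n with hD
  have hD0 : 0 < D := by positivity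
  have hlim : Tendsto (fun j => (Y j).toReal / D) atTop (𝓝 0) := by
    refine hconv _ (fun j => by positivity) (fun j => ?_) ?_
    · have h1 := hstep j
      have e : (8 * 2 ^ j : ℝ) ^ κ = 8 ^ κ * (2 ^ κ) ^ j := by
        rw [Real.mul_rpow (by norm_num) (by positivity), ← Real.rpow_natCast, ← Real.rpow_natCast,
          ← Real.rpow_mul (by norm_num), ← Real.rpow_mul (by norm_num), mul_comm (j : ℝ)]
      rw [e] at h1
      rw [div_le_iff₀ hD0]
      refine h1.trans (le_of_eq ?_)
      have : (Y j).toReal = (Y j).toReal / D * D := by field_simp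
      rw [mul_assoc (N * 8 ^ κ * (2 ^ κ) ^ j), mul_assoc (((Y j).toReal / D) ^ σ), ← this]
      ring
    · rw [div_le_iff₀ hD0]
      refine ENNReal.toReal_le_of_le_ofReal (by positivity) (le_trans (le_of_eq ?_) hstart)
      have e : r / 2 * (1 + 1) = r := by ring
      simp [hY, hrad, hlev, e]
  have hlim' : Tendsto (fun j => (Y j).toReal) atTop (𝓝 0) := by
    have := hlim.mul_const D
    rw [zero_mul] at this
    refine this.congr fun j => ?_
    field_simp
  have hlimY : Tendsto Y atTop (𝓝 0) := by
    have := ENNReal.tendsto_ofReal hlim'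
    rw [ENNReal.ofReal_zero] at this
    refine this.congr fun j => (hYe j).symm
  have hzero : ∫⁻ ξ in hball ξ₀ (r / 2), ENNReal.ofReal (max (k - ε - u ξ) 0 ^ p) = 0 := by
    refine le_antisymm (ge_of_tendsto' hlimY fun j => ?_) zero_le
    calc _ ≤ ∫⁻ ξ in hball ξ₀ (r / 2), ENNReal.ofReal (max (lev j - u ξ) 0 ^ p) := by
          refine lintegral_mono fun ξ => ENNReal.ofReal_le_ofReal ?_
          refine Real.rpow_le_rpow (le_max_right _ _) (max_le_max ?_ le_rfl) hp0.le
          have := hhalf0 j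
          simp only [hlev]; nlinarith
      _ ≤ _ := lintegral_mono_set (hball_mono (hrad_gt j).le)
  rw [lintegral_eq_zero_iff (by fun_prop)] at hzero
  filter_upwards [hzero] with ξ hξ
  by_contra hcon
  have h1 : 0 < max (k - ε - u ξ) 0 ^ p :=
    Real.rpow_pos_of_pos (lt_max_of_lt_left (by linarith)) _
  have h2 := ENNReal.ofReal_eq_zero.1 hξ
  linarith

end DeGiorgi

end Heis
end

noncomputable section
namespace Heis
variable {n : ℕ}

/-! ### Reductions and local lower bounds -/

variable {s p : ℝ} {d : Heis n → ℝ} {Ω : Set (Heis n)} {f : Heis n → ℝ → ℝ} {u : Heis n → ℝ}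

/-- The null set in the bound for f(·, x) depends on x. Rational x and continuity in x give one null
set for all x, so that x = u(ξ) may be inserted. -/
theorem IsDatum.exists_bound (hf : IsDatum Ω f) {K : Set (Heis n)} (hK : IsCompact K)
    (hKΩ : K ⊆ Ω) : ∃ F : ℝ, ∀ᵐ ξ ∂(volume.restrict K), ∀ x, |f ξ x| ≤ F := by
  obtain ⟨C, hC⟩ := hf.uniform K hK hKΩ
  refine ⟨C, ?_⟩
  have h : ∀ᵐ ξ ∂(volume.restrict K), ∀ q : ℚ, |f ξ q| ≤ C := ae_all_iff.2 fun q => hC q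
  filter_upwards [h, ae_restrict_of_ae hf.continuous] with ξ h1 h2 x
  exact Rat.denseRange_cast.induction_on (p := fun x : ℝ => |f ξ x| ≤ C) x
    (isClosed_le h2.abs continuous_const) h1

theorem IsWeakSupersolution.congr_ae (hu : IsWeakSupersolution s p d f Ω u) {v : Heis n → ℝ}
    (h : u =ᵐ[volume] v) : IsWeakSupersolution s p d f Ω v := by
  have hprod : ∀ μ : Measure (Heis n), μ ≪ volume → SFinite μ →
      ∀ᵐ z ∂(μ.prod μ), u z.1 = v z.1 ∧ u z.2 = v z.2 := by
    intro μ hμ _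
    have hμ' : ∀ᵐ ξ ∂μ, u ξ = v ξ := hμ.ae_le h
    exact (Measure.quasiMeasurePreserving_fst.ae hμ').and
      (Measure.quasiMeasurePreserving_snd.ae hμ')
  refine ⟨hu.measurable.congr h, fun D hD hDc hDΩ => ?_, ⟨fun K hK => ?_, ?_⟩,
    fun ψ h1 h2 h3 h4 => ?_⟩
  · obtain ⟨ha, hb⟩ := hu.memLoc D hD hDc hDΩ
    refine ⟨ha.ae_eq (ae_restrict_of_ae h), hb.ae_eq ?_⟩
    filter_upwards [hprod _ Measure.restrict_le_self.absolutelyContinuous inferInstance] with z hz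
    rw [hz.1, hz.2]
  · refine (hu.negPart.1 K hK).ae_eq (ae_restrict_of_ae ?_)
    filter_upwards [h] with ξ hξ
    rw [hξ]
  · refine hu.negPart.2.congr ?_
    filter_upwards [h] with ξ hξ
    rw [hξ]
  · obtain ⟨ha, hb⟩ := hu.weak ψ h1 h2 h3 h4
    have hE : energyIntegrand s p d u ψ
        =ᵐ[(volume : Measure (Heis n)).prod volume] energyIntegrand s p d v ψ := by
      filter_upwards [hprod volume Measure.AbsolutelyContinuous.rfl inferInstance] with z hz
      simp only [energyIntegrand, hz.1, hz.2]
    refine ⟨ha.congr hE, ?_⟩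
    rw [← integral_congr_ae hE]
    refine le_of_eq_of_le (integral_congr_ae ?_) hb
    filter_upwards [h] with ξ hξ
    rw [hξ]

theorem essLiminf_congr_ae {v : Heis n → ℝ} (h : u =ᵐ[volume] v) : essLiminf u = essLiminf v := by
  funext ξ
  unfold essLiminf
  refine iSup_congr fun r => iSup_congr fun _ => essInf_congr_ae ?_
  filter_upwards [ae_restrict_of_ae h] with η hη
  rw [hη]

theorem IsWeakSupersolution.tail_lt_top (hu : IsWeakSupersolution s p d f Ω u) (hs : 0 < s)
    (hs1 : s < 1) (hp : 1 < p) (k : ℝ) (ξ₀ : Heis n) {R : ℝ} (hR : 0 < R) :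
    tail s p k u ξ₀ R < ⊤ := by
  have hQ := homDim_pos (n := n)
  have hq : 0 ≤ homDim n + s * p := by positivity
  obtain ⟨C, hC, hCb⟩ := exists_kern_le_weight hq (isCompact_singleton (x := ξ₀))
    (isOpen_hball ξ₀ R) (singleton_subset_iff.2 (mem_hball_self hR))
  have hfin := hu.negPart.lintegral_one_add_lt_top hs hs1 hp (fun _ => le_max_right _ _) |k|
    (abs_nonneg k)
  refine lt_of_le_of_lt ?_ (ENNReal.mul_lt_top (ENNReal.ofReal_lt_top (r := C)) hfin)
  rw [← lintegral_const_mul' _ _ ENNReal.ofReal_ne_top]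
  unfold tail
  refine (setLIntegral_mono_ae' (measurableSet_hball _ _).compl (ae_of_all _ fun η hη => ?_)).trans
    (setLIntegral_le_lintegral _ _)
  have h0 : 0 ≤ max (-u η) 0 := le_max_right _ _
  have hk : max (k - u η) 0 ≤ |k| + max (-u η) 0 :=
    max_le (by linarith [le_abs_self k, le_max_left (-u η) 0]) (by positivity)
  have h1 : max (k - u η) 0 ^ (p - 1) ≤ (|k| + max (-u η) 0) ^ (p - 1) :=
    Real.rpow_le_rpow (le_max_right _ _) hk (by linarith)
  rw [kern_comm, kern, ← ENNReal.ofReal_mul (Real.rpow_nonneg (le_max_right _ _) _),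
    ← ENNReal.ofReal_mul hC]
  refine ENNReal.ofReal_le_ofReal ?_
  calc _ ≤ (|k| + max (-u η) 0) ^ (p - 1) * (C * (1 + hnorm η) ^ (-(homDim n + s * p))) :=
        mul_le_mul h1 (hCb ξ₀ rfl η hη) (Real.rpow_nonneg (hnorm_nonneg _) _) (by positivity)
    _ = _ := by ring

/-- On one fixed ball, with level 0, the tail, the datum and the integral of u_-^p are finite
numbers. All three are admissible in the De Giorgi lemma once ε is large, because ε^(p-1) and ε^p
tend to infinity. -/
theorem IsWeakSupersolution.exists_lower_bound (hs : 0 < s) (hs1 : s < 1) (hp : 1 < p)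
    (hd : IsHomogeneousNorm d) (hΩ : IsOpen Ω) (hf : IsDatum Ω f)
    (hu : IsWeakSupersolution s p d f Ω u) (hum : Measurable u) {ξ₀ : Heis n} (hξ₀ : ξ₀ ∈ Ω) :
    ∃ R M : ℝ, 0 < R ∧ closedHball ξ₀ R ⊆ Ω ∧
      ∀ᵐ ξ ∂(volume.restrict (hball ξ₀ R)), -M ≤ u ξ := by
  have hp0 : 0 < p := by linarith
  obtain ⟨r, hr, hrΩ⟩ := exists_closedHball_subset hΩ hξ₀
  obtain ⟨F, hF⟩ := hf.exists_bound (isCompact_closedHball ξ₀ r) hrΩ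
  obtain ⟨ν, hν, key⟩ := exists_deGiorgi (n := n) hs hs1 hp hd (zero_le_one' ℝ)
  have hT := hu.tail_lt_top hs hs1 hp 0 ξ₀ (half_pos hr)
  have hsub := (closure_hball_subset ξ₀ r).trans hrΩ
  have hY := lintegral_trunc_lt_top hp (isCompact_closure_hball ξ₀ r)
    (hu.memLoc _ (isOpen_hball ξ₀ r) (isCompact_closure_hball ξ₀ r) hsub).1 0
  have l1 : Tendsto (fun ε : ℝ => 1 * ε ^ (p - 1) * r ^ (-(s * p))) atTop atTop :=
    ((tendsto_rpow_atTop (by linarith)).const_mul_atTop one_pos).atTop_mul_const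
      (Real.rpow_pos_of_pos hr _)
  have l2 : Tendsto (fun ε : ℝ => ν * (ε ^ p * r ^ homDim n)) atTop atTop :=
    ((tendsto_rpow_atTop hp0).atTop_mul_const (Real.rpow_pos_of_pos hr _)).const_mul_atTop hν
  obtain ⟨ε, ⟨hε1, hε2⟩, hε3, hε4⟩ := (((l1.eventually_ge_atTop F).and
    (l1.eventually_ge_atTop (tail s p 0 u ξ₀ (r / 2)).toReal)).and
    ((l2.eventually_ge_atTop (∫⁻ ξ in hball ξ₀ r, ENNReal.ofReal (max (0 - u ξ) 0 ^ p)).toReal).and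
    (eventually_gt_atTop 0))).exists
  refine ⟨r / 2, ε, half_pos hr, ?_, ?_⟩
  · exact (closedHball_subset_hball (by linarith)).trans
      ((hball_subset_closedHball ξ₀ r).trans hrΩ)
  have := key Ω f u hu hum ξ₀ r 0 ε F hr hε4 hrΩ
    (by filter_upwards [ae_restrict_of_ae_restrict_of_subset (hball_subset_closedHball ξ₀ r) hF]
          with ξ hξ using hξ _)
    hε1 ((ENNReal.le_ofReal_iff_toReal_le hT.ne (by positivity)).2 hε2)
    ((ENNReal.le_ofReal_iff_toReal_le hY.ne (by positivity)).2 hε3)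
  filter_upwards [this] with ξ hξ
  linarith

/-- Between radii r and R the truncation is at most (k + M)_+ and the kernel integrates to
O(r^(-sp)); beyond R the tail does not depend on r. This is the growth in r that the De Giorgi lemma
tolerates. -/
theorem tail_le_of_lower_bound {k M r R : ℝ} {ξ₀ : Heis n} (hp : 1 < p) (hr : 0 < r)
    (hM : ∀ᵐ ξ ∂(volume.restrict (hball ξ₀ R)), -M ≤ u ξ) :
    tail s p k u ξ₀ r ≤ ENNReal.ofReal (max (k + M) 0 ^ (p - 1)) *
      (ENNReal.ofReal (r ^ (-(s * p))) * ∫⁻ h : Heis n, cutKernel s p 1 h)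
      + tail s p k u ξ₀ R := by
  have hcov : (hball ξ₀ r)ᶜ ⊆ ((hball ξ₀ r)ᶜ ∩ hball ξ₀ R) ∪ (hball ξ₀ R)ᶜ := by
    intro ξ hξ
    by_cases h : ξ ∈ hball ξ₀ R
    · exact Or.inl ⟨hξ, h⟩
    · exact Or.inr h
  refine (lintegral_mono_set hcov).trans ((lintegral_union_le _ _ _).trans (add_le_add ?_ le_rfl))
  rw [ae_restrict_iff' (measurableSet_hball _ _)] at hM
  refine le_trans ?_ (mul_le_mul_right (lintegral_kern_compl_hball_le s p ξ₀ hr) _)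
  rw [← lintegral_const_mul' _ _ ENNReal.ofReal_ne_top]
  refine (setLIntegral_mono_ae'
    ((measurableSet_hball _ _).compl.inter (measurableSet_hball _ _)) ?_).trans
    (lintegral_mono_set inter_subset_left)
  filter_upwards [hM] with η hη hmem
  refine mul_le_mul_left (ENNReal.ofReal_le_ofReal ?_) _
  exact Real.rpow_le_rpow (le_max_right _ _)
    (max_le_max (by linarith [hη hmem.2]) le_rfl) (by linarith)

/-- If the truncation `(k - u)_+` has small `L^p`-mean on a small ball about `ξ₀`, then `u` is
almost at least `k` on the ball of half the radius. -/
theorem IsWeakSupersolution.exists_threshold (hs : 0 < s) (hs1 : s < 1) (hp : 1 < p)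
    (hd : IsHomogeneousNorm d) (hΩ : IsOpen Ω) (hf : IsDatum Ω f)
    (hu : IsWeakSupersolution s p d f Ω u) (hum : Measurable u) {ξ₀ : Heis n} (hξ₀ : ξ₀ ∈ Ω)
    (k : ℝ) {ε : ℝ} (hε : 0 < ε) :
    ∃ ν R : ℝ, 0 < ν ∧ 0 < R ∧ ∀ r, 0 < r → r ≤ R →
      ∫⁻ ξ in hball ξ₀ r, ENNReal.ofReal (max (k - u ξ) 0 ^ p)
        ≤ ENNReal.ofReal (ν * r ^ homDim n) →
      ∀ᵐ ξ ∂(volume.restrict (hball ξ₀ (r / 2))), k - ε ≤ u ξ := by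
  have hp0 : 0 < p := by linarith
  have hsp : 0 < s * p := by positivity
  obtain ⟨R, M, hR, hRΩ, hM⟩ := hu.exists_lower_bound hs hs1 hp hd hΩ hf hum hξ₀
  obtain ⟨F, hF⟩ := hf.exists_bound (isCompact_closedHball ξ₀ R) hRΩ
  have hTfin := hu.tail_lt_top hs hs1 hp k ξ₀ hR
  set T := (tail s p k u ξ₀ R).toReal with hT
  have hT0 : 0 ≤ T := ENNReal.toReal_nonneg
  have hTe : tail s p k u ξ₀ R = ENNReal.ofReal T := (ENNReal.ofReal_toReal hTfin.ne).symm
  have hIfin := lintegral_cutKernel_one_lt_top (n := n) hs hs1 hp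
  set I := (∫⁻ h : Heis n, cutKernel s p 1 h).toReal with hI
  have hIe : ∫⁻ h : Heis n, cutKernel s p 1 h = ENNReal.ofReal I :=
    (ENNReal.ofReal_toReal hIfin.ne).symm
  have hI0 : 0 ≤ I := ENNReal.toReal_nonneg
  set m := max (k + M) 0 ^ (p - 1) with hm
  have hm0 : 0 ≤ m := Real.rpow_nonneg (le_max_right _ _) _
  -- Constants are converted into multiples of r^(-sp) by 1 ≤ R^(sp) r^(-sp) for r ≤ R. The factor
  -- 2^(sp) appears because the tail is taken off B_{r/2}.
  set L := m * (2 ^ (s * p) * I) + T * R ^ (s * p) + |F| * R ^ (s * p) with hL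
  have hL0 : 0 ≤ L := by positivity
  have hεp : 0 < ε ^ (p - 1) := by positivity
  -- The choice Λ = L / ε^(p-1) makes Λ ε^(p-1) = L; since L does not involve r, one ν serves all r
  -- ≤ R.
  obtain ⟨ν, hν, key⟩ := exists_deGiorgi (n := n) hs hs1 hp hd (Λ := L / ε ^ (p - 1))
    (by positivity)
  refine ⟨ν * ε ^ p, R, by positivity, hR, fun r hr hrR hsmall => ?_⟩
  have hone : 1 ≤ R ^ (s * p) * r ^ (-(s * p)) := by
    rw [Real.rpow_neg hr.le, ← div_eq_mul_inv, one_le_div (by positivity)]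
    exact Real.rpow_le_rpow hr.le hrR hsp.le
  have hr' : (r / 2) ^ (-(s * p)) = 2 ^ (s * p) * r ^ (-(s * p)) := by
    rw [Real.div_rpow hr.le (by norm_num), Real.rpow_neg (by norm_num : (0 : ℝ) ≤ 2),
      div_inv_eq_mul, mul_comm]
  have hΛ : L / ε ^ (p - 1) * ε ^ (p - 1) * r ^ (-(s * p)) = L * r ^ (-(s * p)) := by
    rw [div_mul_cancel₀ _ hεp.ne']
  have hLr : L * r ^ (-(s * p)) = m * ((r / 2) ^ (-(s * p)) * I)
      + T * (R ^ (s * p) * r ^ (-(s * p))) + |F| * (R ^ (s * p) * r ^ (-(s * p))) := by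
    rw [hr', hL]; ring
  have hTr := le_mul_of_one_le_right hT0 hone
  have hFr := le_mul_of_one_le_right (abs_nonneg F) hone
  have hmr : 0 ≤ m * ((r / 2) ^ (-(s * p)) * I) := by positivity
  have hsub : hball ξ₀ r ⊆ closedHball ξ₀ R :=
    (hball_mono hrR).trans (hball_subset_closedHball ξ₀ R)
  refine key Ω f u hu hum ξ₀ r k ε F hr hε ?_ ?_ ?_ ?_ ?_
  · intro ξ hξ
    exact hRΩ (mem_closedHball.2 ((mem_closedHball.1 hξ).trans hrR))
  · filter_upwards [ae_restrict_of_ae_restrict_of_subset hsub hF] with ξ hξ using hξ _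
  · rw [hΛ, hLr]
    linarith [le_abs_self F]
  · refine (tail_le_of_lower_bound hp (half_pos hr) hM).trans ?_
    rw [hTe, hIe, hΛ, hLr, ← ENNReal.ofReal_mul (by positivity), ← ENNReal.ofReal_mul hm0,
      ← ENNReal.ofReal_add hmr hT0]
    exact ENNReal.ofReal_le_ofReal (by linarith [abs_nonneg F])
  · rwa [← mul_assoc]

end Heis
end

noncomputable section
namespace Heis
variable {n : ℕ}

/-! ### The pointwise statement -/

variable {s p : ℝ} {d : Heis n → ℝ} {Ω : Set (Heis n)} {f : Heis n → ℝ → ℝ} {u : Heis n → ℝ}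

/-- The uniform probability measure on the ball `B_r(0)`. -/
def ballMeasure (n : ℕ) (r : ℝ) : Measure (Heis n) :=
  ProbabilityTheory.cond volume (hball (0 : Heis n) r)

theorem isProbabilityMeasure_ballMeasure {r : ℝ} (hr : 0 < r) :
    IsProbabilityMeasure (ballMeasure n r) :=
  ProbabilityTheory.cond_isProbabilityMeasure_of_finite (volume_hball_pos _ hr).ne'
    (volume_hball_lt_top _ _).ne

theorem lintegral_hball_eq (ξ : Heis n) (r : ℝ) {G : Heis n → ℝ≥0∞} (hG : Measurable G) :
    ∫⁻ η in hball ξ r, G η = ∫⁻ h in hball (0 : Heis n) r, G (op ξ h) := by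
  rw [← lintegral_indicator (measurableSet_hball _ _),
    ← lintegral_op_left ξ (hG.indicator (measurableSet_hball _ _)),
    ← lintegral_indicator (measurableSet_hball _ _)]
  refine lintegral_congr fun h => ?_
  have : op ξ h ∈ hball ξ r ↔ h ∈ hball 0 r := by
    rw [mem_hball, mem_hball, inverse_op_cancel, inverse_zero, zero_op]
  by_cases hh : h ∈ hball 0 r
  · rw [indicator_of_mem hh, indicator_of_mem (this.2 hh)]
  · rw [indicator_of_notMem hh, indicator_of_notMem (fun hm => hh (this.1 hm))]

/-- A nonnegative integrable function has, at almost every of its zeros, arbitrarily small means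
over arbitrarily small balls. -/
theorem ae_exists_lintegral_hball_le {F : Heis n → ℝ} (hF : Integrable F) (hFm : Measurable F)
    (hF0 : ∀ ξ, 0 ≤ F ξ) :
    ∀ᵐ ξ : Heis n, F ξ = 0 → ∀ c R : ℝ, 0 < c → 0 < R → ∃ r, 0 < r ∧ r ≤ R ∧
      ∫⁻ η in hball ξ r, ENNReal.ofReal (F η) ≤ ENNReal.ofReal (c * r ^ homDim n) := by
  set ρ : ℕ → ℝ := fun i => 1 / ((i : ℝ) + 1) with hρ
  have hρ0 : ∀ i, 0 < ρ i := fun i => by simp only [hρ]; positivity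
  have hρl : Tendsto ρ atTop (𝓝 0) := tendsto_one_div_add_atTop_nhds_zero_nat
  have : ∀ i, IsProbabilityMeasure (ballMeasure n (ρ i)) :=
    fun i => isProbabilityMeasure_ballMeasure (hρ0 i)
  -- The mean over B_ρ(ξ) is the average of F(ξ ∘ h) over h in B_ρ(0), so the means converge to F in
  -- L¹ by continuity of right translations.
  have hlim := tendsto_eLpNorm_average_sub (μ := (volume : Measure (Heis n)))
    (τ := fun h ξ : Heis n => op ξ h) (g₀ := 0) (p := 1) (F := F) (l := atTop)
    (ν := fun i => ballMeasure n (ρ i))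
    (by unfold Function.uncurry; fun_prop) (by unfold Function.uncurry; fun_prop)
    measurePreserving_op_right op_zero le_rfl hFm
    (by rw [ENNReal.ofReal_one]; exact memLp_one_iff_integrable.2 hF) (by
      intro N hN
      obtain ⟨V, hVN, hVo, hV0⟩ := mem_nhds_iff.1 hN
      obtain ⟨δ, hδ, hδV⟩ := exists_closedHball_subset hVo hV0
      filter_upwards [hρl.eventually_lt_const hδ] with i hi
      have := ProbabilityTheory.ae_cond_mem (μ := (volume : Measure (Heis n)))
        (measurableSet_hball (0 : Heis n) (ρ i))
      filter_upwards [this] with h hh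
      exact hVN (hδV (hball_subset_closedHball _ _ (hball_mono hi.le hh))))
  have hmeas : ∀ i, Measurable fun ξ => ∫ h, F (op ξ h) ∂(ballMeasure n (ρ i)) := fun i => by
    have : Measurable fun z : Heis n × Heis n => F (op z.1 z.2) := by fun_prop
    exact this.stronglyMeasurable.integral_prod_right'.measurable
  have hconv : TendstoInMeasure volume
      (fun i ξ => ∫ h, F (op ξ h) ∂(ballMeasure n (ρ i))) atTop F := by
    refine tendstoInMeasure_of_tendsto_eLpNorm (p := ENNReal.ofReal 1) (by simp)
      (fun i => (hmeas i).aestronglyMeasurable) hFm.aestronglyMeasurable ?_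
    exact hlim
  -- Convergence along a subsequence of radii replaces Lebesgue differentiation; the De Giorgi lemma
  -- needs only one small radius.
  obtain ⟨φ, hφ, hae⟩ := hconv.exists_seq_tendsto_ae
  filter_upwards [hae] with ξ hξ h0 c R hc hR
  rw [h0] at hξ
  set b := (volume (hball (0 : Heis n) 1)).toReal with hb
  have hb0 : 0 < b := ENNReal.toReal_pos (volume_hball_pos _ one_pos).ne'
    (volume_hball_lt_top _ _).ne
  have hρφ : Tendsto (fun i => ρ (φ i)) atTop (𝓝 0) := hρl.comp hφ.tendsto_atTop
  obtain ⟨i, hi1, hi2⟩ := ((hξ.eventually_lt_const (div_pos hc hb0)).and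
    (hρφ.eventually_lt_const hR)).exists
  set r := ρ (φ i) with hr
  have hr0 : 0 < r := hρ0 _
  refine ⟨r, hr0, hi2.le, ?_⟩
  have hint : Integrable fun h => F (op ξ h) :=
    (measurePreserving_op_left ξ).integrable_comp_of_integrable hF
  rw [lintegral_hball_eq ξ r (by fun_prop), ← ofReal_integral_eq_lintegral_ofReal
    hint.integrableOn (ae_of_all _ fun h => hF0 _)]
  refine ENNReal.ofReal_le_ofReal ?_
  have hvol : (volume (hball (0 : Heis n) r)).toReal = r ^ homDim n * b := by
    rw [volume_hball _ hr0, ENNReal.toReal_mul, ENNReal.toReal_ofReal (by positivity)]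
  have havg : ∫ h, F (op ξ h) ∂(ballMeasure n r)
      = (r ^ homDim n * b)⁻¹ * ∫ h in hball (0 : Heis n) r, F (op ξ h) := by
    rw [ballMeasure, ProbabilityTheory.cond, integral_smul_measure, ENNReal.toReal_inv, hvol,
      smul_eq_mul]
  have hrQ : 0 < r ^ homDim n := by positivity
  rw [havg, inv_mul_lt_iff₀ (by positivity)] at hi1
  refine hi1.le.trans (le_of_eq ?_)
  field_simp

/-- Where u(ξ) ≥ k the function (k - u)_+^p vanishes, so at almost every such ξ it has a small mean
over some small ball, and the threshold lemma gives u ≥ k - ε on the half ball. Rational levels k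
below u(ξ) exhaust its value. -/
theorem IsWeakSupersolution.ae_le_essLiminf (hs : 0 < s) (hs1 : s < 1) (hp : 1 < p)
    (hd : IsHomogeneousNorm d) (hΩ : IsOpen Ω) (hf : IsDatum Ω f)
    (hu : IsWeakSupersolution s p d f Ω u) (hum : Measurable u) :
    ∀ᵐ ξ ∂(volume.restrict Ω), (u ξ : EReal) ≤ essLiminf u ξ := by
  have hp0 : 0 < p := by linarith
  have hk : ∀ k : ℝ, ∀ᵐ ξ ∂(volume.restrict Ω), k ≤ u ξ → ∀ ε > 0,
      ((k - ε : ℝ) : EReal) ≤ essLiminf u ξ := by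
    intro k
    rw [ae_restrict_iff' hΩ.measurableSet, ae_iff]
    -- The truncation is integrable only over balls compactly inside Ω, so the exceptional set is
    -- shown to be null locally.
    refine measure_null_of_locally_null _ fun a ha => ?_
    have haΩ : a ∈ Ω := by
      by_contra h
      exact ha fun h' => absurd h' h
    obtain ⟨ρ, hρ, hρΩ⟩ := exists_closedHball_subset hΩ haΩ
    refine ⟨_, inter_mem_nhdsWithin _ ((isOpen_hball a ρ).mem_nhds (mem_hball_self hρ)), ?_⟩
    set F : Heis n → ℝ := (hball a ρ).indicator fun ξ => max (k - u ξ) 0 ^ p with hFd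
    have hFm : Measurable F := Measurable.indicator (by fun_prop) (measurableSet_hball _ _)
    have hF0 : ∀ ξ, 0 ≤ F ξ := fun ξ =>
      indicator_nonneg (fun _ _ => Real.rpow_nonneg (le_max_right _ _) _) ξ
    have hF : Integrable F := by
      rw [hFd, integrable_indicator_iff (measurableSet_hball _ _)]
      refine ⟨Measurable.aestronglyMeasurable (by fun_prop), ?_⟩
      rw [hasFiniteIntegral_iff_ofReal
        (ae_of_all _ fun _ => Real.rpow_nonneg (le_max_right _ _) _)]
      exact lintegral_trunc_lt_top hp (isCompact_closure_hball a ρ)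
        (hu.memLoc _ (isOpen_hball a ρ) (isCompact_closure_hball a ρ)
          ((closure_hball_subset a ρ).trans hρΩ)).1 k
    have hae := ae_exists_lintegral_hball_le hF hFm hF0
    rw [ae_iff] at hae
    refine measure_mono_null (fun ξ hξ => ?_) hae
    obtain ⟨hξ, hξa⟩ := hξ
    refine fun hgood => hξ fun hξΩ hkξ ε hε => ?_
    have hFξ : F ξ = 0 := by
      rw [hFd, indicator_of_mem hξa, max_eq_right (by linarith), Real.zero_rpow hp0.ne']
    obtain ⟨ν, R, hν, hR, key⟩ :=
      hu.exists_threshold hs hs1 hp hd hΩ hf hum hξΩ k hε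
    have hgap : 0 < ρ - hnorm (op (inverse a) ξ) := sub_pos.2 hξa
    obtain ⟨r, hr, hrR, hle⟩ := hgood hFξ ν (min R (ρ - hnorm (op (inverse a) ξ))) hν
      (lt_min hR hgap)
    have hsub : hball ξ r ⊆ hball a ρ :=
      hball_subset_hball (by linarith [hrR.trans (min_le_right _ _)])
    have hae' := key r hr (hrR.trans (min_le_left _ _)) (by
      refine le_trans (le_of_eq ?_) hle
      refine setLIntegral_congr_fun (measurableSet_hball _ _) fun η hη => ?_
      simp only [hFd, indicator_of_mem (hsub hη)])
    refine le_iSup₂_of_le (r / 2) (half_pos hr) (le_essInf_of_ae_le _ ?_)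
    filter_upwards [hae'] with η hη
    exact EReal.coe_le_coe_iff.2 hη
  have hall : ∀ᵐ ξ ∂(volume.restrict Ω), ∀ k : ℚ, (k : ℝ) ≤ u ξ → ∀ ε > 0,
      (((k : ℝ) - ε : ℝ) : EReal) ≤ essLiminf u ξ := ae_all_iff.2 fun k => hk k
  filter_upwards [hall] with ξ hξ
  refine EReal.ge_of_forall_gt_iff_ge.1 fun x hx => ?_
  have hx' : x < u ξ := EReal.coe_lt_coe_iff.1 hx
  obtain ⟨q, hq1, hq2⟩ := exists_rat_btwn hx'
  have := hξ q hq2.le (q - x) (by linarith)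
  rwa [sub_sub_cancel] at this

/-- If u < q < ess lim inf u at a point, then u > q a.e. on a ball about it, so the set of such
points is null in that ball. Locally null sets are null, and the rational q are countable. -/
theorem ae_essLiminf_le (u : Heis n → ℝ) : ∀ᵐ ξ : Heis n, essLiminf u ξ ≤ u ξ := by
  have hq : ∀ q : ℚ, ∀ᵐ ξ : Heis n, u ξ < q → essLiminf u ξ ≤ ((q : ℝ) : EReal) := by
    intro q
    rw [ae_iff]
    refine measure_null_of_locally_null _ fun a ha => ?_
    have ha' : ¬ (u a < q → essLiminf u a ≤ ((q : ℝ) : EReal)) := ha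
    push Not at ha'
    obtain ⟨r, hr⟩ := lt_iSup_iff.1 ha'.2
    obtain ⟨hr0, hr⟩ := lt_iSup_iff.1 hr
    refine ⟨_, inter_mem_nhdsWithin _ ((isOpen_hball a r).mem_nhds (mem_hball_self hr0)), ?_⟩
    have hlt := ae_lt_of_lt_essInf hr
    rw [ae_restrict_iff' (measurableSet_hball _ _), ae_iff] at hlt
    refine measure_mono_null (fun ξ hξ => ?_) hlt
    exact fun h => hξ.1 fun h' => absurd (EReal.coe_lt_coe_iff.1 (h hξ.2)) (not_lt.2 h'.le)
  filter_upwards [ae_all_iff.2 hq] with ξ hξ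
  refine EReal.le_of_forall_lt_iff_le.1 fun x hx => ?_
  obtain ⟨q, hq1, hq2⟩ := exists_rat_btwn (EReal.coe_lt_coe_iff.1 hx)
  exact (hξ q hq1).trans (EReal.coe_le_coe_iff.2 hq2.le)

/-- A ball about ξ contains a ball about each of its points η, and the essential infimum over the
smaller ball is at least as large. -/
theorem lowerSemicontinuous_essLiminf (u : Heis n → ℝ) : LowerSemicontinuous (essLiminf u) := by
  intro ξ y hy
  obtain ⟨r, hr⟩ := lt_iSup_iff.1 hy
  obtain ⟨hr0, hr⟩ := lt_iSup_iff.1 hr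
  filter_upwards [(isOpen_hball ξ r).mem_nhds (mem_hball_self hr0)] with η hη
  have hgap : 0 < r - hnorm (op (inverse ξ) η) := sub_pos.2 hη
  refine hr.trans_le (le_iSup₂_of_le _ hgap (essInf_antitone_measure ?_))
  exact (Measure.restrict_mono (hball_subset_hball (by linarith)) le_rfl).absolutelyContinuous

theorem IsWeakSupersolution.essLiminf_ne_bot (hs : 0 < s) (hs1 : s < 1) (hp : 1 < p)
    (hd : IsHomogeneousNorm d) (hΩ : IsOpen Ω) (hf : IsDatum Ω f)
    (hu : IsWeakSupersolution s p d f Ω u) (hum : Measurable u) {ξ : Heis n} (hξ : ξ ∈ Ω) :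
    essLiminf u ξ ≠ ⊥ := by
  obtain ⟨R, M, hR, -, hM⟩ := hu.exists_lower_bound hs hs1 hp hd hΩ hf hum hξ
  refine ne_bot_of_le_ne_bot (EReal.coe_ne_bot (-M)) (le_iSup₂_of_le R hR
    (le_essInf_of_ae_le _ ?_))
  filter_upwards [hM] with η hη
  exact EReal.coe_le_coe_iff.2 hη

end Heis
end

/-! ### The theorem -/

theorem mainTheorem6 (n : ℕ) (hn : 1 ≤ n) (s p : ℝ) (hs : 0 < s) (hs1 : s < 1) (hp : 1 < p)
    (d : Heis n → ℝ) (hd : Heis.IsHomogeneousNorm d)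
    (Ω : Set (Heis n)) (hΩ : IsOpen Ω)
    (f : Heis n → ℝ → ℝ) (hf : Heis.IsDatum Ω f)
    (u : Heis n → ℝ) (hu : Heis.IsWeakSupersolution s p d f Ω u) :
    (∀ᵐ ξ ∂(volume.restrict Ω), (u ξ : EReal) = Heis.essLiminf u ξ) ∧
    ∃ v : Heis n → EReal,
      LowerSemicontinuousOn v Ω ∧ (∀ ξ ∈ Ω, v ξ ≠ ⊥) ∧
        ∀ᵐ ξ ∂(volume.restrict Ω), (u ξ : EReal) = v ξ := by
  -- The estimates are stated for Borel functions. Being a supersolution and the ess lim inf are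
  -- unaffected by changes on null sets, so u may be replaced by a Borel representative.
  have hae := hu.measurable.ae_eq_mk
  have hu' := hu.congr_ae hae
  have hum := hu.measurable.stronglyMeasurable_mk.measurable
  have hlim := Heis.essLiminf_congr_ae hae
  have hmain : ∀ᵐ ξ ∂(volume.restrict Ω), (u ξ : EReal) = Heis.essLiminf u ξ := by
    filter_upwards [hu'.ae_le_essLiminf hs hs1 hp hd hΩ hf hum,
      ae_restrict_of_ae (Heis.ae_essLiminf_le u), ae_restrict_of_ae hae] with ξ h1 h2 h3
    refine le_antisymm ?_ h2
    rw [h3, hlim]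
    exact h1
  refine ⟨hmain, Heis.essLiminf u,
    (Heis.lowerSemicontinuous_essLiminf u).lowerSemicontinuousOn Ω, fun ξ hξ => ?_, hmain⟩
  rw [hlim]
  exact hu'.essLiminf_ne_bot hs hs1 hp hd hΩ hf hum hξ
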